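/- Let $S$ be a Noetherian local ring with maximal ideal $\mathbf m$ and residue field $k$, let $f_1,\dots,f_c\in S$ be a regular sequence, and put $R(p)=S/(f_1,\dots,f_p)$ for $0\le p\le c$ and $R=R(c)$. A *higher matrix factorization* $(d,h)$ with respect to $f_1,\dots,f_c$ consists of finitely generated free $S$-modules $A_0,A_1$ with filtrations $0=A_s(0)\subseteq A_s(1)\subseteq\cdots\subseteq A_s(c)=A_s$ ($s=0,1$) such that each $A_s(p-1)$ is a free direct summand of the free module $A_s(p)$, and of filtration-preserving maps $\bigoplus_{q=1}^c A_0(q)\xrightarrow{h}A_1\xrightarrow{d}A_0$ (where $\bigoplus_q A_0(q)$ is filtered by the submodules $\bigoplus_{q\le p}A_0(q)$), such that, with $A_0(p)\xrightarrow{h_p}A_1(p)\xrightarrow{d_p}A_0(p)$ the induced maps, $B_s(p)=A_s(p)/A_s(p-1)$ and $\pi_p:A_1(p)\to B_1(p)$ the projection, one has for $1\le p\le c$ $$d_ph_p\equiv f_p\,\mathrm{Id}\ \bmod (f_1,\dots,f_{p-1})A_0(p),\qquad \pi_ph_pd_p\equiv f_p\,\pi_p\ \bmod (f_1,\dots,f_{p-1})B_1(p).$$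 Its module is the $R$-module $M=\mathrm{Coker}(R\otimes d)$. It is *minimal* if $d(A_1)\subseteq\mathbf mA_0$ and $h(\bigoplus_qA_0(q))\subseteq\mathbf mA_1$. It is *pre-stable* if for each $1\le p\le c$ the element $f_p$ is a non-zerodivisor on the cokernel of the composite $$R(p-1)\otimes A_0(p-1)\to R(p-1)\otimes A_0(p)\xrightarrow{h_p}R(p-1)\otimes A_1(p)\xrightarrow{\pi_p}R(p-1)\otimes B_1(p).$$ For a finitely generated module $N$ over a Noetherian local ring $Q$ with residue field $k$, let $b^Q_i(N)=\dim_k\mathrm{Tor}^Q_i(N,k)$, $\mathcal P^Q_N(x)=\sum_i b_i^Q(N)x^i$, and let $\mathrm{cx}_Q(N)$ be the least integer $q\ge0$ for which there is $w\in\mathbb R$ with $b_i^Q(N)\le w\,i^{q-1}$ for $i\gg0$ ($\infty$ if there is none). If $\mu=\mathrm{cx}_Q(N)$ is finite and $\mu\ge 1$, the multiplicities of $\mathrm{Ext}_Q^{even}(N,k)$ and $\mathrm{Ext}_Q^{odd}(N,k)$ are the numbers $\beta$ with $\dim_k\mathrm{Ext}_Q^{2i}(N,k)=\frac{\beta}{(\mu-1)!}i^{\mu-1}+O(i^{\mu-2})$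 and $\dim_k\mathrm{Ext}_Q^{2i+1}(N,k)=\frac{\beta}{(\mu-1)!}i^{\mu-1}+O(i^{\mu-2})$ respectively; when they are equal, their common value is called the *Betti degree* of $N$. **Statement.** Let $(d,h)$ be a minimal pre-stable higher matrix factorization with respect to $f_1,\dots,f_c$, with $A_0\neq 0$ or $A_1\ne0$, and let $\gamma$ be the least number $p$ such that $A_0(p)\ne0$ or $A_1(p)\neq0$. Then: 1. $\mathrm{cx}_R(M)=c-\gamma+1$. 2. $\mathrm{rank}\,B_1(p)=\mathrm{rank}\,B_0(p)=0$ for $1\le p\le\gamma-1$; $\mathrm{rank}\,B_1(\gamma)=\mathrm{rank}\,B_0(\gamma)>0$; and $\mathrm{rank}\,B_1(p)>\mathrm{rank}\,B_0(p)>0$ for $\gamma+1\le p\le c$. 3. The multiplicities of $\mathrm{Ext}_R^{even}(M,k)$ and of $\mathrm{Ext}_R^{odd}(M,k)$ are equal, and this Betti degree of $M$ is the size (the rank over $R(\gamma-1)$ of the free modules) of the top non-zero part of $(d,h)$, i.e. of the matrix factorization of the image of $f_\gamma$ in $R(\gamma-1)$ given by the maps $R(\gamma-1)\otimes B_1(\gamma)\to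 R(\gamma-1)\otimes B_0(\gamma)\to R(\gamma-1)\otimes B_1(\gamma)$ induced by $d$ and $h_\gamma$. 4. For every $0\le p\le\gamma-1$ the projective dimension of $M$ over $R(p)$ is finite, and $\mathcal P^{S}_M(x)=(1+x)^p\,\mathcal P^{R(p)}_M(x)$. -/

import Mathlib

open CategoryTheory TensorProduct

universe u

noncomputable section

/-! ### Elements `f 1, …, f c` of a ring and the quotients `R(p) = S/(f₁, …, f_p)`

A sequence `f₁, …, f_c` is given by a function `f : ℕ → S` together with the number `c`;
only the values `f 1, …, f c` are used. -/

/-- The list `[f 1, …, f c]`. -/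
def seqList {S : Type u} (f : ℕ → S) (c : ℕ) : List S :=
  (List.range' 1 c).map f

/-- The ideal `(f 1, …, f p)`. -/
def seqIdeal {S : Type u} [CommRing S] (f : ℕ → S) (p : ℕ) : Ideal S :=
  Ideal.span (f '' Set.Icc 1 p)

/-- The ring `R(p) = S/(f 1, …, f p)`; in particular `R(0) = S/(0)`. -/
abbrev SeqQuot {S : Type u} [CommRing S] (f : ℕ → S) (p : ℕ) : Type u :=
  S ⧸ seqIdeal f p

theorem seqIdeal_mono {S : Type u} [CommRing S] (f : ℕ → S) {p q : ℕ} (h : p ≤ q) :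
    seqIdeal f p ≤ seqIdeal f q :=
  Ideal.span_mono (Set.image_mono (Set.Icc_subset_Icc_right h))

/-- The canonical surjection `R(p) → R(q)` for `p ≤ q`. -/
abbrev seqQuotMap {S : Type u} [CommRing S] (f : ℕ → S) {p q : ℕ} (h : p ≤ q) :
    SeqQuot f p →+* SeqQuot f q :=
  Ideal.Quotient.factor (seqIdeal_mono f h)

theorem seqQuot_isLocalRing {S : Type u} [CommRing S] [IsLocalRing S] {f : ℕ → S} {c : ℕ}
    (hreg : RingTheory.Sequence.IsRegular S (seqList f c)) {p : ℕ} (hp : p ≤ c) :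
    IsLocalRing (SeqQuot f p) := by
  have hne : seqIdeal f p ≠ ⊤ := by
    intro htop
    have h1 := hreg.top_ne_smul
    apply h1
    have h2 : Ideal.ofList (seqList f c) = ⊤ := by
      rw [eq_top_iff, ← htop]
      refine Ideal.span_mono ?_
      rintro _ ⟨i, hi, rfl⟩
      simp only [seqList, List.mem_map, List.mem_range'_1, Set.mem_ofPred_eq]
      exact ⟨i, ⟨hi.1, by have := hi.2; omega⟩, rfl⟩
    rw [h2]; simp
  have : Nontrivial (SeqQuot f p) := Ideal.Quotient.nontrivial_iff.mpr hne
  exact IsLocalRing.of_surjective' (Ideal.Quotient.mk (seqIdeal f p))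
    Ideal.Quotient.mk_surjective

/-! ### Higher matrix factorizations -/

/-- A higher matrix factorization `(d, h)` with respect to `f 1, …, f c` on the finitely
generated free modules `A₁`, `A₀`.

* `F₀ p`, `F₁ p` are the filtrations `A₀(p)`, `A₁(p)`, with `A_s(0) = 0` and `A_s(c) = A_s`
  (so `A_s(p) = A_s` for `p ≥ c` by monotonicity).
* A map `h : ⨁_{p = 1}^{c} A₀(p) → A₁` is the family of its restrictions `h p : A₀(p) → A₁`;
  it preserves the filtrations, where the source is filtered by `⨁_{q ≤ p} A₀(q)`, exactly
  when `h p` has values in `A₁(p)`.  So `h` is recorded as the family of the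
  maps `h_p : A₀(p) → A₁(p)`, of which only those with `1 ≤ p ≤ c` are meaningful. -/
structure HMF {S : Type u} [CommRing S] (f : ℕ → S) (c : ℕ) (A₀ A₁ : Type u)
    [AddCommGroup A₀] [Module S A₀] [AddCommGroup A₁] [Module S A₁] where
  free₀ : Module.Free S A₀
  finite₀ : Module.Finite S A₀
  free₁ : Module.Free S A₁
  finite₁ : Module.Finite S A₁
  F₀ : ℕ → Submodule S A₀
  F₁ : ℕ → Submodule S A₁
  mono₀ : Monotone F₀
  mono₁ : Monotone F₁
  zero₀ : F₀ 0 = ⊥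
  zero₁ : F₁ 0 = ⊥
  top₀ : F₀ c = ⊤
  top₁ : F₁ c = ⊤
  free_F₀ : ∀ p, Module.Free S (F₀ p)
  free_F₁ : ∀ p, Module.Free S (F₁ p)
  /-- `A₀(p-1)` is a direct summand of `A₀(p)`. -/
  summand₀ : ∀ p, 1 ≤ p → ∃ C : Submodule S A₀, F₀ (p - 1) ⊓ C = ⊥ ∧ F₀ (p - 1) ⊔ C = F₀ p
  /-- `A₁(p-1)` is a direct summand of `A₁(p)`. -/
  summand₁ : ∀ p, 1 ≤ p → ∃ C : Submodule S A₁, F₁ (p - 1) ⊓ C = ⊥ ∧ F₁ (p - 1) ⊔ C = F₁ p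
  d : A₁ →ₗ[S] A₀
  /-- `d` preserves the filtrations. -/
  d_mem : ∀ p, ∀ y ∈ F₁ p, d y ∈ F₀ p
  h : ∀ p, F₀ p →ₗ[S] F₁ p
  /-- Condition (a): `d_p h_p ≡ f_p Id` modulo `(f_1, …, f_{p-1}) A₀(p)`. -/
  dh : ∀ p, 1 ≤ p → p ≤ c → ∀ x : F₀ p,
    (d.restrict (d_mem p)) (h p x) - f p • x ∈ seqIdeal f (p - 1) • (⊤ : Submodule S (F₀ p))
  /-- Condition (b): `π_p h_p d_p ≡ f_p π_p` modulo
  `(f_1, …, f_{p-1}) (A₁(p) / A₁(p-1))`. -/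
  hd : ∀ p, 1 ≤ p → p ≤ c → ∀ y : F₁ p,
    ((F₁ (p - 1)).submoduleOf (F₁ p)).mkQ (h p ((d.restrict (d_mem p)) y)) -
        f p • ((F₁ (p - 1)).submoduleOf (F₁ p)).mkQ y ∈
      seqIdeal f (p - 1) •
        (⊤ : Submodule S ((F₁ p) ⧸ (F₁ (p - 1)).submoduleOf (F₁ p)))

/-- A (hypersurface, or codimension `1`) matrix factorization of an element `g` of a ring `R`:
maps `d : G₁ → G₀` and `h : G₀ → G₁` of finitely generated free modules
with `d h = g` and `h d = g`. -/
structure HypersurfaceMF {R : Type u} [CommRing R] (g : R) (G₀ G₁ : Type u)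
    [AddCommGroup G₀] [Module R G₀] [AddCommGroup G₁] [Module R G₁] where
  free₀ : Module.Free R G₀
  finite₀ : Module.Finite R G₀
  free₁ : Module.Free R G₁
  finite₁ : Module.Finite R G₁
  d : G₁ →ₗ[R] G₀
  h : G₀ →ₗ[R] G₁
  dh : d ∘ₗ h = g • LinearMap.id
  hd : h ∘ₗ d = g • LinearMap.id

/-- The size of a hypersurface matrix factorization: the rank of `G₀`
(which is also the rank of `G₁` if `g` is a non-zerodivisor). -/
def HypersurfaceMF.size {R : Type u} [CommRing R] {g : R} {G₀ G₁ : Type u}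
    [AddCommGroup G₀] [Module R G₀] [AddCommGroup G₁] [Module R G₁]
    (_X : HypersurfaceMF g G₀ G₁) : ℕ :=
  Module.finrank R G₀

namespace HMF

variable {S : Type u} [CommRing S] {f : ℕ → S} {c : ℕ} {A₀ A₁ : Type u}
  [AddCommGroup A₀] [Module S A₀] [AddCommGroup A₁] [Module S A₁]

/-- `d_p : A₁(p) → A₀(p)`. -/
def dp (X : HMF f c A₀ A₁) (p : ℕ) : X.F₁ p →ₗ[S] X.F₀ p :=
  X.d.restrict (X.d_mem p)

/-- `B₀(p) = A₀(p)/A₀(p-1)`, for `p ≥ 1`. -/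
abbrev B₀ (X : HMF f c A₀ A₁) (p : ℕ) : Type u :=
  (X.F₀ p) ⧸ (X.F₀ (p - 1)).submoduleOf (X.F₀ p)

/-- `B₁(p) = A₁(p)/A₁(p-1)`, for `p ≥ 1`. -/
abbrev B₁ (X : HMF f c A₀ A₁) (p : ℕ) : Type u :=
  (X.F₁ p) ⧸ (X.F₁ (p - 1)).submoduleOf (X.F₁ p)

/-- The projection `π_p : A₁(p) → B₁(p)`. -/
abbrev proj₁ (X : HMF f c A₀ A₁) (p : ℕ) : X.F₁ p →ₗ[S] X.B₁ p :=
  ((X.F₁ (p - 1)).submoduleOf (X.F₁ p)).mkQ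

/-- The map `b_p : B₁(p) → B₀(p)` induced by `d`. -/
def bp (X : HMF f c A₀ A₁) (p : ℕ) : X.B₁ p →ₗ[S] X.B₀ p :=
  Submodule.mapQ _ _ (X.dp p) (fun y hy => X.d_mem (p - 1) y.1 hy)

/-- `M(p) = Coker (R(p) ⊗ d_p)`, an `R(p)`-module. -/
abbrev M (X : HMF f c A₀ A₁) (p : ℕ) : Type u :=
  (SeqQuot f p ⊗[S] X.F₀ p) ⧸ LinearMap.range ((X.dp p).baseChange (SeqQuot f p))

/-- The module `M = M(c)` of the higher matrix factorization, over `R = R(c)`. -/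
abbrev hmfModule (X : HMF f c A₀ A₁) : ModuleCat.{u} (SeqQuot f c) :=
  ModuleCat.of (SeqQuot f c) (X.M c)

/-- `(d, h)` is minimal: the images of `d : A₁ → A₀` and `h : ⨁_{1 ≤ p ≤ c} A₀(p) → A₁` lie in
the maximal ideal times the target. -/
def IsMinimal [IsLocalRing S] (X : HMF f c A₀ A₁) : Prop :=
  LinearMap.range X.d ≤ IsLocalRing.maximalIdeal S • (⊤ : Submodule S A₀) ∧
  ∀ p, 1 ≤ p → p ≤ c → LinearMap.range ((X.F₁ p).subtype ∘ₗ X.h p) ≤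
    IsLocalRing.maximalIdeal S • (⊤ : Submodule S A₁)

/-- The composite `A₀(p-1) ↪ A₀(p) → A₁(p) → B₁(p)` of the inclusion, `h_p` and `π_p`. -/
def stabMap (X : HMF f c A₀ A₁) (p : ℕ) : X.F₀ (p - 1) →ₗ[S] X.B₁ p :=
  X.proj₁ p ∘ₗ X.h p ∘ₗ Submodule.inclusion (X.mono₀ (Nat.sub_le p 1))

/-- `(d, h)` is pre-stable: for `1 ≤ p ≤ c`, the element `f_p` is a non-zerodivisor on the cokernel
of the composite `R(p-1) ⊗ A₀(p-1) → R(p-1) ⊗ A₀(p) → R(p-1) ⊗ A₁(p) → R(p-1) ⊗ B₁(p)`. -/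
def IsPreStable (X : HMF f c A₀ A₁) : Prop :=
  ∀ p, 1 ≤ p → p ≤ c →
    IsSMulRegular
      ((SeqQuot f (p - 1) ⊗[S] X.B₁ p) ⧸
        LinearMap.range ((X.stabMap p).baseChange (SeqQuot f (p - 1))))
      (f p)

/-- `γ` is the smallest number with `A(γ) ≠ 0`, where `A(p)` is the two-term complex
`A₁(p) → A₀(p)`. -/
def IsTopIndex (X : HMF f c A₀ A₁) (γ : ℕ) : Prop :=
  IsLeast {p : ℕ | p ∈ Set.Icc 1 c ∧ (X.F₀ p ≠ ⊥ ∨ X.F₁ p ≠ ⊥)} γ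

theorem IsTopIndex.bot₀ {X : HMF f c A₀ A₁} {γ : ℕ} (hγ : X.IsTopIndex γ) :
    X.F₀ (γ - 1) = ⊥ := by
  by_contra hne
  have h1 : 1 ≤ γ := hγ.1.1.1
  have h2 : γ ≤ c := hγ.1.1.2
  rcases Nat.eq_zero_or_pos (γ - 1) with h0 | h0
  · rw [h0] at hne; exact hne X.zero₀
  · have := hγ.2 (show γ - 1 ∈ _ from ⟨⟨h0, by omega⟩, Or.inl hne⟩)
    omega

theorem IsTopIndex.bot₁ {X : HMF f c A₀ A₁} {γ : ℕ} (hγ : X.IsTopIndex γ) :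
    X.F₁ (γ - 1) = ⊥ := by
  by_contra hne
  have h1 : 1 ≤ γ := hγ.1.1.1
  have h2 : γ ≤ c := hγ.1.1.2
  rcases Nat.eq_zero_or_pos (γ - 1) with h0 | h0
  · rw [h0] at hne; exact hne X.zero₁
  · have := hγ.2 (show γ - 1 ∈ _ from ⟨⟨h0, by omega⟩, Or.inr hne⟩)
    omega

/-- If `γ` is the smallest number with `A(γ) ≠ 0`, the map `B₀(γ) → B₁(γ)` induced by `h_γ`. -/
def topH (X : HMF f c A₀ A₁) {γ : ℕ} (hγ : X.IsTopIndex γ) : X.B₀ γ →ₗ[S] X.B₁ γ :=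
  Submodule.mapQ _ _ (X.h γ) (by
    intro x hx
    have h0 : (x : A₀) ∈ X.F₀ (γ - 1) := hx
    rw [hγ.bot₀, Submodule.mem_bot] at h0
    have hx0 : x = 0 := Subtype.ext h0
    simp [hx0])

theorem tmul_eq_zero_of_mem {N : Type u} [AddCommGroup N] [Module S N] (I : Ideal S) {n : N}
    (hn : n ∈ I • (⊤ : Submodule S N)) : (1 : S ⧸ I) ⊗ₜ[S] n = 0 := by
  induction hn using Submodule.smul_induction_on' with
  | smul r hr n _ =>
    rw [← TensorProduct.smul_tmul]
    have : r • (1 : S ⧸ I) = 0 := by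
      rw [Algebra.smul_def, mul_one]
      exact Ideal.Quotient.eq_zero_iff_mem.mpr hr
    rw [this, TensorProduct.zero_tmul]
  | add x _ y _ hx hy => rw [TensorProduct.tmul_add, hx, hy, add_zero]

theorem baseChange_comp_eq {P Q : Type u} [AddCommGroup P] [Module S P] [AddCommGroup Q]
    [Module S Q] (I : Ideal S) (φ : P →ₗ[S] Q) (ψ : Q →ₗ[S] P) (g : S)
    (h : ∀ x, φ (ψ x) - g • x ∈ I • (⊤ : Submodule S Q)) :
    (φ.baseChange (S ⧸ I)) ∘ₗ (ψ.baseChange (S ⧸ I)) =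
      (Ideal.Quotient.mk I g) • LinearMap.id := by
  refine TensorProduct.AlgebraTensorModule.curry_injective (LinearMap.ext_ring ?_)
  refine LinearMap.ext fun x => ?_
  have h0 := tmul_eq_zero_of_mem _ (h x)
  rw [TensorProduct.tmul_sub, sub_eq_zero] at h0
  have h1 : (1 : S ⧸ I) ⊗ₜ[S] (g • x) = (Ideal.Quotient.mk I g) • ((1 : S ⧸ I) ⊗ₜ[S] x) := by
    rw [← TensorProduct.smul_tmul, TensorProduct.smul_tmul', Algebra.smul_def]
    rfl
  change (1 : S ⧸ I) ⊗ₜ[S] (φ (ψ x)) = (Ideal.Quotient.mk I g) • ((1 : S ⧸ I) ⊗ₜ[S] x)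
  rw [h0, h1]

/-- The top non-zero part of a non-trivial higher matrix factorization: if `γ` is the smallest
number with `A(γ) ≠ 0` and `R' = R(γ-1)`, it is the hypersurface matrix factorization of the image
of `f_γ` in `R'` that consists of `R' ⊗ b_γ` and of the map `R' ⊗ B₀(γ) → R' ⊗ B₁(γ)`
induced by `h_γ`. -/
def topPart [IsNoetherianRing S] (X : HMF f c A₀ A₁) {γ : ℕ} (hγ : X.IsTopIndex γ) :
    HypersurfaceMF (R := SeqQuot f (γ - 1)) (Ideal.Quotient.mk (seqIdeal f (γ - 1)) (f γ))
      (SeqQuot f (γ - 1) ⊗[S] X.B₀ γ) (SeqQuot f (γ - 1) ⊗[S] X.B₁ γ) where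
  free₀ := by
    have := X.free_F₀ γ
    have : Module.Free S (X.B₀ γ) := Module.Free.of_equiv
      (Submodule.quotEquivOfEqBot ((X.F₀ (γ - 1)).submoduleOf (X.F₀ γ))
        (by rw [hγ.bot₀]; simp [Submodule.submoduleOf])).symm
    infer_instance
  finite₀ := by
    have := X.finite₀
    infer_instance
  free₁ := by
    have := X.free_F₁ γ
    have : Module.Free S (X.B₁ γ) := Module.Free.of_equiv
      (Submodule.quotEquivOfEqBot ((X.F₁ (γ - 1)).submoduleOf (X.F₁ γ))
        (by rw [hγ.bot₁]; simp [Submodule.submoduleOf])).symm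
    infer_instance
  finite₁ := by
    have := X.finite₁
    infer_instance
  d := (X.bp γ).baseChange _
  h := (X.topH hγ).baseChange _
  dh := baseChange_comp_eq (seqIdeal f (γ - 1)) (X.bp γ) (X.topH hγ) (f γ) (by
    intro x
    obtain ⟨x, rfl⟩ := Submodule.mkQ_surjective _ x
    have hx := Submodule.mem_map_of_mem (f := ((X.F₀ (γ - 1)).submoduleOf (X.F₀ γ)).mkQ)
      (X.dh γ hγ.1.1.1 hγ.1.1.2 x)
    rw [Submodule.map_smul''] at hx
    exact Submodule.smul_mono le_rfl le_top hx)
  hd := baseChange_comp_eq (seqIdeal f (γ - 1)) (X.topH hγ) (X.bp γ) (f γ) (by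
    intro y
    obtain ⟨y, rfl⟩ := Submodule.mkQ_surjective _ y
    exact X.hd γ hγ.1.1.1 hγ.1.1.2 y)

end HMF

/-! ### Betti numbers, complexity, Betti degree -/

/-- The residue field of a local ring, as a module. -/
abbrev residueModule (R : Type u) [CommRing R] [IsLocalRing R] : ModuleCat.{u} R :=
  ModuleCat.of R (IsLocalRing.ResidueField R)

/-- The Betti number `b_i^R(N) = dim_k Tor_i^R(N, k)`.  As `Tor_i^R(N, k)` is annihilated
by the maximal ideal, its dimension over `k` is its length as an `R`-module; it is finite for
finitely generated `N` over a Noetherian local ring `R`. -/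
def bettiNumber (R : Type u) [CommRing R] [IsLocalRing R] (N : ModuleCat.{u} R) (i : ℕ) : ℕ :=
  (Module.length R (((Tor' (ModuleCat.{u} R) i).obj N).obj (residueModule R))).toNat

/-- The dimension `dim_k Ext^i_R(N, k)`, again computed as a length. -/
def extDim (R : Type u) [CommRing R] [IsLocalRing R] (N : ModuleCat.{u} R) (i : ℕ) : ℕ :=
  (Module.length R
    (((Ext R (ModuleCat.{u} R) i).obj (Opposite.op N)).obj (residueModule R))).toNat

/-- The Poincaré series `∑ b_i^R(N) x^i`. -/
def poincareSeries (R : Type u) [CommRing R] [IsLocalRing R] (N : ModuleCat.{u} R) :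
    PowerSeries ℕ :=
  PowerSeries.mk (bettiNumber R N)

/-- The complexity
`inf {q ≥ 0 | there is a real w with b_i^R(N) ≤ w i^{q-1} for i ≫ 0}`. -/
def complexity (R : Type u) [CommRing R] [IsLocalRing R] (N : ModuleCat.{u} R) : ℕ∞ :=
  sInf {a : ℕ∞ | ∃ q : ℕ, a = q ∧ ∃ w : ℝ, ∀ᶠ i : ℕ in Filter.atTop,
    (bettiNumber R N i : ℝ) ≤ w * (i : ℝ) ^ ((q : ℤ) - 1)}

/-- The multiplicity of a graded module with Hilbert function `H` and of dimension `μ ≥ 1` is `β`: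
`H(i) = (β/(μ-1)!) i^{μ-1} + O(i^{μ-2})`. -/
def HasMultiplicity (H : ℕ → ℕ) (μ β : ℕ) : Prop :=
  1 ≤ μ ∧ (fun i : ℕ => (H i : ℝ) - (β : ℝ) / ((μ - 1).factorial : ℝ) * (i : ℝ) ^ (μ - 1))
    =O[Filter.atTop] (fun i : ℕ => (i : ℝ) ^ ((μ : ℤ) - 2))

/-- The Betti degree of `N` is `β`: with `μ` the complexity of `N`, both
`Ext^{even}_R(N, k)` and `Ext^{odd}_R(N, k)`, with `Ext^{2i}` and `Ext^{2i+1}` in degree `i`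
(the operators of cohomological degree `2` having degree `1`), have multiplicity `β`. -/
def HasBettiDegree (R : Type u) [CommRing R] [IsLocalRing R] (N : ModuleCat.{u} R) (β : ℕ) :
    Prop :=
  ∃ μ : ℕ, complexity R N = μ ∧
    HasMultiplicity (fun i => extDim R N (2 * i)) μ β ∧
    HasMultiplicity (fun i => extDim R N (2 * i + 1)) μ β

end

/-! Write I_p = (f_1, …, f_p), M(p) for the cokernel of R(p) ⊗ d_p, and b_p : B_1(p) → B_0(p) for
the map induced by d. Two minimal resolutions of M carry the theorem.

The infinite resolution, over R. By d h ≡ f_{p+1}, the module Coker(R(p) ⊗ d_{p+1}) is killed by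
f_{p+1}, so it is already M(p+1). By π h d ≡ f_{p+1} π and regularity, the kernel of R(p) ⊗ d_{p+1}
comes from A_1(p). Hence A_1(p+1) → A_0(p+1), continued by the minimal R(p)-resolution of M(p) from
degree 2 on, resolves M(p+1) over R(p). Shamash's construction for f_{p+1}, started with the
homotopy h_{p+1}, turns this into a resolution over R(p+1) (`exists_extension`, `exists_modRes`).
The higher homotopies might have unit entries. They do not, because of a property carried along the
induction, `IsDetecting`: the map G_{i+2} ⊗ k → I G_i / 𝔪 I G_i given by D² is injective. The
homotopy relations place D²σ(x) in 𝔪 I G, so σ(x) lies in 𝔪 G; and the new resolution is again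
detecting. The recursion for the ranks makes the even Betti numbers b_{2i} the sum over q < c of
rank B_0(q+1) times the binomial coefficient of i + c-1-q over c-1-q, and the odd ones likewise with
B_1. The term q + 1 = γ dominates, which gives the complexity and the Betti degree.

The finite resolution, over R(j) with j < γ. For p ≥ γ - 1, M(p+1) is the cokernel of an injection
R(p) ⊗ B_1(p+1) → M(p) ⊕ (R(p) ⊗ B_0(p+1)) with entries in 𝔪. Koszul resolutions of R(p) over R(j)
and minimal mapping cones add (1+x)^{p-j} (rank B_0(p+1) + x rank B_1(p+1)) to the Poincaré series,
starting from M(γ-1) = 0 (`hasResolution_M_succ`). Only the powers of 1+x depend on j.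

The ranks. Modulo I_{p-1}, b_p has a right inverse up to the nonzerodivisor f_p, so rank B_0(p) ≤
rank B_1(p). If equality held, a determinant argument would make b_p injective, and since f_p is a
nonzerodivisor on M(p-1), every element of A_0(p-1) would lie in 𝔪 A_0(p-1), forcing A_0(p-1) = 0
(`finrank_B₀_lt`). Pre-stability enters only to exclude B_0(p) = 0 for p > γ (`finrank_B₁_eq_zero`).
At γ both composites of the top part are multiplication by a nonzerodivisor, so the two ranks agree.
-/

noncomputable section

/-! ### Betti numbers and Ext dimensions from a minimal free resolution -/

section FreeResolution

variable {Q : Type u} [CommRing Q]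

/-- The chain complex of modules with terms `G i` and differentials `D i`. -/
def moduleComplex (G : ℕ → Type u) [∀ i, AddCommGroup (G i)] [∀ i, Module Q (G i)]
    (D : ∀ i, G (i + 1) →ₗ[Q] G i) (hD : ∀ i, Function.Exact (D (i + 1)) (D i)) :
    ChainComplex (ModuleCat.{u} Q) ℕ :=
  ChainComplex.of (fun i => ModuleCat.of Q (G i)) (fun i => ModuleCat.ofHom (D i))
    (fun i => by ext x; exact (hD i).apply_apply_eq_zero x)

theorem moduleComplex_d (G : ℕ → Type u) [∀ i, AddCommGroup (G i)] [∀ i, Module Q (G i)]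
    (D : ∀ i, G (i + 1) →ₗ[Q] G i) (hD : ∀ i, Function.Exact (D (i + 1)) (D i)) (i : ℕ) :
    (moduleComplex G D hD).d (i + 1) i = ModuleCat.ofHom (D i) :=
  ChainComplex.of_d (fun i => ModuleCat.of Q (G i)) (fun i => ModuleCat.ofHom (D i)) i

/-- A free resolution, given by its modules and maps, as a projective resolution. -/
def projectiveResolutionOfExact (N : ModuleCat.{u} Q) (G : ℕ → Type u)
    [∀ i, AddCommGroup (G i)] [∀ i, Module Q (G i)] [∀ i, Module.Free Q (G i)]
    (D : ∀ i, G (i + 1) →ₗ[Q] G i) (ε : G 0 →ₗ[Q] N)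
    (hD : ∀ i, Function.Exact (D (i + 1)) (D i)) (hDε : Function.Exact (D 0) ε)
    (hε : Function.Surjective ε) : ProjectiveResolution N where
  complex := moduleComplex G D hD
  projective i := by
    change Projective (ModuleCat.of Q (G i))
    exact (IsProjective.iff_projective _).mp inferInstance
  π := (ChainComplex.toSingle₀Equiv _ _).symm ⟨ModuleCat.ofHom ε, by
    rw [moduleComplex_d]
    ext x
    exact hDε.apply_apply_eq_zero x⟩
  quasiIso := ⟨fun n => by
    cases n with
    | zero =>
      rw [ChainComplex.quasiIsoAt₀_iff, ShortComplex.quasiIso_iff_of_zeros']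
      · refine (ShortComplex.exact_and_epi_g_iff_of_iso
          (S₂ := ShortComplex.mk (ModuleCat.ofHom (D 0)) (ModuleCat.ofHom ε)
            (by ext x; exact hDε.apply_apply_eq_zero x)) ?_).2 ⟨?_, ?_⟩
        · refine ShortComplex.isoMk (Iso.refl (ModuleCat.of Q (G 1)))
            (Iso.refl (ModuleCat.of Q (G 0))) (Iso.refl N) ?_ ?_
          · change 𝟙 _ ≫ ModuleCat.ofHom (D 0) = (moduleComplex G D hD).d 1 0 ≫ 𝟙 _
            rw [moduleComplex_d]
            rfl
          · change 𝟙 _ ≫ ModuleCat.ofHom ε = _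
            ext x
            rfl
        · rw [ShortComplex.ShortExact.moduleCat_exact_iff_function_exact]
          exact hDε
        · exact (ModuleCat.epi_iff_surjective _).2 hε
      all_goals rfl
    | succ n =>
      rw [quasiIsoAt_iff_exactAt']
      · rw [HomologicalComplex.exactAt_iff' _ (n + 1 + 1) (n + 1) n (by simp) (by simp)]
        rw [ShortComplex.ShortExact.moduleCat_exact_iff_function_exact]
        change Function.Exact ((moduleComplex G D hD).d (n + 1 + 1) (n + 1))
          ((moduleComplex G D hD).d (n + 1) n)
        rw [moduleComplex_d, moduleComplex_d]
        exact hD n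
      · apply ChainComplex.exactAt_succ_single_obj⟩

/-- Tensoring a minimal resolution with k, or mapping it to k, kills the differential; Tor and Ext
are then the terms themselves. -/
theorem HomologicalComplex.nonempty_homology_iso_of_d_eq_zero {C : Type*} [Category C]
    [Abelian C] {ι : Type*} {s : ComplexShape ι} (K : HomologicalComplex C s)
    (hK : ∀ i j, K.d i j = 0) (i : ι) : Nonempty (K.homology i ≅ K.X i) :=
  ⟨(ShortComplex.HomologyData.ofZeros (K.sc i) (hK _ _) (hK _ _)).left.homologyIso⟩

theorem ModuleCat.length_eq_of_iso {M N : ModuleCat.{u} Q} (e : M ≅ N) :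
    Module.length Q M = Module.length Q N :=
  e.toLinearEquiv.length_eq

/-- A module with a finite free resolution has finite projective dimension. -/
theorem hasProjectiveDimensionLT_of_exact (n : ℕ) : ∀ (N : ModuleCat.{u} Q) (G : ℕ → Type u)
    [∀ i, AddCommGroup (G i)] [∀ i, Module Q (G i)] [∀ i, Module.Free Q (G i)]
    (D : ∀ i, G (i + 1) →ₗ[Q] G i) (ε : G 0 →ₗ[Q] N)
    (_ : ∀ i, Function.Exact (D (i + 1)) (D i)) (_ : Function.Exact (D 0) ε)
    (_ : Function.Surjective ε) (_ : Subsingleton (G n)),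
    HasProjectiveDimensionLT N n := by
  induction n with
  | zero =>
    intro N G _ _ _ D ε hD hDε hε hn
    have : Subsingleton N := hε.subsingleton
    exact (ModuleCat.isZero_of_subsingleton N).hasProjectiveDimensionLT_zero
  | succ n ih =>
    intro N G _ _ _ D ε hD hDε hε hn
    let K := ModuleCat.of Q (LinearMap.ker ε)
    have h0 : ∀ x, D 0 x ∈ LinearMap.ker ε := fun x => hDε.apply_apply_eq_zero x
    have hK : HasProjectiveDimensionLT K n := by
      refine ih K (fun i => G (i + 1)) (fun i => D (i + 1)) ((D 0).codRestrict _ h0)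
        (fun i => hD (i + 1)) ?_ ?_ hn
      · intro x
        rw [← hD 0 x, Subtype.ext_iff]
        rfl
      · rintro ⟨x, hx⟩
        obtain ⟨y, hy⟩ := (hDε x).1 hx
        exact ⟨y, Subtype.ext hy⟩
    have hS : (ShortComplex.mk (ModuleCat.ofHom (LinearMap.ker ε).subtype) (ModuleCat.ofHom ε)
        (by ext x; exact x.2)).ShortExact := by
      refine ShortComplex.ShortExact.mk' ?_ ?_ ?_
      · rw [ShortComplex.ShortExact.moduleCat_exact_iff_function_exact]
        intro x
        simp
      · exact (ModuleCat.mono_iff_injective _).2 (Submodule.subtype_injective _)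
      · exact (ModuleCat.epi_iff_surjective _).2 hε
    have : Projective (ModuleCat.of Q (G 0)) := (IsProjective.iff_projective _).mp inferInstance
    have h1 : HasProjectiveDimensionLT (ModuleCat.of Q (G 0)) (n + 1) :=
      hasProjectiveDimensionLT_of_ge _ 1 _ (by omega)
    exact hS.hasProjectiveDimensionLT_X₃ n hK h1

variable [IsLocalRing Q]

theorem length_residueField_pi (n : ℕ) :
    Module.length Q (Fin n → IsLocalRing.ResidueField Q) = n := by
  have : IsSimpleModule Q (IsLocalRing.ResidueField Q) :=
    (isSimpleModule_iff_quot_maximal).2 ⟨IsLocalRing.maximalIdeal Q, inferInstance, ⟨LinearEquiv.refl _ _⟩⟩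
  rw [Module.length_pi]
  simp

theorem smul_residueField_eq_zero {r : Q} (hr : r ∈ IsLocalRing.maximalIdeal Q)
    (x : IsLocalRing.ResidueField Q) : r • x = 0 := by
  rw [Algebra.smul_def, IsLocalRing.ResidueField.algebraMap_eq,
    (IsLocalRing.residue_eq_zero_iff r).2 hr, zero_mul]

theorem tmul_residueField_eq_zero {G : Type u} [AddCommGroup G] [Module Q G] {x : G}
    (hx : x ∈ IsLocalRing.maximalIdeal Q • (⊤ : Submodule Q G)) (y : IsLocalRing.ResidueField Q) :
    x ⊗ₜ[Q] y = 0 := by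
  induction hx using Submodule.smul_induction_on' with
  | smul r hr n _ =>
    rw [TensorProduct.smul_tmul, smul_residueField_eq_zero hr, TensorProduct.tmul_zero]
  | add x _ y _ hx hy => rw [TensorProduct.add_tmul, hx, hy, add_zero]

theorem apply_eq_zero_of_mem_maximalIdeal_smul_top {G : Type u} [AddCommGroup G] [Module Q G]
    (φ : G →ₗ[Q] IsLocalRing.ResidueField Q) {x : G}
    (hx : x ∈ IsLocalRing.maximalIdeal Q • (⊤ : Submodule Q G)) : φ x = 0 := by
  induction hx using Submodule.smul_induction_on' with
  | smul r hr n _ => rw [map_smul, smul_residueField_eq_zero hr]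
  | add x _ y _ hx hy => rw [map_add, hx, hy, add_zero]

/-- A minimal free resolution computes the Betti numbers and the dimensions of the Ext modules. -/
theorem bettiNumber_extDim_eq_of_minimal (N : ModuleCat.{u} Q) (G : ℕ → Type u)
    [∀ i, AddCommGroup (G i)] [∀ i, Module Q (G i)] [∀ i, Module.Free Q (G i)]
    [∀ i, Module.Finite Q (G i)]
    (D : ∀ i, G (i + 1) →ₗ[Q] G i) (ε : G 0 →ₗ[Q] N)
    (hD : ∀ i, Function.Exact (D (i + 1)) (D i)) (hDε : Function.Exact (D 0) ε)
    (hε : Function.Surjective ε)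
    (hmin : ∀ i x, D i x ∈ IsLocalRing.maximalIdeal Q • (⊤ : Submodule Q (G i))) (i : ℕ) :
    bettiNumber Q N i = Module.finrank Q (G i) ∧ extDim Q N i = Module.finrank Q (G i) := by
  let P := projectiveResolutionOfExact N G D ε hD hDε hε
  have hd : ∀ i j, i ≠ j + 1 → P.complex.d i j = 0 := fun i j hij =>
    P.complex.shape _ _ (by simpa using Ne.symm hij)
  have hd' : ∀ j, P.complex.d (j + 1) j = ModuleCat.ofHom (D j) := moduleComplex_d G D hD
  let b : Module.Basis (Fin (Module.finrank Q (G i))) Q (G i) := Module.finBasis Q (G i)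
  constructor
  · let F := (MonoidalCategory.tensoringRight (ModuleCat.{u} Q)).obj (residueModule Q)
    obtain ⟨e⟩ := HomologicalComplex.nonempty_homology_iso_of_d_eq_zero
      ((F.mapHomologicalComplex _).obj P.complex) (fun a b => by
        change F.map (P.complex.d a b) = 0
        by_cases h : a = b + 1
        · subst h
          rw [hd']
          refine ModuleCat.hom_ext (TensorProduct.ext' fun x y => ?_)
          exact tmul_residueField_eq_zero (hmin b x) y
        · rw [hd a b h, F.map_zero]) i
    have e1 : ((Tor' (ModuleCat.{u} Q) i).obj N).obj (residueModule Q) ≅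
        ModuleCat.of Q (G i ⊗[Q] IsLocalRing.ResidueField Q) :=
      (P.isoLeftDerivedObj F i) ≪≫ e
    have e2 : G i ⊗[Q] IsLocalRing.ResidueField Q ≃ₗ[Q]
        (Fin (Module.finrank Q (G i)) → IsLocalRing.ResidueField Q) :=
      TensorProduct.congr b.equivFun (LinearEquiv.refl Q _) ≪≫ₗ
        TensorProduct.comm Q _ _ ≪≫ₗ TensorProduct.piScalarRight Q Q _ _
    unfold bettiNumber
    rw [ModuleCat.length_eq_of_iso e1, e2.length_eq, length_residueField_pi]
    rfl
  · obtain ⟨e⟩ := HomologicalComplex.nonempty_homology_iso_of_d_eq_zero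
      (P.complex.linearYonedaObj Q (residueModule Q)) (fun a b => by
        refine ModuleCat.hom_ext (LinearMap.ext fun φ => ?_)
        change P.complex.d b a ≫ φ = 0
        by_cases h : b = a + 1
        · subst h
          rw [hd']
          refine ModuleCat.hom_ext (LinearMap.ext fun x => ?_)
          exact apply_eq_zero_of_mem_maximalIdeal_smul_top
            (G := G a) (ModuleCat.Hom.hom φ) (hmin a x)
        · exact (congrArg (fun u => u ≫ (φ : P.complex.X a ⟶ residueModule Q)) (hd b a h)).trans
            Limits.zero_comp) i
    have e1 : ((Ext Q (ModuleCat.{u} Q) i).obj (Opposite.op N)).obj (residueModule Q) ≅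
        ModuleCat.of Q (ModuleCat.of Q (G i) ⟶ residueModule Q) :=
      P.isoExt i (residueModule Q) ≪≫ e
    have e2 : (ModuleCat.of Q (G i) ⟶ residueModule Q) ≃ₗ[Q]
        (Fin (Module.finrank Q (G i)) → IsLocalRing.ResidueField Q) :=
      ModuleCat.homLinearEquiv ≪≫ₗ (b.constr Q).symm
    unfold extDim
    rw [ModuleCat.length_eq_of_iso e1, e2.length_eq, length_residueField_pi]
    rfl

end FreeResolution

/-! ### Submodules `I G` of a module `G` -/

section IdealTop

variable {S : Type u} [CommRing S]

/-- The submodule `I G` of a module `G`. -/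
abbrev idealTop (I : Ideal S) (G : Type u) [AddCommGroup G] [Module S G] : Submodule S G :=
  I • (⊤ : Submodule S G)

variable {G G' : Type u} [AddCommGroup G] [Module S G] [AddCommGroup G'] [Module S G']
  {I J : Ideal S}

theorem idealTop_mono (h : I ≤ J) {x : G} (hx : x ∈ idealTop I G) : x ∈ idealTop J G :=
  Submodule.smul_mono_left h hx

theorem smul_mem_idealTop {r : S} (hr : r ∈ I) (x : G) : r • x ∈ idealTop I G :=
  Submodule.smul_mem_smul hr trivial

theorem smul_mem_idealTop_mul {r : S} (hr : r ∈ J) {x : G} (hx : x ∈ idealTop I G) :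
    r • x ∈ idealTop (J * I) G := by
  rw [idealTop, Submodule.mul_smul]
  exact Submodule.smul_mem_smul hr hx

theorem smul_mem_idealTop_mul' {r : S} (hr : r ∈ I) {x : G} (hx : x ∈ idealTop J G) :
    r • x ∈ idealTop (J * I) G := by
  rw [mul_comm]
  exact smul_mem_idealTop_mul hr hx

theorem map_mem_idealTop (φ : G →ₗ[S] G') {x : G} (hx : x ∈ idealTop I G) :
    φ x ∈ idealTop I G' := by
  have h := Submodule.mem_map_of_mem (f := φ) hx
  rw [Submodule.map_smul''] at h
  exact Submodule.smul_mono le_rfl le_top h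

theorem map_mem_idealTop_mul (φ : G →ₗ[S] G') (hφ : ∀ x, φ x ∈ idealTop J G') {x : G}
    (hx : x ∈ idealTop I G) : φ x ∈ idealTop (J * I) G' := by
  have h := Submodule.mem_map_of_mem (f := φ) hx
  rw [Submodule.map_smul''] at h
  rw [idealTop, mul_comm, Submodule.mul_smul]
  refine Submodule.smul_mono le_rfl ?_ h
  rintro _ ⟨y, -, rfl⟩
  exact hφ y

theorem map_mem_idealTop_mul' (φ : G →ₗ[S] G') (hφ : ∀ x, φ x ∈ idealTop I G') {x : G}
    (hx : x ∈ idealTop J G) : φ x ∈ idealTop (J * I) G' := by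
  rw [mul_comm]
  exact map_mem_idealTop_mul φ hφ hx

theorem mem_idealTop_prod {x : G × G'} :
    x ∈ idealTop I (G × G') ↔ x.1 ∈ idealTop I G ∧ x.2 ∈ idealTop I G' := by
  refine ⟨fun h => ⟨map_mem_idealTop (LinearMap.fst S G G') h,
    map_mem_idealTop (LinearMap.snd S G G') h⟩, fun h => ?_⟩
  have h1 := add_mem (map_mem_idealTop (LinearMap.inl S G G') h.1)
    (map_mem_idealTop (LinearMap.inr S G G') h.2)
  simpa using h1

theorem mem_idealTop_sup_span {f : S} {x : G} :
    x ∈ idealTop (I ⊔ Ideal.span {f}) G ↔ ∃ z : G, x - f • z ∈ idealTop I G := by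
  rw [idealTop, Submodule.sup_smul, Submodule.mem_sup]
  constructor
  · rintro ⟨a, ha, b, hb, rfl⟩
    rw [Submodule.ideal_span_singleton_smul] at hb
    obtain ⟨z, -, rfl⟩ := hb
    exact ⟨z, by simpa using ha⟩
  · rintro ⟨z, hz⟩
    exact ⟨_, hz, f • z, smul_mem_idealTop (Ideal.mem_span_singleton_self f) z, by abel⟩

/-- Keeping the coefficient of `f` in `J G` is what allows the detection property to be tested
modulo 𝔪(I + (f)). -/
theorem mem_idealTop_mul_sup_span {f : S} {x : G} :
    x ∈ idealTop (J * (I ⊔ Ideal.span {f})) G ↔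
      ∃ u ∈ idealTop J G, x - f • u ∈ idealTop (J * I) G := by
  rw [idealTop, Ideal.mul_sup, Submodule.sup_smul, Submodule.mem_sup]
  constructor
  · rintro ⟨a, ha, b, hb, rfl⟩
    rw [mul_comm, Submodule.mul_smul, Submodule.ideal_span_singleton_smul] at hb
    obtain ⟨z, hz, rfl⟩ := hb
    exact ⟨z, hz, by simpa using ha⟩
  · rintro ⟨z, hz, hz'⟩
    exact ⟨_, hz', f • z, smul_mem_idealTop_mul' (Ideal.mem_span_singleton_self f) hz, by abel⟩

theorem mem_idealTop_iff_repr {ι : Type*} (b : Module.Basis ι S G) {x : G} :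
    x ∈ idealTop I G ↔ ∀ i, b.repr x i ∈ I := by
  constructor
  · intro hx i
    have h := map_mem_idealTop (b.coord i) hx
    simpa using h
  · intro h
    rw [← b.linearCombination_repr x, Finsupp.linearCombination_apply]
    exact Submodule.sum_mem _ fun i _ => smul_mem_idealTop (h i) _

/-- A nonzerodivisor modulo `I` stays one on G/IG for G free, by looking at coordinates in a basis.
-/
theorem mem_idealTop_of_smul_mem [Module.Free S G] {f : S} (hf : ∀ s, f * s ∈ I → s ∈ I) {x : G}
    (hx : f • x ∈ idealTop I G) : x ∈ idealTop I G := by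
  rw [mem_idealTop_iff_repr (Module.Free.chooseBasis S G)] at hx ⊢
  intro i
  exact hf _ (by simpa using hx i)

/-- Preimages are chosen on a basis of `F`. The error submodule `N` is I G' for lifting modulo an
ideal, and ⊥ for lifting on the nose. -/
theorem exists_linearMap_lift {F : Type u} [AddCommGroup F] [Module S F] [Module.Free S F]
    {N : Submodule S G'} (D : G →ₗ[S] G') (z : F →ₗ[S] G') (h : ∀ x, ∃ y, z x - D y ∈ N) :
    ∃ L : F →ₗ[S] G, ∀ x, z x - D (L x) ∈ N := by
  let b := Module.Free.chooseBasis S F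
  choose y hy using fun i => h (b i)
  refine ⟨b.constr S y, fun x => ?_⟩
  have : z - D ∘ₗ b.constr S y = b.constr S (fun i => z (b i) - D (y i)) :=
    b.ext fun i => by simp
  have hx : z x - D (b.constr S y x) = b.constr S (fun i => z (b i) - D (y i)) x :=
    congrArg (fun l => l x) this
  rw [hx, Module.Basis.constr_apply]
  exact Submodule.sum_mem _ fun i _ => N.smul_mem _ (hy i)

/-- Congruences proved in a larger step of a filtration descend to a smaller one, because the steps
are direct summands. -/
theorem mem_idealTop_of_retract (i : G →ₗ[S] G') (r : G' →ₗ[S] G) (h : ∀ x, r (i x) = x) {x : G}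
    (hx : i x ∈ idealTop I G') : x ∈ idealTop I G := by
  have := map_mem_idealTop r hx
  rwa [h] at this

end IdealTop

/-! ### Congruences modulo I as identities over S/I -/

section BaseChange

variable {S : Type u} [CommRing S] {I : Ideal S} {Q : Type u} [CommRing Q] [Algebra S Q]

/-- This is the dictionary between the resolutions written over S modulo I and genuine complexes
over S/I. -/
theorem one_tmul_eq_zero_iff {G : Type u} [AddCommGroup G] [Module S G] [Module.Free S G]
    (hI : RingHom.ker (algebraMap S Q) = I) (x : G) :
    (1 : Q) ⊗ₜ[S] x = 0 ↔ x ∈ idealTop I G := by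
  let b := Module.Free.chooseBasis S G
  rw [mem_idealTop_iff_repr b, ← (b.baseChange Q).repr.map_eq_zero_iff, Finsupp.ext_iff]
  refine forall_congr' fun i => ?_
  rw [Module.Basis.baseChange_repr_tmul, ← hI, RingHom.mem_ker, Algebra.smul_def]
  simp

theorem exists_one_tmul_eq {G : Type u} [AddCommGroup G] [Module S G]
    (hQ : Function.Surjective (algebraMap S Q)) (x : Q ⊗[S] G) : ∃ y : G, (1 : Q) ⊗ₜ[S] y = x := by
  induction x with
  | zero => exact ⟨0, by simp⟩
  | tmul q g =>
    obtain ⟨s, rfl⟩ := hQ q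
    exact ⟨s • g, by rw [← TensorProduct.smul_tmul, Algebra.smul_def, mul_one]⟩
  | add x y hx hy =>
    obtain ⟨a, rfl⟩ := hx
    obtain ⟨b, rfl⟩ := hy
    exact ⟨a + b, by rw [TensorProduct.tmul_add]⟩

theorem one_tmul_mem_maximalIdeal_smul [IsLocalRing S] [IsLocalRing Q] {G : Type u}
    [AddCommGroup G] [Module S G] (hQ : Function.Surjective (algebraMap S Q)) {x : G}
    (hx : x ∈ idealTop (IsLocalRing.maximalIdeal S) G) :
    (1 : Q) ⊗ₜ[S] x ∈ idealTop (IsLocalRing.maximalIdeal Q) (Q ⊗[S] G) := by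
  have : IsLocalHom (algebraMap S Q) := hQ.isLocalHom _
  induction hx using Submodule.smul_induction_on' with
  | smul r hr n _ =>
    have hr' : algebraMap S Q r ∈ IsLocalRing.maximalIdeal Q :=
      (IsLocalRing.mem_maximalIdeal _).2 fun hu =>
        (IsLocalRing.mem_maximalIdeal _).1 hr (isUnit_of_map_unit _ _ hu)
    rw [← TensorProduct.smul_tmul, Algebra.smul_def, mul_one, ← mul_one (algebraMap S Q r),
      ← smul_eq_mul, ← TensorProduct.smul_tmul']
    exact smul_mem_idealTop hr' _
  | add x _ y _ hx hy =>
    rw [TensorProduct.tmul_add]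
    exact add_mem hx hy

end BaseChange

/-! ### Free resolutions modulo an ideal -/

/-- Maps of finitely generated free modules over a local ring `S` that become a minimal free
resolution modulo the ideal `I`. -/
structure ModRes (S : Type u) [CommRing S] [IsLocalRing S] (I : Ideal S) where
  G : ℕ → Type u
  [acg : ∀ i, AddCommGroup (G i)]
  [mod : ∀ i, Module S (G i)]
  [free : ∀ i, Module.Free S (G i)]
  [finite : ∀ i, Module.Finite S (G i)]
  D : ∀ i, G (i + 1) →ₗ[S] G i
  sq : ∀ i (x : G (i + 1 + 1)), D i (D (i + 1) x) ∈ idealTop I (G i)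
  exact : ∀ i (x : G (i + 1)), D i x ∈ idealTop I (G i) →
    ∃ y, x - D (i + 1) y ∈ idealTop I (G (i + 1))
  minimal : ∀ i x, D i x ∈ idealTop (IsLocalRing.maximalIdeal S) (G i)

namespace ModRes

attribute [instance] acg mod free finite

variable {S : Type u} [CommRing S] [IsLocalRing S] {I : Ideal S}

/-- `ε` presents `N` as the module resolved by `Y`. -/
structure Resolves (Y : ModRes S I) {N : Type u} [AddCommGroup N] [Module S N]
    (ε : Y.G 0 →ₗ[S] N) : Prop where
  surj : Function.Surjective ε
  apply_D : ∀ x, ε (Y.D 0 x) = 0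
  apply_mem : ∀ x ∈ idealTop I (Y.G 0), ε x = 0
  exact : ∀ x, ε x = 0 → ∃ y, x - Y.D 0 y ∈ idealTop I (Y.G 0)

section BaseChange

variable {Q : Type u} [CommRing Q] [Algebra S Q]

theorem exact_baseChange (Y : ModRes S I) (hQ : Function.Surjective (algebraMap S Q))
    (hI : RingHom.ker (algebraMap S Q) = I) (i : ℕ) :
    Function.Exact ((Y.D (i + 1)).baseChange Q) ((Y.D i).baseChange Q) := by
  intro x
  obtain ⟨x, rfl⟩ := exists_one_tmul_eq hQ x
  rw [LinearMap.baseChange_tmul, one_tmul_eq_zero_iff hI]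
  constructor
  · intro h
    obtain ⟨y, hy⟩ := Y.exact i x h
    refine ⟨1 ⊗ₜ y, ?_⟩
    rw [← one_tmul_eq_zero_iff (Q := Q) hI, TensorProduct.tmul_sub, sub_eq_zero] at hy
    rw [LinearMap.baseChange_tmul, hy]
  · rintro ⟨y, hy⟩
    obtain ⟨y, rfl⟩ := exists_one_tmul_eq hQ y
    rw [LinearMap.baseChange_tmul, ← sub_eq_zero, ← TensorProduct.tmul_sub,
      one_tmul_eq_zero_iff hI] at hy
    have h1 := map_mem_idealTop (Y.D i) hy
    rw [map_sub] at h1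
    exact (Submodule.sub_mem_iff_right _ (Y.sq i y)).1 h1

end BaseChange

/-- A resolution modulo `I` yields a resolution over a ring isomorphic to `S/I`, which computes
Betti numbers, Ext dimensions and bounds the projective dimension. -/
theorem Resolves.homological {Y : ModRes S I} {N : Type u} [AddCommGroup N] [Module S N]
    {ε : Y.G 0 →ₗ[S] N} (hY : Y.Resolves ε) {Q : Type u} [CommRing Q] [IsLocalRing Q]
    (φ : S →+* Q) (hφ : Function.Surjective φ) (hI : RingHom.ker φ = I) (N' : ModuleCat.{u} Q)
    (e : N ≃+ N') (he : ∀ s x, e (s • x) = φ s • e x) :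
    (∀ i, bettiNumber Q N' i = Module.finrank S (Y.G i)) ∧
    (∀ i, extDim Q N' i = Module.finrank S (Y.G i)) ∧
    ((∃ n, Subsingleton (Y.G n)) → projectiveDimension N' < ⊤) := by
  let := φ.toAlgebra
  have hQ : Function.Surjective (algebraMap S Q) := hφ
  have hI' : RingHom.ker (algebraMap S Q) = I := hI
  let : Module S N' := Module.compHom N' φ
  have : IsScalarTower S Q N' := ⟨fun s q x => by
    rw [Algebra.smul_def, mul_smul]; rfl⟩
  let e' : N →ₗ[S] N' := { toFun := e, map_add' := e.map_add, map_smul' := he }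
  let ε' : Q ⊗[S] Y.G 0 →ₗ[Q] N' := (LinearMap.liftBaseChange Q (e' ∘ₗ ε))
  have hε' : ∀ x, ε' (1 ⊗ₜ x) = e (ε x) := fun x => by
    simp [ε', e']
  have hex : Function.Exact ((Y.D 0).baseChange Q) ε' := by
    intro x
    obtain ⟨x, rfl⟩ := exists_one_tmul_eq hQ x
    rw [hε', e.map_eq_zero_iff]
    constructor
    · intro h
      obtain ⟨y, hy⟩ := hY.exact x h
      refine ⟨1 ⊗ₜ y, ?_⟩
      rw [← one_tmul_eq_zero_iff (Q := Q) hI', TensorProduct.tmul_sub, sub_eq_zero] at hy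
      rw [LinearMap.baseChange_tmul, hy]
    · rintro ⟨y, hy⟩
      obtain ⟨y, rfl⟩ := exists_one_tmul_eq hQ y
      rw [LinearMap.baseChange_tmul, ← sub_eq_zero, ← TensorProduct.tmul_sub,
        one_tmul_eq_zero_iff hI'] at hy
      have h1 := hY.apply_mem _ hy
      rw [map_sub, hY.apply_D, zero_sub, neg_eq_zero] at h1
      exact h1
  have hsurj : Function.Surjective ε' := by
    intro n
    obtain ⟨x, hx⟩ := hY.surj (e.symm n)
    exact ⟨1 ⊗ₜ x, by rw [hε', hx, e.apply_symm_apply]⟩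
  have key := bettiNumber_extDim_eq_of_minimal N' (fun i => Q ⊗[S] Y.G i)
    (fun i => (Y.D i).baseChange Q) ε' (Y.exact_baseChange hQ hI') hex hsurj (by
      intro i x
      obtain ⟨x, rfl⟩ := exists_one_tmul_eq hQ x
      rw [LinearMap.baseChange_tmul]
      exact one_tmul_mem_maximalIdeal_smul hQ (Y.minimal i x))
  refine ⟨fun i => ?_, fun i => ?_, ?_⟩
  · rw [(key i).1, Module.finrank_baseChange]
  · rw [(key i).2, Module.finrank_baseChange]
  · rintro ⟨n, hn⟩
    have := hasProjectiveDimensionLT_of_exact n N' (fun i => Q ⊗[S] Y.G i)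
      (fun i => (Y.D i).baseChange Q) ε' (Y.exact_baseChange hQ hI') hex hsurj
      inferInstance
    refine lt_of_lt_of_le (projectiveDimension_lt_iff.2 this) ?_
    exact le_top

end ModRes

/-! ### Passing from a resolution modulo `I` to one modulo `I + (f)` -/

/-- The modules `⨁_j G (i - 2j)`. -/
def evenSum (G : ℕ → Type u) : ℕ → Type u
  | 0 => G 0
  | 1 => G 1
  | i + 2 => G (i + 2) × evenSum G i

namespace evenSum

variable {S : Type u} [CommRing S] (G : ℕ → Type u) [acg : ∀ i, AddCommGroup (G i)]

instance instAddCommGroup : ∀ i, AddCommGroup (evenSum G i)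
  | 0 => acg 0
  | 1 => acg 1
  | i + 2 => @Prod.instAddCommGroup _ _ (acg (i + 2)) (instAddCommGroup i)

variable [mod : ∀ i, Module S (G i)]

instance instModule : ∀ i, Module S (evenSum G i)
  | 0 => mod 0
  | 1 => mod 1
  | i + 2 => @Prod.instModule _ _ _ _ _ _ (mod (i + 2)) (instModule i)

instance instFree [free : ∀ i, Module.Free S (G i)] : ∀ i, Module.Free S (evenSum G i)
  | 0 => free 0
  | 1 => free 1
  | i + 2 =>
    have := instFree i
    inferInstanceAs (Module.Free S (G (i + 2) × evenSum G i))

instance instFinite [finite : ∀ i, Module.Finite S (G i)] : ∀ i, Module.Finite S (evenSum G i)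
  | 0 => finite 0
  | 1 => finite 1
  | i + 2 =>
    have := instFinite i
    inferInstanceAs (Module.Finite S (G (i + 2) × evenSum G i))

variable (S)

/-- The projection to the first summand. -/
def pr : ∀ i, evenSum G i →ₗ[S] G i
  | 0 => LinearMap.id
  | 1 => LinearMap.id
  | i + 2 => LinearMap.fst S (G (i + 2)) (evenSum G i)

/-- The projection to the remaining summands. -/
def t (i : ℕ) : evenSum G (i + 2) →ₗ[S] evenSum G i :=
  LinearMap.snd S (G (i + 2)) (evenSum G i)

theorem mem_idealTop_iff {I : Ideal S} {i : ℕ} {x : evenSum G (i + 2)} :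
    x ∈ idealTop I (evenSum G (i + 2)) ↔
      pr S G (i + 2) x ∈ idealTop I (G (i + 2)) ∧ t S G i x ∈ idealTop I (evenSum G i) :=
  mem_idealTop_prod (G := G (i + 2)) (G' := evenSum G i)

end evenSum

namespace ModRes

variable {S : Type u} [CommRing S] [IsLocalRing S] {I : Ideal S}

local notation "𝔪" => IsLocalRing.maximalIdeal S

/-- The operators defined by `D²` detect minimal generators in degree at least two. -/
def IsDetecting (Y : ModRes S I) : Prop :=
  ∀ i (x : Y.G (i + 1 + 1)), Y.D i (Y.D (i + 1) x) ∈ idealTop (𝔪 * I) (Y.G i) →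
    x ∈ idealTop 𝔪 (Y.G (i + 1 + 1))

section Shamash

variable (H : ModRes S I)

/-- A choice of preimages under `D` modulo `I`. -/
def lift {F : Type u} [AddCommGroup F] [Module S F] [Module.Free S F] (i : ℕ)
    (z : F →ₗ[S] H.G (i + 1)) : F →ₗ[S] H.G (i + 1 + 1) := by
  classical
  -- The default value 0 lets all the homotopies be defined recursively before the cycle condition
  -- is proved; `lift_spec` recovers the meaning afterwards.
  exact if h : ∀ x, H.D i (z x) ∈ idealTop I (H.G i) then
    (exists_linearMap_lift (H.D (i + 1)) z fun x => H.exact i (z x) (h x)).choose else 0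

theorem lift_spec {F : Type u} [AddCommGroup F] [Module S F] [Module.Free S F] (i : ℕ)
    (z : F →ₗ[S] H.G (i + 1)) (h : ∀ x, H.D i (z x) ∈ idealTop I (H.G i)) (x : F) :
    z x - H.D (i + 1) (H.lift i z x) ∈ idealTop I (H.G (i + 1)) := by
  rw [lift, dif_pos h]
  exact (exists_linearMap_lift (H.D (i + 1)) z fun x => H.exact i (z x) (h x)).choose_spec x

variable (f : S) (h : H.G 0 →ₗ[S] H.G 1)

/-- Consecutive differentials and homotopies of the extended resolution. -/
structure ShamashStage (i : ℕ) where
  d₀ : evenSum H.G (i + 1) →ₗ[S] evenSum H.G i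
  d₁ : evenSum H.G (i + 2) →ₗ[S] evenSum H.G (i + 1)
  s₀ : evenSum H.G i →ₗ[S] H.G (i + 1)
  s₁ : evenSum H.G (i + 1) →ₗ[S] H.G (i + 2)

/-- The stages, starting from the homotopy `h`. -/
def shamashStage : ∀ i, H.ShamashStage i
  | 0 =>
    { d₀ := H.D 0
      d₁ := (H.D 1 ∘ₗ evenSum.pr S H.G 2 + h ∘ₗ evenSum.t S H.G 0 :
        evenSum H.G 2 →ₗ[S] H.G 1)
      s₀ := h
      s₁ := H.lift 0 ((f • LinearMap.id - h ∘ₗ H.D 0 : H.G 1 →ₗ[S] H.G 1)) }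
  | i + 1 =>
    let T := shamashStage i
    { d₀ := T.d₁
      d₁ := LinearMap.prod (H.D (i + 2) ∘ₗ evenSum.pr S H.G (i + 3) + T.s₁ ∘ₗ evenSum.t S H.G (i + 1))
        (T.d₀ ∘ₗ evenSum.t S H.G (i + 1))
      s₀ := T.s₁
      s₁ := H.lift (i + 1) (f • evenSum.pr S H.G (i + 2) - T.s₁ ∘ₗ T.d₁) }

/-- The differentials of the extended resolution. -/
def shD (i : ℕ) : evenSum H.G (i + 1) →ₗ[S] evenSum H.G i := (H.shamashStage f h i).d₀

/-- The homotopies of the extended resolution. -/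
def shs (i : ℕ) : evenSum H.G i →ₗ[S] H.G (i + 1) := (H.shamashStage f h i).s₀

local notation "δ" => H.shD f h
local notation "σ" => H.shs f h
local notation "pr" => evenSum.pr S H.G
local notation "τ" => evenSum.t S H.G

theorem shs_succ : ∀ i, σ (i + 1) = H.lift i (f • pr (i + 1) - σ i ∘ₗ δ i)
  | 0 => rfl
  | _ + 1 => rfl

theorem pr_shD : ∀ i (x : evenSum H.G (i + 2)),
    pr (i + 1) (δ (i + 1) x) = H.D (i + 1) (pr (i + 2) x) + σ i (τ i x)
  | 0, _ => rfl
  | _ + 1, _ => rfl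

theorem t_shD (i : ℕ) (x : evenSum H.G (i + 3)) :
    τ i (δ (i + 2) x) = δ i (τ (i + 1) x) := rfl

variable {f h}
variable (hh : ∀ x, H.D 0 (h x) - f • x ∈ idealTop I (H.G 0))

theorem D_shs_mem_of (i : ℕ)
    (h' : ∀ x, H.D i (f • pr (i + 1) x - σ i (δ i x)) ∈ idealTop I (H.G i)) (x) :
    f • pr (i + 1) x - σ i (δ i x) - H.D (i + 1) (σ (i + 1) x) ∈ idealTop I (H.G (i + 1)) := by
  rw [shs_succ]
  exact H.lift_spec i (f • pr (i + 1) - σ i ∘ₗ δ i) h' x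

/-- The homotopy relation at stage i, combined with D² ≡ 0, is the leading coordinate of δδ ≡ fτ one
stage later. -/
theorem pr_shD_shD_mem (i : ℕ) (ha : ∀ x, f • pr (i + 1) x - σ i (δ i x) -
      H.D (i + 1) (σ (i + 1) x) ∈ idealTop I (H.G (i + 1))) (x : evenSum H.G (i + 3)) :
    pr (i + 1) (δ (i + 1) (δ (i + 2) x)) - f • pr (i + 1) (τ (i + 1) x) ∈
      idealTop I (H.G (i + 1)) := by
  have h1 := ha (τ (i + 1) x)
  have h2 := H.sq (i + 1) (pr (i + 3) x)
  rw [pr_shD, pr_shD, t_shD, map_add]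
  have h3 := sub_mem h2 h1
  convert h3 using 1
  abel

include hh in
-- The relations δδ ≡ fτ and Dσ + σδ ≡ f·pr are proved in tandem. The first makes f·pr - σδ a cycle,
-- so that the next σ exists; the second gives the leading coordinate of the next δδ ≡ fτ, whose
-- tail is an earlier instance. Two consecutive instances are carried because the direct sums recur
-- with step two.
theorem shD_shD_shs (i : ℕ) :
    (∀ x, δ i (δ (i + 1) x) - f • τ i x ∈ idealTop I (evenSum H.G i)) ∧
    (∀ x, δ (i + 1) (δ (i + 2) x) - f • τ (i + 1) x ∈ idealTop I (evenSum H.G (i + 1))) ∧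
    (∀ x, f • pr (i + 1) x - σ i (δ i x) - H.D (i + 1) (σ (i + 1) x) ∈
      idealTop I (H.G (i + 1))) := by
  induction i with
  | zero =>
    have ha : ∀ x, f • pr 1 x - σ 0 (δ 0 x) - H.D 1 (σ 1 x) ∈ idealTop I (H.G 1) := by
      refine H.D_shs_mem_of 0 fun x => ?_
      have key (y : H.G 1) : H.D 0 (f • y - h (H.D 0 y)) ∈ idealTop I (H.G 0) := by
        rw [map_sub, map_smul, ← neg_mem_iff, neg_sub]
        exact hh (H.D 0 y)
      exact key x
    have key (a : H.G 2) (b : H.G 0) : H.D 0 (H.D 1 a + h b) - f • b ∈ idealTop I (H.G 0) := by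
      rw [map_add, add_sub_assoc]
      exact add_mem (H.sq 0 a) (hh b)
    exact ⟨fun x => key (pr 2 x) (τ 0 x), H.pr_shD_shD_mem 0 ha, ha⟩
  | succ i ih =>
    obtain ⟨h0, h1, ha⟩ := ih
    have ha' : ∀ x, f • pr (i + 2) x - σ (i + 1) (δ (i + 1) x) - H.D (i + 2) (σ (i + 2) x) ∈
        idealTop I (H.G (i + 2)) := by
      refine H.D_shs_mem_of (i + 1) fun x => ?_
      have h2 := add_mem (ha (δ (i + 1) x)) (map_mem_idealTop (σ i) (h0 x))
      convert h2 using 1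
      rw [pr_shD, map_sub, map_sub, map_smul, map_smul, smul_add]
      abel
    refine ⟨h1, fun x => ?_, ha'⟩
    rw [evenSum.mem_idealTop_iff]
    refine ⟨H.pr_shD_shD_mem (i + 1) ha' x, ?_⟩
    exact h0 (τ (i + 2) x)

variable (hf : ∀ s, f * s ∈ I → s ∈ I)

include hh hf in
-- Once the tail of a cycle is a boundary, only the leading coordinate is left, and it is treated
-- with the exactness of `H` modulo I and the regularity of f.
theorem exists_mem_of_pr_mem (i : ℕ) (x : evenSum H.G (i + 2)) (u : evenSum H.G (i + 1))
    (hu : τ i x - δ i u ∈ idealTop (I ⊔ Ideal.span {f}) (evenSum H.G i))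
    (hx : δ (i + 1) x ∈ idealTop (I ⊔ Ideal.span {f}) (evenSum H.G (i + 1))) :
    ∃ y, x - δ (i + 2) y ∈ idealTop (I ⊔ Ideal.span {f}) (evenSum H.G (i + 2)) := by
  set I' := I ⊔ Ideal.span {f} with hI'
  -- Subtracting δ(0, u) clears the tail modulo I + (f) and keeps a cycle, because δδ ≡ fτ.
  let y₁ : evenSum H.G (i + 3) := ((0, u) : H.G (i + 3) × evenSum H.G (i + 1))
  let x' := x - δ (i + 2) y₁
  have hx'1 : τ i x' ∈ idealTop I' (evenSum H.G i) := by
    rw [map_sub, t_shD]; exact hu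
  have hx'2 : δ (i + 1) x' ∈ idealTop I' (evenSum H.G (i + 1)) := by
    rw [map_sub]
    refine sub_mem hx ?_
    have h1 := (H.shD_shD_shs hh (i + 1)).1 y₁
    have h2 := mem_idealTop_sup_span.2 ⟨_, h1⟩
    exact h2
  have hz : H.D (i + 1) (pr (i + 2) x') ∈ idealTop I' (H.G (i + 1)) := by
    have h1 := map_mem_idealTop (pr (i + 1)) hx'2
    rw [pr_shD] at h1
    exact (Submodule.add_mem_iff_left _ (map_mem_idealTop (σ i) hx'1)).1 h1
  obtain ⟨z, hz⟩ := mem_idealTop_sup_span.1 hz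
  -- D² ≡ 0 gives f·Dz ≡ 0, so z is a cycle modulo I and hence a boundary Dw; replacing the leading
  -- coordinate by itself minus f·w makes it a cycle modulo I.
  have hDz : H.D i z ∈ idealTop I (H.G i) := by
    refine mem_idealTop_of_smul_mem hf ?_
    have h1 := map_mem_idealTop (H.D i) hz
    rw [map_sub, map_smul] at h1
    exact (Submodule.sub_mem_iff_right _ (H.sq _ _)).1 h1
  obtain ⟨w, hw⟩ := H.exact i z hDz
  have h2 : H.D (i + 1) (pr (i + 2) x' - f • w) ∈ idealTop I (H.G (i + 1)) := by
    have h1 := add_mem hz (Submodule.smul_mem _ f hw)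
    convert h1 using 1
    rw [map_sub, map_smul, smul_sub]
    abel
  obtain ⟨v, hv⟩ := H.exact (i + 1) _ h2
  let y₂ : evenSum H.G (i + 3) := ((v, 0) : H.G (i + 3) × evenSum H.G (i + 1))
  refine ⟨y₁ + y₂, ?_⟩
  rw [map_add, ← sub_sub]
  change x' - _ ∈ _
  have hy1 : pr (i + 3) y₂ = v := rfl
  have hy2 : τ (i + 1) y₂ = 0 := rfl
  rw [evenSum.mem_idealTop_iff, map_sub _ x', map_sub _ x', pr_shD, t_shD, hy1, hy2, map_zero,
    add_zero, map_zero, sub_zero]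
  refine ⟨mem_idealTop_sup_span.2 ⟨w, ?_⟩, hx'1⟩
  convert hv using 1
  abel

include hh hf in
-- In degree 1, Dx ≡ fz and subtracting hz leaves a cycle of `H`. In degree 2 the cycle condition
-- does not constrain the tail through a differential; instead δx ≡ fu gives f(τx - δu) ≡ 0, so the
-- tail is the boundary of u. From degree 3 on the tail is itself a cycle and the recursion applies
-- to it.
theorem exact_shD : ∀ (i : ℕ) (x : evenSum H.G (i + 1)),
    δ i x ∈ idealTop (I ⊔ Ideal.span {f}) (evenSum H.G i) →
    ∃ y, x - δ (i + 1) y ∈ idealTop (I ⊔ Ideal.span {f}) (evenSum H.G (i + 1))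
  | 0, x, hx => by
    obtain ⟨z, hz⟩ := mem_idealTop_sup_span.1 hx
    have key (x : H.G 1) (z : H.G 0) (hz : H.D 0 x - f • z ∈ idealTop I (H.G 0)) :
        ∃ v, x - (H.D 1 v + h z) ∈ idealTop I (H.G 1) := by
      have h1 : H.D 0 (x - h z) ∈ idealTop I (H.G 0) := by
        rw [map_sub, ← sub_sub_sub_cancel_right _ _ (f • z)]
        exact sub_mem hz (hh z)
      obtain ⟨v, hv⟩ := H.exact 0 _ h1
      refine ⟨v, ?_⟩
      rwa [add_comm, ← sub_sub]
    obtain ⟨v, hv⟩ := key x z hz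
    exact ⟨((v, z) : H.G 2 × H.G 0), idealTop_mono le_sup_left hv⟩
  | 1, x, hx => by
    obtain ⟨u, hu⟩ := mem_idealTop_sup_span.1 hx
    refine H.exists_mem_of_pr_mem hh hf 0 x u (idealTop_mono le_sup_left ?_) hx
    refine mem_idealTop_of_smul_mem hf ?_
    have h1 := map_mem_idealTop (δ 0) hu
    have h2 := sub_mem h1 ((H.shD_shD_shs hh 0).1 x)
    convert h2 using 1
    rw [map_sub, map_smul, smul_sub]
    abel
  | i + 2, x, hx => by
    obtain ⟨u, hu⟩ := exact_shD i (τ (i + 1) x) (by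
      rw [← t_shD]
      exact map_mem_idealTop (τ i) hx)
    exact H.exists_mem_of_pr_mem hh hf (i + 1) x u hu hx

/-- The entries of δ are those of `D` and of the earlier σ, so minimality reduces to σ having values
in 𝔪. -/
theorem minimal_shD_of (i : ℕ) (hs : ∀ j < i, ∀ x, σ j x ∈ idealTop 𝔪 (H.G (j + 1))) :
    ∀ x, δ i x ∈ idealTop 𝔪 (evenSum H.G i) := by
  induction i using Nat.strong_induction_on with
  | _ i ih =>
    match i, hs, ih with
    | 0, _, _ => exact H.minimal 0
    | 1, hs, _ =>
      exact fun x => add_mem (H.minimal 1 (pr 2 x)) (hs 0 Nat.zero_lt_one (τ 0 x))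
    | i + 2, hs, ih =>
      intro x
      rw [evenSum.mem_idealTop_iff, pr_shD, t_shD]
      exact ⟨add_mem (H.minimal _ _) (hs (i + 1) (by omega) _),
        ih i (by omega) (fun j hj => hs j (by omega)) _⟩

variable (hJ : H.IsDetecting)

include hh hJ in
-- Applying D to the homotopy relation gives DDσ(x) ≡ (f - Dh)(Dx) modulo 𝔪I. Since f - Dh has
-- values in I and Dx lies in 𝔪, this is in 𝔪I, and detection applies.
theorem minimal_shs_one (x : evenSum H.G 1) : σ 1 x ∈ idealTop 𝔪 (H.G 2) := by
  refine hJ 0 _ ?_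
  have key (x : H.G 1) (z : H.G 2) (hz : f • x - h (H.D 0 x) - H.D 1 z ∈ idealTop I (H.G 1)) :
      H.D 0 (H.D 1 z) ∈ idealTop (𝔪 * I) (H.G 0) := by
    have h1 := map_mem_idealTop_mul (H.D 0) (H.minimal 0) hz
    have h2 := map_mem_idealTop_mul' (H.D 0 ∘ₗ h - f • LinearMap.id) hh (H.minimal 0 x)
    have h3 := neg_mem (add_mem h1 h2)
    convert h3 using 1
    simp only [map_sub, map_smul, LinearMap.sub_apply, LinearMap.comp_apply,
      LinearMap.smul_apply, LinearMap.id_apply]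
    abel
  exact key x _ ((H.shD_shD_shs hh 0).2.2 x)

include hh hJ in
-- Applying D to the relation for x and subtracting it from the relation for δx expresses DDσ(x)
-- through errors in 𝔪I: D and σ_i map I into 𝔪I, and the relation maps δx, which lies in 𝔪, into
-- 𝔪I. Only σ_j with j ≤ i are needed.
theorem minimal_shs_add_two (i : ℕ)
    (ih : ∀ j < i + 1, ∀ x : evenSum H.G j, σ j x ∈ idealTop 𝔪 (H.G (j + 1)))
    (x : evenSum H.G (i + 2)) : σ (i + 2) x ∈ idealTop 𝔪 (H.G (i + 3)) := by
  refine hJ (i + 1) _ ?_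
  have h1 := map_mem_idealTop_mul (H.D (i + 1)) (H.minimal (i + 1))
    ((H.shD_shD_shs hh (i + 1)).2.2 x)
  have h2 := map_mem_idealTop_mul' (f • pr (i + 1) - σ i ∘ₗ δ i - H.D (i + 1) ∘ₗ σ (i + 1))
    (H.shD_shD_shs hh i).2.2 (H.minimal_shD_of (i + 1) ih x)
  have h3 := map_mem_idealTop_mul (σ i) (ih i (Nat.lt_succ_self i)) ((H.shD_shD_shs hh i).1 x)
  have h4 := sub_mem (add_mem h2 h3) h1
  convert h4 using 1
  simp only [map_sub, map_smul, LinearMap.sub_apply, LinearMap.comp_apply,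
    LinearMap.smul_apply, pr_shD, smul_add]
  abel

theorem minimal_shs_zero (hm : ∀ x : H.G 0, h x ∈ idealTop 𝔪 (H.G 1)) (x : evenSum H.G 0) :
    σ 0 x ∈ idealTop 𝔪 (H.G 1) := hm x

include hh hJ in
theorem minimal_shs (h0 : ∀ x : evenSum H.G 0, σ 0 x ∈ idealTop 𝔪 (H.G 1)) (i : ℕ) :
    ∀ x : evenSum H.G i, σ i x ∈ idealTop 𝔪 (H.G (i + 1)) := by
  induction i using Nat.strong_induction_on with
  | _ i ih =>
    obtain _ | _ | i := i
    · exact h0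
    · exact H.minimal_shs_one hh hJ
    · exact H.minimal_shs_add_two hh hJ i fun j hj => ih j (by omega)

theorem pr_shD_shD_of_t_eq_zero (i : ℕ) (x : evenSum H.G (i + 2)) (hx : τ i x = 0) :
    pr i (δ i (δ (i + 1) x)) = H.D i (H.D (i + 1) (pr (i + 2) x)) := by
  match i, x, hx with
  | 0, x, hx =>
    have h1 : h (τ 0 x) = 0 := (congrArg h hx).trans (map_zero h)
    change H.D 0 (H.D 1 (pr 2 x) + h (τ 0 x)) = _
    rw [h1, add_zero]
  | i + 1, x, hx =>
    rw [pr_shD, pr_shD, t_shD, hx, map_zero, map_zero, map_zero, add_zero, add_zero]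

include hh hf hJ in
-- The part fτ of δδ detects the tail, since f is regular modulo I. With the tail removed, the
-- leading coordinate of δδ is D², and the detection property of `H` takes over.
theorem mem_of_shD_shD_mem (hfm : f ∈ 𝔪) (hI : I ≤ 𝔪) (i : ℕ) (x : evenSum H.G (i + 2))
    (hx : δ i (δ (i + 1) x) ∈ idealTop (𝔪 * (I ⊔ Ideal.span {f})) (evenSum H.G i)) :
    x ∈ idealTop 𝔪 (evenSum H.G (i + 2)) := by
  have hD := (H.shD_shD_shs hh i).1
  obtain ⟨u, hu, hux⟩ := mem_idealTop_mul_sup_span.1 hx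
  have ht : τ i x ∈ idealTop 𝔪 (evenSum H.G i) := by
    have h1 : f • (τ i x - u) ∈ idealTop I (evenSum H.G i) := by
      have h2 := sub_mem (idealTop_mono Ideal.mul_le_right hux) (hD x)
      convert h2 using 1
      rw [smul_sub]
      abel
    have h2 := idealTop_mono hI (mem_idealTop_of_smul_mem hf h1)
    exact (Submodule.sub_mem_iff_left _ hu).1 h2
  -- The tail lies in 𝔪, so its contribution to δδ lies in 𝔪(I + (f)) and x may be replaced by x -
  -- y, whose tail is zero.
  let y : evenSum H.G (i + 2) := ((0, τ i x) : H.G (i + 2) × evenSum H.G i)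
  have hy : y ∈ idealTop 𝔪 (evenSum H.G (i + 2)) :=
    (evenSum.mem_idealTop_iff S H.G).2 ⟨zero_mem _, ht⟩
  have hpr : pr (i + 2) (x - y) = pr (i + 2) x := by
    rw [map_sub]
    exact sub_zero _
  have htx : τ i (x - y) = 0 := by
    rw [map_sub]
    exact sub_self _
  have h1 : δ i (δ (i + 1) (x - y)) ∈ idealTop (𝔪 * (I ⊔ Ideal.span {f})) (evenSum H.G i) := by
    rw [map_sub, map_sub]
    exact sub_mem hx (map_mem_idealTop_mul' (δ i ∘ₗ δ (i + 1))
      (fun x => mem_idealTop_sup_span.2 ⟨_, hD x⟩) hy)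
  have h2 := hD (x - y)
  rw [htx, smul_zero, sub_zero] at h2
  have h3 := map_mem_idealTop (pr i) h1
  have h4 := map_mem_idealTop (pr i) h2
  rw [pr_shD_shD_of_t_eq_zero H i _ htx, hpr] at h3 h4
  obtain ⟨v, -, hv'⟩ := mem_idealTop_mul_sup_span.1 h3
  have h5 : f • v ∈ idealTop I (H.G i) :=
    (Submodule.sub_mem_iff_right _ h4).1
      (idealTop_mono Ideal.mul_le_right hv')
  -- Regularity puts v in I, and f lies in 𝔪, so the term f·v is in 𝔪I and can be dropped.
  have h6 := smul_mem_idealTop_mul hfm (mem_idealTop_of_smul_mem hf h5)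
  rw [evenSum.mem_idealTop_iff]
  exact ⟨hJ i _ ((Submodule.sub_mem_iff_left _ h6).1 hv'), ht⟩

end Shamash

/-- The resolution modulo `I + (f)` obtained from a resolution modulo `I` and a homotopy for
multiplication by `f`. -/
def shamash (H : ModRes S I) (f : S) (h : H.G 0 →ₗ[S] H.G 1)
    (hh : ∀ x, H.D 0 (h x) - f • x ∈ idealTop I (H.G 0)) (hf : ∀ s, f * s ∈ I → s ∈ I)
    (hm : ∀ x : H.G 0, h x ∈ idealTop 𝔪 (H.G 1)) (hJ : H.IsDetecting) :
    ModRes S (I ⊔ Ideal.span {f}) where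
  G := evenSum H.G
  D := H.shD f h
  sq i x := mem_idealTop_sup_span.2 ⟨_, (H.shD_shD_shs hh i).1 x⟩
  exact := H.exact_shD hh hf
  minimal i := H.minimal_shD_of i fun j _ => H.minimal_shs hh hJ (H.minimal_shs_zero hm) j

theorem isDetecting_shamash (H : ModRes S I) (f : S) (h : H.G 0 →ₗ[S] H.G 1)
    (hh : ∀ x, H.D 0 (h x) - f • x ∈ idealTop I (H.G 0)) (hf : ∀ s, f * s ∈ I → s ∈ I)
    (hm : ∀ x : H.G 0, h x ∈ idealTop 𝔪 (H.G 1)) (hJ : H.IsDetecting) (hfm : f ∈ 𝔪) (hI : I ≤ 𝔪) :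
    (H.shamash f h hh hf hm hJ).IsDetecting :=
  H.mem_of_shD_shD_mem hh hf hJ hfm hI

end ModRes

/-! ### Mapping cones and direct sums of resolutions modulo an ideal -/

/-- The modules of the mapping cone of a map of complexes. -/
def coneFamily (Y W : ℕ → Type u) : ℕ → Type u
  | 0 => Y 0
  | i + 1 => Y (i + 1) × W i

namespace coneFamily

variable {S : Type u} [CommRing S] (Y W : ℕ → Type u) [acY : ∀ i, AddCommGroup (Y i)]
  [acW : ∀ i, AddCommGroup (W i)]

instance instAddCommGroup : ∀ i, AddCommGroup (coneFamily Y W i)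
  | 0 => acY 0
  | i + 1 => inferInstanceAs (AddCommGroup (Y (i + 1) × W i))

variable [mY : ∀ i, Module S (Y i)] [mW : ∀ i, Module S (W i)]

instance instModule : ∀ i, Module S (coneFamily Y W i)
  | 0 => mY 0
  | i + 1 => inferInstanceAs (Module S (Y (i + 1) × W i))

instance instFree [fY : ∀ i, Module.Free S (Y i)] [∀ i, Module.Free S (W i)] :
    ∀ i, Module.Free S (coneFamily Y W i)
  | 0 => fY 0
  | i + 1 => inferInstanceAs (Module.Free S (Y (i + 1) × W i))

instance instFinite [fY : ∀ i, Module.Finite S (Y i)] [∀ i, Module.Finite S (W i)] :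
    ∀ i, Module.Finite S (coneFamily Y W i)
  | 0 => fY 0
  | i + 1 => inferInstanceAs (Module.Finite S (Y (i + 1) × W i))

end coneFamily

namespace ModRes

variable {S : Type u} [CommRing S] [IsLocalRing S] {I : Ideal S}

local notation "𝔪" => IsLocalRing.maximalIdeal S

variable {U V N : Type u} [AddCommGroup U] [Module S U] [AddCommGroup V] [Module S V]
  [AddCommGroup N] [Module S N]

section ChainMap

variable (W Y : ModRes S I)

/-- The extension of two maps to a map of complexes modulo `I`. -/
def chainMap (Φ₀ : W.G 0 →ₗ[S] Y.G 0) (Φ₁ : W.G 1 →ₗ[S] Y.G 1) : ∀ i, W.G i →ₗ[S] Y.G i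
  | 0 => Φ₀
  | 1 => Φ₁
  | i + 2 => Y.lift i (chainMap Φ₀ Φ₁ (i + 1) ∘ₗ W.D (i + 1))

variable {W Y}

theorem D_chainMap {Φ₀ : W.G 0 →ₗ[S] Y.G 0} {Φ₁ : W.G 1 →ₗ[S] Y.G 1}
    (h : ∀ x, Φ₀ (W.D 0 x) - Y.D 0 (Φ₁ x) ∈ idealTop I (Y.G 0)) (i : ℕ) (x : W.G (i + 1)) :
    chainMap W Y Φ₀ Φ₁ i (W.D i x) - Y.D i (chainMap W Y Φ₀ Φ₁ (i + 1) x) ∈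
      idealTop I (Y.G i) := by
  induction i with
  | zero => exact h x
  | succ i ih =>
    refine Y.lift_spec i (chainMap W Y Φ₀ Φ₁ (i + 1) ∘ₗ W.D (i + 1)) (fun x => ?_) x
    have h1 := map_mem_idealTop (chainMap W Y Φ₀ Φ₁ i) (W.sq i x)
    exact (Submodule.sub_mem_iff_right _ h1).1 (ih _)

theorem exists_chainMap {εW : W.G 0 →ₗ[S] U} {εY : Y.G 0 →ₗ[S] V} (hW : W.Resolves εW)
    (hY : Y.Resolves εY) (φ : U →ₗ[S] V) :
    ∃ Φ : ∀ i, W.G i →ₗ[S] Y.G i, (∀ x, εY (Φ 0 x) = φ (εW x)) ∧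
      ∀ i x, Φ i (W.D i x) - Y.D i (Φ (i + 1) x) ∈ idealTop I (Y.G i) := by
  obtain ⟨Φ₀, h₀⟩ := exists_linearMap_lift (N := ⊥) εY (φ ∘ₗ εW) fun x => by
    obtain ⟨y, hy⟩ := hY.surj (φ (εW x))
    exact ⟨y, by simp [hy]⟩
  have h₀' : ∀ x, εY (Φ₀ x) = φ (εW x) := fun x =>
    (sub_eq_zero.1 ((Submodule.mem_bot S).1 (h₀ x))).symm
  obtain ⟨Φ₁, h₁⟩ := exists_linearMap_lift (Y.D 0) (Φ₀ ∘ₗ W.D 0) fun x => hY.exact _ (by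
    rw [LinearMap.comp_apply, h₀', hW.apply_D, map_zero])
  exact ⟨chainMap W Y Φ₀ Φ₁, h₀', D_chainMap h₁⟩

/-- A map with coefficients in the maximal ideal lifts to a map of complexes with coefficients in
the maximal ideal. -/
theorem exists_minimal_chainMap {εW : W.G 0 →ₗ[S] U} {εY : Y.G 0 →ₗ[S] V}
    (hW : W.Resolves εW) (hY : Y.Resolves εY) {φ : U →ₗ[S] V}
    (hφ : φ ∈ 𝔪 • (⊤ : Submodule S (U →ₗ[S] V))) :
    ∃ Φ : ∀ i, W.G i →ₗ[S] Y.G i, (∀ x, εY (Φ 0 x) = φ (εW x)) ∧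
      (∀ i x, Φ i (W.D i x) - Y.D i (Φ (i + 1) x) ∈ idealTop I (Y.G i)) ∧
      ∀ i x, Φ i x ∈ idealTop 𝔪 (Y.G i) := by
  -- A generator rφ of 𝔪 Hom(U, V) is lifted by r times a lift of φ, which has its entries in 𝔪.
  induction hφ using Submodule.smul_induction_on' with
  | smul r hr φ _ =>
    obtain ⟨Φ, h0, h1⟩ := exists_chainMap hW hY φ
    refine ⟨fun i => r • Φ i, fun x => ?_, fun i x => ?_, fun i x => smul_mem_idealTop hr _⟩
    · rw [LinearMap.smul_apply, map_smul, h0, LinearMap.smul_apply]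
    · rw [LinearMap.smul_apply, LinearMap.smul_apply, map_smul, ← smul_sub]
      exact Submodule.smul_mem _ r (h1 i x)
  | add φ _ ψ _ hφ hψ =>
    obtain ⟨Φ, h0, h1, h2⟩ := hφ
    obtain ⟨Ψ, h0', h1', h2'⟩ := hψ
    refine ⟨fun i => Φ i + Ψ i, fun x => ?_, fun i x => ?_, fun i x => add_mem (h2 i x) (h2' i x)⟩
    · rw [LinearMap.add_apply, map_add, h0, h0', LinearMap.add_apply]
    · rw [LinearMap.add_apply, LinearMap.add_apply, map_add, add_sub_add_comm]
      exact add_mem (h1 i x) (h1' i x)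

end ChainMap

section Cone

variable (Y W : ModRes S I) (Φ : ∀ i, W.G i →ₗ[S] Y.G i)

/-- The differential of the mapping cone. -/
def coneD : ∀ i, coneFamily Y.G W.G (i + 1) →ₗ[S] coneFamily Y.G W.G i
  | 0 => (LinearMap.coprod (Y.D 0) (Φ 0) : Y.G 1 × W.G 0 →ₗ[S] Y.G 0)
  | i + 1 => (LinearMap.prod (LinearMap.coprod (Y.D (i + 1)) (Φ (i + 1)))
      (-(W.D i ∘ₗ LinearMap.snd S _ _)) :
        Y.G (i + 2) × W.G (i + 1) →ₗ[S] Y.G (i + 1) × W.G i)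

variable {Y W Φ} (hΦ : ∀ i x, Φ i (W.D i x) - Y.D i (Φ (i + 1) x) ∈ idealTop I (Y.G i))

include hΦ in
theorem coneD_coneD : ∀ i (x : coneFamily Y.G W.G (i + 2)),
    coneD Y W Φ i (coneD Y W Φ (i + 1) x) ∈ idealTop I (coneFamily Y.G W.G i) := by
  have key : ∀ i (y : Y.G (i + 2)) (w : W.G (i + 1)),
      Y.D i (Y.D (i + 1) y + Φ (i + 1) w) + Φ i (-W.D i w) ∈ idealTop I (Y.G i) := by
    intro i y w
    have h1 := sub_mem (Y.sq i y) (hΦ i w)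
    convert h1 using 1
    rw [map_add, map_neg]
    abel
  rintro (_ | i) ⟨y, w⟩
  · exact key 0 y w
  · refine mem_idealTop_prod.2 ⟨key (i + 1) y w, ?_⟩
    change -W.D i (-W.D (i + 1) w) ∈ _
    rw [map_neg, neg_neg]
    exact W.sq i w

theorem coneD_minimal (hm : ∀ i x, Φ i x ∈ idealTop 𝔪 (Y.G i)) :
    ∀ i (x : coneFamily Y.G W.G (i + 1)),
      coneD Y W Φ i x ∈ idealTop 𝔪 (coneFamily Y.G W.G i) := by
  rintro (_ | i) ⟨y, w⟩
  · exact add_mem (Y.minimal 0 y) (hm 0 w)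
  · exact mem_idealTop_prod.2 ⟨add_mem (Y.minimal (i + 1) y) (hm (i + 1) w),
      neg_mem (W.minimal i w)⟩

include hΦ in
theorem exists_cone_of_exists (i : ℕ) (y : Y.G (i + 1)) (w : W.G i) (w' : W.G (i + 1))
    (hw : w - W.D i w' ∈ idealTop I (W.G i)) (h : Y.D i y + Φ i w ∈ idealTop I (Y.G i)) :
    ∃ y', y + Φ (i + 1) w' - Y.D (i + 1) y' ∈ idealTop I (Y.G (i + 1)) := by
  refine Y.exact i _ ?_
  have h1 := sub_mem (sub_mem h (map_mem_idealTop (Φ i) hw)) (hΦ i w')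
  convert h1 using 1
  rw [map_add, map_sub]
  abel

include hΦ in
-- Injectivity of `φ` is needed only at the bottom: a cycle (y, w) in degree 1 satisfies φ(ε w) = 0,
-- so w is a boundary. Above that both resolutions are exact.
theorem exact_coneD {εW : W.G 0 →ₗ[S] U} {εY : Y.G 0 →ₗ[S] V} (hW : W.Resolves εW)
    (hY : Y.Resolves εY) {φ : U →ₗ[S] V} (hφ : Function.Injective φ)
    (h0 : ∀ x, εY (Φ 0 x) = φ (εW x)) : ∀ i (x : coneFamily Y.G W.G (i + 1)),
      coneD Y W Φ i x ∈ idealTop I (coneFamily Y.G W.G i) →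
      ∃ y, x - coneD Y W Φ (i + 1) y ∈ idealTop I (coneFamily Y.G W.G (i + 1)) := by
  have key : ∀ i (y : Y.G (i + 1)) (w : W.G i) (w' : W.G (i + 1)),
      w - W.D i w' ∈ idealTop I (W.G i) → Y.D i y + Φ i w ∈ idealTop I (Y.G i) →
      ∃ z, @id (coneFamily Y.G W.G (i + 1)) (y, w) - coneD Y W Φ (i + 1) z ∈
          idealTop I (coneFamily Y.G W.G (i + 1)) := by
    intro i y w w' hw h
    obtain ⟨y', hy'⟩ := exists_cone_of_exists hΦ i y w w' hw h
    refine ⟨((y', -w') : Y.G (i + 2) × W.G (i + 1)), mem_idealTop_prod.2 ⟨?_, ?_⟩⟩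
    · change y - (Y.D (i + 1) y' + Φ (i + 1) (-w')) ∈ _
      convert hy' using 1
      rw [map_neg]
      abel
    · change w - (-W.D i (-w')) ∈ _
      rwa [map_neg, neg_neg]
  rintro (_ | i) ⟨y, w⟩ h
  · have h' : Y.D 0 y + Φ 0 w ∈ idealTop I (Y.G 0) := h
    have h1 := hY.apply_mem _ h'
    rw [map_add, hY.apply_D, zero_add, h0] at h1
    obtain ⟨w', hw'⟩ := hW.exact w (hφ (h1.trans (map_zero φ).symm))
    exact key 0 y w w' hw' h'
  · have h' := (mem_idealTop_prod (G := Y.G (i + 1)) (G' := W.G i)).1 h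
    have h1 : -W.D i w ∈ idealTop I (W.G i) := h'.2
    obtain ⟨w', hw'⟩ := W.exact i w (neg_mem_iff.1 h1)
    exact key (i + 1) y w w' hw' h'.1

end Cone

/-- If `0 → U → V → N → 0` is exact and the first map has coefficients in the maximal ideal,
minimal resolutions of `U` and `V` combine to one of `N`. -/
theorem exists_resolves_of_exact {W Y : ModRes S I} {εW : W.G 0 →ₗ[S] U} {εY : Y.G 0 →ₗ[S] V}
    (hW : W.Resolves εW) (hY : Y.Resolves εY) {φ : U →ₗ[S] V} (hφ : Function.Injective φ)
    (hφm : φ ∈ 𝔪 • (⊤ : Submodule S (U →ₗ[S] V))) {π : V →ₗ[S] N}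
    (hπ : Function.Surjective π) (hφπ : Function.Exact φ π) :
    ∃ (C : ModRes S I) (ε : C.G 0 →ₗ[S] N), C.Resolves ε ∧
      Module.finrank S (C.G 0) = Module.finrank S (Y.G 0) ∧
      ∀ i, Module.finrank S (C.G (i + 1)) =
        Module.finrank S (Y.G (i + 1)) + Module.finrank S (W.G i) := by
  obtain ⟨Φ, h0, h1, h2⟩ := exists_minimal_chainMap hW hY hφm
  let C : ModRes S I :=
    { G := coneFamily Y.G W.G
      D := coneD Y W Φ
      sq := coneD_coneD h1
      exact := exact_coneD h1 hW hY hφ h0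
      minimal := coneD_minimal h2 }
  refine ⟨C, (π ∘ₗ εY : Y.G 0 →ₗ[S] N), ⟨?_, ?_, ?_, ?_⟩, rfl, fun i => ?_⟩
  · exact hπ.comp hY.surj
  · rintro ⟨y, w⟩
    change π (εY (Y.D 0 y + Φ 0 w)) = 0
    rw [map_add, hY.apply_D, zero_add, h0]
    exact hφπ.apply_apply_eq_zero _
  · intro x hx
    change π (εY x) = 0
    rw [hY.apply_mem x hx, map_zero]
  · intro (x : Y.G 0) (hx : π (εY x) = 0)
    obtain ⟨u, hu⟩ := (hφπ _).1 hx
    obtain ⟨w, rfl⟩ := hW.surj u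
    obtain ⟨y, hy⟩ := hY.exact (x - Φ 0 w) (by rw [map_sub, h0, hu, sub_self])
    refine ⟨((y, w) : Y.G 1 × W.G 0), ?_⟩
    change x - (Y.D 0 y + Φ 0 w) ∈ idealTop I (Y.G 0)
    convert hy using 1
    abel
  · exact Module.finrank_prod (R := S) (M := Y.G (i + 1)) (M' := W.G i)

/-- Direct sums of resolutions. -/
theorem exists_resolves_prod {W Y : ModRes S I} {εW : W.G 0 →ₗ[S] U} {εY : Y.G 0 →ₗ[S] V}
    (hW : W.Resolves εW) (hY : Y.Resolves εY) :
    ∃ (C : ModRes S I) (ε : C.G 0 →ₗ[S] U × V), C.Resolves ε ∧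
      ∀ i, Module.finrank S (C.G i) = Module.finrank S (W.G i) + Module.finrank S (Y.G i) := by
  let C : ModRes S I :=
    { G := fun i => W.G i × Y.G i
      D := fun i => (W.D i).prodMap (Y.D i)
      sq := fun i x => mem_idealTop_prod.2 ⟨W.sq i x.1, Y.sq i x.2⟩
      exact := fun i x hx => by
        obtain ⟨h1, h2⟩ := mem_idealTop_prod.1 hx
        obtain ⟨y, hy⟩ := W.exact i x.1 h1
        obtain ⟨z, hz⟩ := Y.exact i x.2 h2
        exact ⟨(y, z), mem_idealTop_prod.2 ⟨hy, hz⟩⟩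
      minimal := fun i x => mem_idealTop_prod.2 ⟨W.minimal i x.1, Y.minimal i x.2⟩ }
  refine ⟨C, εW.prodMap εY, ⟨?_, ?_, ?_, ?_⟩, fun i => Module.finrank_prod⟩
  · exact hW.surj.prodMap hY.surj
  · exact fun x => Prod.ext (hW.apply_D x.1) (hY.apply_D x.2)
  · intro x hx
    obtain ⟨h1, h2⟩ := mem_idealTop_prod.1 hx
    exact Prod.ext (hW.apply_mem _ h1) (hY.apply_mem _ h2)
  · intro x hx
    obtain ⟨y, hy⟩ := hW.exact x.1 (congrArg Prod.fst hx)
    obtain ⟨z, hz⟩ := hY.exact x.2 (congrArg Prod.snd hx)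
    exact ⟨(y, z), mem_idealTop_prod.2 ⟨hy, hz⟩⟩

/-- The zero resolution. -/
def zero (I : Ideal S) : ModRes S I where
  G _ := PUnit.{u + 1}
  D _ := 0
  sq _ _ := zero_mem _
  exact _ _ _ := ⟨0, zero_mem _⟩
  minimal _ _ := zero_mem _

theorem isDetecting_zero : (zero I).IsDetecting := fun _ _ _ => zero_mem _

theorem zero_resolves [Subsingleton N] : (zero I).Resolves (0 : PUnit.{u + 1} →ₗ[S] N) where
  surj _ := ⟨PUnit.unit, Subsingleton.elim _ _⟩
  apply_D _ := rfl
  apply_mem _ _ := rfl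
  exact _ _ := ⟨0, zero_mem _⟩

/-- The modules of a complex concentrated in degree zero. -/
def singleFamily (B : Type u) : ℕ → Type u
  | 0 => B
  | _ + 1 => PUnit.{u + 1}

section Single

variable (B : Type u) [acB : AddCommGroup B]

instance : ∀ i, AddCommGroup (singleFamily B i)
  | 0 => acB
  | _ + 1 => inferInstanceAs (AddCommGroup PUnit.{u + 1})

variable [modB : Module S B]

instance : ∀ i, Module S (singleFamily B i)
  | 0 => modB
  | _ + 1 => inferInstanceAs (Module S PUnit.{u + 1})

instance [fB : Module.Free S B] : ∀ i, Module.Free S (singleFamily B i)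
  | 0 => fB
  | _ + 1 => inferInstanceAs (Module.Free S PUnit.{u + 1})

instance [fB : Module.Finite S B] : ∀ i, Module.Finite S (singleFamily B i)
  | 0 => fB
  | _ + 1 => inferInstanceAs (Module.Finite S PUnit.{u + 1})

variable [Module.Free S B] [Module.Finite S B]

theorem exists_resolves_quotient (I : Ideal S) :
    ∃ (C : ModRes S I) (ε : C.G 0 →ₗ[S] B ⧸ idealTop I B), C.Resolves ε ∧
      Module.finrank S (C.G 0) = Module.finrank S B ∧
      ∀ i, Module.finrank S (C.G (i + 1)) = 0 := by
  let C : ModRes S I :=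
    { G := singleFamily B
      D := fun _ => 0
      sq := fun _ _ => zero_mem _
      exact := fun i x _ => ⟨0, by
        have : x = 0 := Subsingleton.elim (α := PUnit.{u + 1}) _ _
        rw [this, map_zero, sub_zero]
        exact zero_mem _⟩
      minimal := fun _ _ => zero_mem _ }
  refine ⟨C, ((idealTop I B).mkQ : B →ₗ[S] B ⧸ idealTop I B), ⟨?_, ?_, ?_, ?_⟩, rfl,
    fun i => ?_⟩
  · exact Submodule.mkQ_surjective _
  · exact fun _ => map_zero _
  · exact fun x hx => (Submodule.Quotient.mk_eq_zero _).2 hx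
  · intro (x : B) hx
    refine ⟨0, ?_⟩
    change x - 0 ∈ idealTop I B
    rw [sub_zero]
    exact (Submodule.Quotient.mk_eq_zero _).1 hx
  · exact Module.finrank_zero_of_subsingleton (R := S) (M := PUnit.{u + 1})

end Single

end ModRes

/-! ### Regular sequences -/

section Regular

variable {S : Type u} [CommRing S]

theorem seqIdeal_eq_ofList (f : ℕ → S) (p : ℕ) :
    seqIdeal f p = Ideal.ofList ((List.range' 1 p).map f) := by
  refine congrArg Ideal.span (Set.ext fun x => ?_)
  simp only [Set.mem_image, Set.mem_Icc, Set.mem_ofPred_eq, List.mem_map, List.mem_range'_1]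
  refine exists_congr fun i => and_congr_left fun _ => ?_
  omega

theorem seqIdeal_zero (f : ℕ → S) : seqIdeal f 0 = ⊥ := by
  rw [seqIdeal_eq_ofList]
  simp

theorem seqIdeal_succ (f : ℕ → S) (p : ℕ) :
    seqIdeal f (p + 1) = seqIdeal f p ⊔ Ideal.span {f (p + 1)} := by
  rw [seqIdeal_eq_ofList, seqIdeal_eq_ofList, List.range'_1_concat, List.map_append,
    Ideal.ofList_append, List.map_singleton, Ideal.ofList_singleton, add_comm 1 p]

theorem mem_seqIdeal_of_mem (f : ℕ → S) {i p : ℕ} (h : 1 ≤ i) (h' : i ≤ p) : f i ∈ seqIdeal f p :=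
  Ideal.subset_span ⟨i, ⟨h, h'⟩, rfl⟩

variable [IsLocalRing S] {f : ℕ → S} {c : ℕ}
  (hreg : RingTheory.Sequence.IsRegular S (seqList f c))

include hreg

theorem seqIdeal_le_maximalIdeal {p : ℕ} (hp : p ≤ c) :
    seqIdeal f p ≤ IsLocalRing.maximalIdeal S := by
  refine IsLocalRing.le_maximalIdeal fun h => ?_
  have := (seqQuot_isLocalRing hreg hp).toNontrivial
  exact (Ideal.Quotient.nontrivial_iff.1 this) h

theorem mem_maximalIdeal_of_isRegular {p : ℕ} (h1 : 1 ≤ p) (hp : p ≤ c) :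
    f p ∈ IsLocalRing.maximalIdeal S :=
  seqIdeal_le_maximalIdeal hreg hp (mem_seqIdeal_of_mem f h1 le_rfl)

/-- Over a Noetherian local ring a regular sequence may be permuted, so the whole sequence can be
reordered to begin with `l` followed by `a`. -/
theorem mem_ofList_of_mul_mem [IsNoetherianRing S] (l : List ℕ) (a : ℕ) (hnd : (l ++ [a]).Nodup)
    (hl : ∀ i ∈ l ++ [a], 1 ≤ i ∧ i ≤ c) (s : S) (hs : f a * s ∈ Ideal.ofList (l.map f)) :
    s ∈ Ideal.ofList (l.map f) := by
  obtain ⟨l', h1, h2⟩ := List.subperm_iff.1 (List.subperm_of_subset hnd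
    (l₂ := List.range' 1 c) fun i hi => by
      have := hl i hi
      rw [List.mem_range'_1]
      omega)
  obtain ⟨r, hr⟩ := h2.exists_perm_append
  have h3 : (seqList f c).Perm (l.map f ++ f a :: r.map f) := by
    have := (h1.symm.trans hr).map f
    simpa [seqList] using this
  have h4 := (IsLocalRing.isRegular_of_perm hreg h3).regular_mod_prev (l.map f).length (by simp)
  rw [List.take_left, List.getElem_append_right le_rfl] at h4
  simp only [Nat.sub_self, List.getElem_cons_zero] at h4
  have h5 : (f a : S) • (Submodule.Quotient.mk s : S ⧸ (Ideal.ofList (l.map f) • ⊤ :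
      Submodule S S)) = f a • 0 := by
    rw [smul_zero, ← Submodule.Quotient.mk_smul, Submodule.Quotient.mk_eq_zero]
    simpa using hs
  have h6 := (Submodule.Quotient.mk_eq_zero _).1 (h4 h5)
  simpa using h6

theorem mem_seqIdeal_of_mul_mem [IsNoetherianRing S] {p q : ℕ} (hqp : q < p) (hp : p ≤ c) (s : S)
    (hs : f p * s ∈ seqIdeal f q) : s ∈ seqIdeal f q := by
  rw [seqIdeal_eq_ofList] at hs ⊢
  refine mem_ofList_of_mul_mem hreg _ p ?_ ?_ s hs
  · rw [List.nodup_append]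
    refine ⟨List.nodup_range', List.nodup_singleton _, ?_⟩
    simp only [List.mem_range'_1, List.mem_singleton]
    omega
  · simp only [List.mem_append, List.mem_range'_1, List.mem_singleton]
    omega

/-- The order f_1, …, f_q, f_p, f_{q+1} is used. This is needed to see that f_p is regular on
M(q+1). -/
theorem mem_seqIdeal_sup_of_mul_mem [IsNoetherianRing S] {p q : ℕ} (hqp : q + 1 < p) (hp : p ≤ c)
    (s : S) (hs : f (q + 1) * s ∈ seqIdeal f q ⊔ Ideal.span {f p}) :
    s ∈ seqIdeal f q ⊔ Ideal.span {f p} := by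
  have h : seqIdeal f q ⊔ Ideal.span {f p} =
      Ideal.ofList ((List.range' 1 q ++ [p]).map f) := by
    rw [seqIdeal_eq_ofList, List.map_append, Ideal.ofList_append, List.map_singleton,
      Ideal.ofList_singleton]
  rw [h] at hs ⊢
  refine mem_ofList_of_mul_mem hreg _ (q + 1) ?_ ?_ s hs
  · simp only [List.nodup_append, List.nodup_singleton, List.mem_range'_1,
      List.mem_singleton, List.mem_append]
    refine ⟨⟨List.nodup_range', trivial, ?_⟩, trivial, ?_⟩ <;> omega
  · simp only [List.mem_append, List.mem_range'_1, List.mem_singleton]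
    omega

end Regular

/-! ### Filtrations by direct summands -/

section Filtration

variable {S : Type u} [CommRing S] {A : Type u} [AddCommGroup A] [Module S A]

theorem exists_isCompl_submoduleOf {P N : Submodule S A}
    (h : ∃ C : Submodule S A, P ⊓ C = ⊥ ∧ P ⊔ C = N) :
    ∃ C : Submodule S N, IsCompl (P.submoduleOf N) C := by
  obtain ⟨C, h1, h2⟩ := h
  have hP : P ≤ N := h2 ▸ le_sup_left
  have hC : C ≤ N := h2 ▸ le_sup_right
  refine ⟨C.submoduleOf N, ?_, ?_⟩
  · rw [disjoint_iff, Submodule.submoduleOf, Submodule.submoduleOf, ← Submodule.comap_inf, h1]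
    simp
  · rw [codisjoint_iff, eq_top_iff]
    rintro ⟨x, hx⟩ -
    rw [← h2] at hx
    obtain ⟨a, ha, b, hb, rfl⟩ := Submodule.mem_sup.1 hx
    exact Submodule.mem_sup.2 ⟨⟨a, hP ha⟩, ha, ⟨b, hC hb⟩, hb, rfl⟩

theorem exists_retraction_of_summand {P N : Submodule S A}
    (h : ∃ C : Submodule S A, P ⊓ C = ⊥ ∧ P ⊔ C = N) :
    ∃ ρ : N →ₗ[S] P, ∀ x : N, ∀ hx : (x : A) ∈ P, ρ x = ⟨x, hx⟩ := by
  obtain ⟨C, hC⟩ := exists_isCompl_submoduleOf h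
  refine ⟨(N.subtype ∘ₗ (P.submoduleOf N).subtype ∘ₗ
    (P.submoduleOf N).projectionOnto C hC).codRestrict P fun x => ?_, fun x hx => ?_⟩
  · exact ((P.submoduleOf N).projectionOnto C hC x).2
  · refine Subtype.ext ?_
    have := Submodule.projectionOnto_apply_left hC ⟨x, hx⟩
    exact congrArg (fun y : P.submoduleOf N => ((y : N) : A)) this

/-- Descending from `F c = ⊤`, the retractions of consecutive steps are composed. -/
theorem exists_retraction_of_filtration {F : ℕ → Submodule S A} {c : ℕ} (hF : Monotone F)
    (htop : F c = ⊤) (h : ∀ p, 1 ≤ p → ∃ C : Submodule S A, F (p - 1) ⊓ C = ⊥ ∧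
      F (p - 1) ⊔ C = F p) {p : ℕ} (hp : p ≤ c) :
    ∃ ρ : A →ₗ[S] F p, ∀ x : F p, ρ x = x := by
  induction hp using Nat.decreasingInduction with
  | self =>
    exact ⟨LinearMap.id.codRestrict _ fun x => by rw [htop]; trivial, fun x => rfl⟩
  | of_succ p _ ih =>
    obtain ⟨ρ, hρ⟩ := ih
    obtain ⟨σ, hσ⟩ := exists_retraction_of_summand (h (p + 1) (by omega))
    refine ⟨σ ∘ₗ ρ, fun x => ?_⟩
    have h1 := hρ ⟨x, hF (Nat.le_succ p) x.2⟩
    rw [LinearMap.comp_apply, h1]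
    exact hσ ⟨x, hF (Nat.le_succ p) x.2⟩ x.2

theorem free_quotient_of_summand [IsLocalRing S] {P N : Submodule S A}
    (h : ∃ C : Submodule S A, P ⊓ C = ⊥ ∧ P ⊔ C = N) [Module.Free S N] [Module.Finite S N] :
    Module.Free S (N ⧸ P.submoduleOf N) := by
  obtain ⟨C, hC⟩ := exists_isCompl_submoduleOf h
  have : Module.Projective S (N ⧸ P.submoduleOf N) := by
    have h1 : Module.Projective S C := Module.Projective.of_split C.subtype
      (C.projectionOnto _ hC.symm) (by ext x; simp)
    exact Module.Projective.of_equiv (Submodule.quotientEquivOfIsCompl _ _ hC).symm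
  exact Module.free_of_flat_of_isLocalRing

theorem exists_equiv_prod_of_summand {P N : Submodule S A}
    (h : ∃ C : Submodule S A, P ⊓ C = ⊥ ∧ P ⊔ C = N) (hPN : P ≤ N) :
    ∃ e : N ≃ₗ[S] P × (N ⧸ P.submoduleOf N),
      (∀ x, (e x).2 = (P.submoduleOf N).mkQ x) ∧ ∀ z, e (Submodule.inclusion hPN z) = (z, 0) := by
  obtain ⟨ρ, hρ⟩ := exists_retraction_of_summand h
  have h1 (z : P) : ρ ⟨z, hPN z.2⟩ = z := hρ ⟨z, hPN z.2⟩ z.2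
  have h2 (z : P) : (P.submoduleOf N).mkQ ⟨z, hPN z.2⟩ = 0 :=
    (Submodule.Quotient.mk_eq_zero _).2 z.2
  refine ⟨LinearEquiv.ofBijective (ρ.prod (P.submoduleOf N).mkQ) ⟨?_, ?_⟩, fun x => rfl,
    fun z => Prod.ext (h1 z) (h2 z)⟩
  · refine (injective_iff_map_eq_zero _).2 fun x hx => ?_
    have h1 : ρ x = 0 := congrArg Prod.fst hx
    have h2 : (P.submoduleOf N).mkQ x = 0 := congrArg Prod.snd hx
    have h3 : (x : A) ∈ P := (Submodule.Quotient.mk_eq_zero (P.submoduleOf N)).1 h2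
    exact Subtype.ext (congrArg (fun z : P => (z : A)) ((hρ x h3).symm.trans h1))
  · rintro ⟨a, b⟩
    obtain ⟨x, rfl⟩ := Submodule.mkQ_surjective _ b
    refine ⟨x - ⟨ρ x, hPN (ρ x).2⟩ + ⟨a, hPN a.2⟩, Prod.ext ?_ ?_⟩
    · change ρ _ = a
      rw [map_add, map_sub, h1, h1, sub_self, zero_add]
    · change (P.submoduleOf N).mkQ _ = _
      rw [map_add, map_sub, h2, h2, sub_zero, add_zero]

theorem exists_sub_mem_of_mkQ_mem {P N : Submodule S A} (hPN : P ≤ N) {I : Ideal S} (y : N)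
    (hy : (P.submoduleOf N).mkQ y ∈ idealTop I (N ⧸ P.submoduleOf N)) :
    ∃ x : P, y - Submodule.inclusion hPN x ∈ idealTop I N := by
  have h1 : idealTop I (N ⧸ P.submoduleOf N) = (idealTop I N).map (P.submoduleOf N).mkQ := by
    rw [idealTop, Submodule.map_smul'', Submodule.map_top, Submodule.range_mkQ]
  rw [h1] at hy
  obtain ⟨z, hz, hzy⟩ := hy
  have h2 : y - z ∈ P.submoduleOf N := by
    rw [← Submodule.ker_mkQ (P.submoduleOf N), LinearMap.mem_ker, map_sub, sub_eq_zero]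
    exact hzy.symm
  refine ⟨⟨_, h2⟩, ?_⟩
  have h3 : y - Submodule.inclusion hPN ⟨_, h2⟩ = z := sub_sub_self y z
  rwa [h3]

end Filtration

/-! ### First properties of higher matrix factorizations -/

namespace HMF

variable {S : Type u} [CommRing S] {f : ℕ → S} {c : ℕ} {A₀ A₁ : Type u}
  [AddCommGroup A₀] [Module S A₀] [AddCommGroup A₁] [Module S A₁] (X : HMF f c A₀ A₁)

theorem exists_retraction₀ {p : ℕ} (hp : p ≤ c) :
    ∃ ρ : A₀ →ₗ[S] X.F₀ p, ∀ x : X.F₀ p, ρ x = x :=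
  exists_retraction_of_filtration X.mono₀ X.top₀ X.summand₀ hp

theorem exists_retraction₁ {p : ℕ} (hp : p ≤ c) :
    ∃ ρ : A₁ →ₗ[S] X.F₁ p, ∀ x : X.F₁ p, ρ x = x :=
  exists_retraction_of_filtration X.mono₁ X.top₁ X.summand₁ hp

theorem finite_F₀ {p : ℕ} (hp : p ≤ c) : Module.Finite S (X.F₀ p) := by
  obtain ⟨ρ, hρ⟩ := X.exists_retraction₀ hp
  have := X.finite₀
  exact Module.Finite.of_surjective ρ fun x => ⟨x, hρ x⟩

theorem finite_F₁ {p : ℕ} (hp : p ≤ c) : Module.Finite S (X.F₁ p) := by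
  obtain ⟨ρ, hρ⟩ := X.exists_retraction₁ hp
  have := X.finite₁
  exact Module.Finite.of_surjective ρ fun x => ⟨x, hρ x⟩

theorem free_B₀ [IsLocalRing S] {p : ℕ} (h1 : 1 ≤ p) (hp : p ≤ c) : Module.Free S (X.B₀ p) := by
  have := X.finite_F₀ hp
  have := X.free_F₀ p
  exact free_quotient_of_summand (X.summand₀ p h1)

theorem free_B₁ [IsLocalRing S] {p : ℕ} (h1 : 1 ≤ p) (hp : p ≤ c) : Module.Free S (X.B₁ p) := by
  have := X.finite_F₁ hp
  have := X.free_F₁ p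
  exact free_quotient_of_summand (X.summand₁ p h1)

theorem exists_equiv_prod₀ (p : ℕ) :
    ∃ e : X.F₀ (p + 1) ≃ₗ[S] X.F₀ p × X.B₀ (p + 1),
      (∀ x, (e x).2 = ((X.F₀ p).submoduleOf (X.F₀ (p + 1))).mkQ x) ∧
      ∀ z, e (Submodule.inclusion (X.mono₀ (Nat.le_succ p)) z) = (z, 0) :=
  exists_equiv_prod_of_summand (X.summand₀ (p + 1) (by omega)) (X.mono₀ (Nat.le_succ p))

theorem exists_equiv_prod₁ (p : ℕ) :
    ∃ e : X.F₁ (p + 1) ≃ₗ[S] X.F₁ p × X.B₁ (p + 1),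
      (∀ x, (e x).2 = ((X.F₁ p).submoduleOf (X.F₁ (p + 1))).mkQ x) ∧
      ∀ z, e (Submodule.inclusion (X.mono₁ (Nat.le_succ p)) z) = (z, 0) :=
  exists_equiv_prod_of_summand (X.summand₁ (p + 1) (by omega)) (X.mono₁ (Nat.le_succ p))

theorem finrank_F₀_succ [IsLocalRing S] {p : ℕ} (hp : p + 1 ≤ c) :
    Module.finrank S (X.F₀ (p + 1)) =
      Module.finrank S (X.F₀ p) + Module.finrank S (X.B₀ (p + 1)) := by
  have := X.finite_F₀ hp
  have := X.free_F₀ (p + 1)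
  have := X.finite_F₀ (p := p) (by omega)
  have := X.free_F₀ p
  have := X.free_B₀ (p := p + 1) (by omega) hp
  obtain ⟨e, -⟩ := X.exists_equiv_prod₀ p
  rw [e.finrank_eq, Module.finrank_prod]

theorem finrank_F₁_succ [IsLocalRing S] {p : ℕ} (hp : p + 1 ≤ c) :
    Module.finrank S (X.F₁ (p + 1)) =
      Module.finrank S (X.F₁ p) + Module.finrank S (X.B₁ (p + 1)) := by
  have := X.finite_F₁ hp
  have := X.free_F₁ (p + 1)
  have := X.finite_F₁ (p := p) (by omega)
  have := X.free_F₁ p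
  have := X.free_B₁ (p := p + 1) (by omega) hp
  obtain ⟨e, -⟩ := X.exists_equiv_prod₁ p
  rw [e.finrank_eq, Module.finrank_prod]

end HMF

/-! ### Enlarging the first two modules of a resolution -/

/-- The family `P₀, P₁, Y 2, Y 3, …`. -/
def boxFamily (P₀ P₁ : Type u) (Y : ℕ → Type u) : ℕ → Type u
  | 0 => P₀
  | 1 => P₁
  | i + 2 => Y (i + 2)

namespace boxFamily

variable {S : Type u} [CommRing S] (P₀ P₁ : Type u) (Y : ℕ → Type u) [a₀ : AddCommGroup P₀]
  [a₁ : AddCommGroup P₁] [aY : ∀ i, AddCommGroup (Y i)]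

instance instAddCommGroup : ∀ i, AddCommGroup (boxFamily P₀ P₁ Y i)
  | 0 => a₀
  | 1 => a₁
  | i + 2 => aY (i + 2)

variable [m₀ : Module S P₀] [m₁ : Module S P₁] [mY : ∀ i, Module S (Y i)]

instance instModule : ∀ i, Module S (boxFamily P₀ P₁ Y i)
  | 0 => m₀
  | 1 => m₁
  | i + 2 => mY (i + 2)

instance instFree [f₀ : Module.Free S P₀] [f₁ : Module.Free S P₁] [fY : ∀ i, Module.Free S (Y i)] :
    ∀ i, Module.Free S (boxFamily P₀ P₁ Y i)
  | 0 => f₀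
  | 1 => f₁
  | i + 2 => fY (i + 2)

instance instFinite [f₀ : Module.Finite S P₀] [f₁ : Module.Finite S P₁]
    [fY : ∀ i, Module.Finite S (Y i)] : ∀ i, Module.Finite S (boxFamily P₀ P₁ Y i)
  | 0 => f₀
  | 1 => f₁
  | i + 2 => fY (i + 2)

end boxFamily

namespace ModRes

variable {S : Type u} [CommRing S] [IsLocalRing S] {I : Ideal S}

local notation "𝔪" => IsLocalRing.maximalIdeal S

variable {P₀ P₁ : Type u} [AddCommGroup P₀] [Module S P₀] [AddCommGroup P₁] [Module S P₁]
  (Y : ModRes S I) (d : P₁ →ₗ[S] P₀) (j₁ : Y.G 1 →ₗ[S] P₁)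

/-- The differentials `d`, `j₁ ∘ Y.D 1`, `Y.D 2`, …. -/
def boxD : ∀ i, boxFamily P₀ P₁ Y.G (i + 1) →ₗ[S] boxFamily P₀ P₁ Y.G i
  | 0 => d
  | 1 => j₁ ∘ₗ Y.D 1
  | i + 2 => Y.D (i + 2)

variable [Module.Free S P₀] [Module.Finite S P₀] [Module.Free S P₁] [Module.Finite S P₁]
  {Y d j₁}
  {j₀ : Y.G 0 →ₗ[S] P₀} {r₀ : P₀ →ₗ[S] Y.G 0} {r₁ : P₁ →ₗ[S] Y.G 1}

/-- The resolution with `P₁ → P₀` in place of `Y.G 1 → Y.G 0`. -/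
def box (hd : ∀ x, d (j₁ x) = j₀ (Y.D 0 x)) (hr₀ : ∀ x, r₀ (j₀ x) = x) (hr₁ : ∀ x, r₁ (j₁ x) = x)
    (hex : ∀ y, d y ∈ idealTop I P₀ → ∃ x, y - j₁ x ∈ idealTop I P₁)
    (hmin : ∀ y, d y ∈ idealTop 𝔪 P₀) : ModRes S I where
  G := boxFamily P₀ P₁ Y.G
  D := Y.boxD d j₁
  sq
    | 0, x => by
      have key (x : Y.G 2) : d (j₁ (Y.D 1 x)) ∈ idealTop I P₀ := by
        rw [hd]
        exact map_mem_idealTop _ (Y.sq 0 x)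
      exact key x
    | 1, x => map_mem_idealTop j₁ (Y.sq 1 x)
    | i + 2, x => Y.sq (i + 2) x
  exact
    | 0, x, h => by
      have key (y : P₁) (h : d y ∈ idealTop I P₀) :
          ∃ z, y - j₁ (Y.D 1 z) ∈ idealTop I P₁ := by
        obtain ⟨x, hx⟩ := hex y h
        have h1 := map_mem_idealTop d hx
        rw [map_sub, hd] at h1
        have h2 := mem_idealTop_of_retract j₀ r₀ hr₀
          ((Submodule.sub_mem_iff_right _ h).1 h1)
        obtain ⟨z, hz⟩ := Y.exact 0 x h2
        refine ⟨z, ?_⟩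
        have h3 := add_mem hx (map_mem_idealTop j₁ hz)
        rw [map_sub] at h3
        simpa using h3
      exact key x h
    | 1, x, h => Y.exact 1 x (mem_idealTop_of_retract j₁ r₁ hr₁ h)
    | i + 2, x, h => Y.exact (i + 2) x h
  minimal
    | 0, x => hmin x
    | 1, x => map_mem_idealTop j₁ (Y.minimal 1 x)
    | i + 2, x => Y.minimal (i + 2) x

/-- The new D² differs from that of `Y` only by the split inclusions `j₀` and `j₁`, which reflect
membership in 𝔪I. -/
theorem isDetecting_box (hd : ∀ x, d (j₁ x) = j₀ (Y.D 0 x)) (hr₀ : ∀ x, r₀ (j₀ x) = x)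
    (hr₁ : ∀ x, r₁ (j₁ x) = x) (hex : ∀ y, d y ∈ idealTop I P₀ → ∃ x, y - j₁ x ∈ idealTop I P₁)
    (hmin : ∀ y, d y ∈ idealTop 𝔪 P₀) (hJ : Y.IsDetecting) :
    (box hd hr₀ hr₁ hex hmin).IsDetecting
  | 0, x => by
    have key (x : Y.G 2) (h : d (j₁ (Y.D 1 x)) ∈ idealTop (𝔪 * I) P₀) : x ∈ idealTop 𝔪 (Y.G 2) := by
      rw [hd] at h
      exact hJ 0 x (mem_idealTop_of_retract j₀ r₀ hr₀ h)
    exact key x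
  | 1, x => fun h => hJ 1 x (mem_idealTop_of_retract j₁ r₁ hr₁ h)
  | i + 2, x => hJ (i + 2) x

/-- The extension of a resolution modulo `I` to one modulo `I + (f)`. -/
theorem exists_extension (hd : ∀ x, d (j₁ x) = j₀ (Y.D 0 x)) (hr₀ : ∀ x, r₀ (j₀ x) = x)
    (hr₁ : ∀ x, r₁ (j₁ x) = x) (hex : ∀ y, d y ∈ idealTop I P₀ → ∃ x, y - j₁ x ∈ idealTop I P₁)
    (hmin : ∀ y, d y ∈ idealTop 𝔪 P₀) (hJ : Y.IsDetecting) {f : S} (h : P₀ →ₗ[S] P₁)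
    (hh : ∀ x, d (h x) - f • x ∈ idealTop I P₀) (hf : ∀ s, f * s ∈ I → s ∈ I)
    (hm : ∀ x, h x ∈ idealTop 𝔪 P₁) (hfm : f ∈ 𝔪) (hI : I ≤ 𝔪) :
    ∃ (Z : ModRes S (I ⊔ Ideal.span {f})) (e₀ : Z.G 0 ≃ₗ[S] P₀) (e₁ : Z.G 1 ≃ₗ[S] P₁),
      Z.IsDetecting ∧ (∀ x, e₀ (Z.D 0 x) = d (e₁ x)) ∧
      ∀ i, Module.finrank S (Z.G (i + 2)) =
        Module.finrank S (Y.G (i + 2)) + Module.finrank S (Z.G i) := by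
  let H := box hd hr₀ hr₁ hex hmin
  have hJH : H.IsDetecting := isDetecting_box hd hr₀ hr₁ hex hmin hJ
  refine ⟨H.shamash f h hh hf hm hJH, LinearEquiv.refl S P₀, LinearEquiv.refl S P₁,
    isDetecting_shamash H f h hh hf hm hJH hfm hI, fun x => rfl, fun i => ?_⟩
  exact Module.finrank_prod (R := S) (M := Y.G (i + 2)) (M' := evenSum H.G i)

end ModRes

/-! ### The minimal resolution of M(p) over R(p) -/

namespace HMF

variable {S : Type u} [CommRing S] {f : ℕ → S} {c : ℕ} {A₀ A₁ : Type u}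
  [AddCommGroup A₀] [Module S A₀] [AddCommGroup A₁] [Module S A₁] (X : HMF f c A₀ A₁)

/-- The ranks of the modules in the resolution over `R(p)` of the cokernel `M(p)`. -/
def resRank : ℕ → ℕ → ℕ
  | 0, _ => 0
  | p + 1, 0 => Module.finrank S (X.F₀ (p + 1))
  | p + 1, 1 => Module.finrank S (X.F₁ (p + 1))
  | p + 1, i + 2 => resRank p (i + 2) + resRank (p + 1) i

variable [IsLocalRing S]

local notation "𝔪" => IsLocalRing.maximalIdeal S

variable {X}

theorem dp_mem_maximalIdeal (hmin : X.IsMinimal) {p : ℕ} (hp : p ≤ c) (y : X.F₁ p) :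
    X.dp p y ∈ idealTop 𝔪 (X.F₀ p) := by
  obtain ⟨ρ, hρ⟩ := X.exists_retraction₀ hp
  exact mem_idealTop_of_retract (X.F₀ p).subtype ρ hρ (hmin.1 ⟨y, rfl⟩)

theorem h_mem_maximalIdeal (hmin : X.IsMinimal) {p : ℕ} (h1 : 1 ≤ p) (hp : p ≤ c) (x : X.F₀ p) :
    X.h p x ∈ idealTop 𝔪 (X.F₁ p) := by
  obtain ⟨ρ, hρ⟩ := X.exists_retraction₁ hp
  exact mem_idealTop_of_retract (X.F₁ p).subtype ρ hρ (hmin.2 p h1 hp ⟨x, rfl⟩)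

variable [IsNoetherianRing S] (hreg : RingTheory.Sequence.IsRegular S (seqList f c))

include hreg

/-- If `d y` vanishes modulo `(f₁, …, f_{p-1})`, then so does the class of `y` in `B₁(p)`. -/
theorem proj₁_mem_of_dp_mem {p : ℕ} (h1 : 1 ≤ p) (hp : p ≤ c) (y : X.F₁ p)
    (hy : X.dp p y ∈ idealTop (seqIdeal f (p - 1)) (X.F₀ p)) :
    X.proj₁ p y ∈ idealTop (seqIdeal f (p - 1)) (X.B₁ p) := by
  have := X.free_B₁ h1 hp
  -- Condition (b) replaces f_p π(y) by π h d(y), which vanishes modulo I_{p-1} by assumption.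
  refine mem_idealTop_of_smul_mem (f := f p)
    (mem_seqIdeal_of_mul_mem hreg (by omega) hp) ?_
  have h2 := map_mem_idealTop (X.proj₁ p ∘ₗ X.h p) hy
  exact (Submodule.sub_mem_iff_right _ h2).1 (X.hd p h1 hp y)

/-- The resolution over `R(p)` of the cokernel `M(p)`. -/
theorem exists_modRes (hmin : X.IsMinimal) (p : ℕ) (hp : p ≤ c) :
    ∃ (Y : ModRes S (seqIdeal f p)) (e₀ : Y.G 0 ≃ₗ[S] X.F₀ p) (e₁ : Y.G 1 ≃ₗ[S] X.F₁ p),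
      Y.IsDetecting ∧ (∀ x, e₀ (Y.D 0 x) = X.dp p (e₁ x)) ∧
      ∀ i, Module.finrank S (Y.G i) = X.resRank p i := by
  induction p with
  | zero =>
    have h0 : Subsingleton (X.F₀ 0) := by rw [X.zero₀]; infer_instance
    have h1 : Subsingleton (X.F₁ 0) := by rw [X.zero₁]; infer_instance
    refine ⟨ModRes.zero _, LinearEquiv.ofSubsingleton PUnit.{u + 1} (X.F₀ 0),
      LinearEquiv.ofSubsingleton PUnit.{u + 1} (X.F₁ 0),
      ModRes.isDetecting_zero, fun x => Subsingleton.elim _ _, fun i => ?_⟩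
    rw [resRank]
    exact Module.finrank_zero_of_subsingleton (R := S) (M := PUnit.{u + 1})
  | succ p ih =>
    obtain ⟨Y, e₀, e₁, hJ, he, hr⟩ := ih (by omega)
    obtain ⟨ρ₀, hρ₀⟩ := X.exists_retraction₀ (p := p) (by omega)
    obtain ⟨ρ₁, hρ₁⟩ := X.exists_retraction₁ (p := p) (by omega)
    have := X.free_F₀ (p + 1)
    have := X.free_F₁ (p + 1)
    have := X.finite_F₀ hp
    have := X.finite_F₁ hp
    let j₀ : Y.G 0 →ₗ[S] X.F₀ (p + 1) :=
      Submodule.inclusion (X.mono₀ (Nat.le_succ p)) ∘ₗ e₀.toLinearMap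
    let j₁ : Y.G 1 →ₗ[S] X.F₁ (p + 1) :=
      Submodule.inclusion (X.mono₁ (Nat.le_succ p)) ∘ₗ e₁.toLinearMap
    let r₀ : X.F₀ (p + 1) →ₗ[S] Y.G 0 :=
      e₀.symm.toLinearMap ∘ₗ ρ₀ ∘ₗ (X.F₀ (p + 1)).subtype
    let r₁ : X.F₁ (p + 1) →ₗ[S] Y.G 1 :=
      e₁.symm.toLinearMap ∘ₗ ρ₁ ∘ₗ (X.F₁ (p + 1)).subtype
    have hr₀ (x) : r₀ (j₀ x) = x :=
      (congrArg e₀.symm (hρ₀ (e₀ x))).trans (e₀.symm_apply_apply x)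
    have hr₁ (x) : r₁ (j₁ x) = x :=
      (congrArg e₁.symm (hρ₁ (e₁ x))).trans (e₁.symm_apply_apply x)
    have hd (x) : X.dp (p + 1) (j₁ x) = j₀ (Y.D 0 x) :=
      (congrArg (Submodule.inclusion (X.mono₀ (Nat.le_succ p))) (he x)).symm
    -- This is exactness at A_1(p+1): modulo I_p, the kernel of d_{p+1} comes from A_1(p), where the
    -- resolution of M(p) takes over.
    have hex (y) (hy : X.dp (p + 1) y ∈ idealTop (seqIdeal f p) (X.F₀ (p + 1))) :
        ∃ x, y - j₁ x ∈ idealTop (seqIdeal f p) (X.F₁ (p + 1)) := by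
      obtain ⟨x, hx⟩ := exists_sub_mem_of_mkQ_mem (X.mono₁ (Nat.le_succ p)) y
        (proj₁_mem_of_dp_mem hreg (p := p + 1) (by omega) hp y hy)
      refine ⟨e₁.symm x, ?_⟩
      change y - Submodule.inclusion (X.mono₁ (Nat.le_succ p)) (e₁ (e₁.symm x)) ∈ _
      rw [LinearEquiv.apply_symm_apply]
      exact hx
    obtain ⟨Z, e₀', e₁', hJ', he', hr'⟩ := ModRes.exists_extension hd hr₀ hr₁ hex
      (dp_mem_maximalIdeal hmin hp) hJ (X.h (p + 1)) (X.dh (p + 1) (by omega) hp)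
      (mem_seqIdeal_of_mul_mem hreg (Nat.lt_succ_self p) hp)
      (h_mem_maximalIdeal hmin (by omega) hp)
      (mem_maximalIdeal_of_isRegular hreg (by omega) hp)
      (seqIdeal_le_maximalIdeal hreg (by omega))
    rw [seqIdeal_succ]
    refine ⟨Z, e₀', e₁', hJ', he', fun i => ?_⟩
    induction i using Nat.twoStepInduction with
    | zero => rw [resRank, e₀'.finrank_eq]
    | one => rw [resRank, e₁'.finrank_eq]
    | more i h1 _ => rw [hr', hr, h1, resRank]

omit [IsLocalRing S] [IsNoetherianRing S] hreg in
variable (X) in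
/-- The presentation of `M(p)` by `A₀(p)`. -/
theorem exists_presentation (p : ℕ) :
    ∃ κ : X.F₀ p →ₗ[S] X.M p, Function.Surjective κ ∧
      ∀ x, κ x = 0 ↔ ∃ y, x - X.dp p y ∈ idealTop (seqIdeal f p) (X.F₀ p) := by
  have := X.free_F₀ p
  have hQ : Function.Surjective (algebraMap S (SeqQuot f p)) := Ideal.Quotient.mk_surjective
  have hI : RingHom.ker (algebraMap S (SeqQuot f p)) = seqIdeal f p := Ideal.mk_ker
  refine ⟨((LinearMap.range ((X.dp p).baseChange (SeqQuot f p))).mkQ.restrictScalars S) ∘ₗ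
      TensorProduct.mk S (SeqQuot f p) (X.F₀ p) 1, fun m => ?_, fun x => ?_⟩
  · obtain ⟨z, rfl⟩ := Submodule.mkQ_surjective _ m
    obtain ⟨a, rfl⟩ := exists_one_tmul_eq hQ z
    exact ⟨a, rfl⟩
  · change (Submodule.Quotient.mk ((1 : SeqQuot f p) ⊗ₜ[S] x) : X.M p) = 0 ↔ _
    rw [Submodule.Quotient.mk_eq_zero, LinearMap.mem_range]
    constructor
    · rintro ⟨y, hy⟩
      obtain ⟨y, rfl⟩ := exists_one_tmul_eq hQ y
      refine ⟨y, ?_⟩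
      rw [← one_tmul_eq_zero_iff (Q := SeqQuot f p) hI, TensorProduct.tmul_sub, ← hy,
        LinearMap.baseChange_tmul, sub_self]
    · rintro ⟨y, hy⟩
      refine ⟨1 ⊗ₜ y, ?_⟩
      rw [← one_tmul_eq_zero_iff (Q := SeqQuot f p) hI, TensorProduct.tmul_sub, sub_eq_zero] at hy
      rw [LinearMap.baseChange_tmul, hy]

/-- The minimal free resolution of the module `M(p)`. -/
theorem exists_resolves_M (hmin : X.IsMinimal) {p : ℕ} (hp : p ≤ c) :
    ∃ (Y : ModRes S (seqIdeal f p)) (ε : Y.G 0 →ₗ[S] X.M p), Y.Resolves ε ∧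
      ∀ i, Module.finrank S (Y.G i) = X.resRank p i := by
  obtain ⟨Y, e₀, e₁, -, he, hr⟩ := exists_modRes hreg hmin p hp
  obtain ⟨κ, hκ, hκ'⟩ := X.exists_presentation p
  refine ⟨Y, κ ∘ₗ e₀.toLinearMap, ⟨hκ.comp e₀.surjective, fun x => ?_, fun x hx => ?_,
    fun x hx => ?_⟩, hr⟩
  · exact (hκ' _).2 ⟨e₁ x, by rw [LinearEquiv.coe_coe, he, sub_self]; exact zero_mem _⟩
  · refine (hκ' _).2 ⟨0, ?_⟩
    rw [map_zero, sub_zero]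
    exact map_mem_idealTop e₀.toLinearMap hx
  · obtain ⟨y, hy⟩ := (hκ' _).1 hx
    refine ⟨e₁.symm y, ?_⟩
    have h1 := map_mem_idealTop e₀.symm.toLinearMap hy
    have h2 : e₀.symm (X.dp p y) = Y.D 0 (e₁.symm y) := by
      rw [LinearEquiv.symm_apply_eq, he, LinearEquiv.apply_symm_apply]
    simpa [h2] using h1

end HMF

/-! ### Finite resolutions -/

open Polynomial in
/-- `N` has a resolution modulo `I` with ranks the coefficients of `P`. -/
def HasResolution {S : Type u} [CommRing S] [IsLocalRing S] (I : Ideal S) (N : Type u)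
    [AddCommGroup N] [Module S N] (P : ℕ[X]) : Prop :=
  ∃ (Y : ModRes S I) (ε : Y.G 0 →ₗ[S] N), Y.Resolves ε ∧ ∀ i, Module.finrank S (Y.G i) = P.coeff i

namespace HasResolution

open Polynomial

variable {S : Type u} [CommRing S] [IsLocalRing S] {I J : Ideal S}

local notation "𝔪" => IsLocalRing.maximalIdeal S

variable {U V N : Type u} [AddCommGroup U] [Module S U] [AddCommGroup V] [Module S V]
  [AddCommGroup N] [Module S N] {P Q : ℕ[X]}

theorem of_subsingleton [Subsingleton N] : HasResolution I N 0 :=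
  ⟨ModRes.zero I, 0, ModRes.zero_resolves, fun i => by
    rw [coeff_zero]
    exact Module.finrank_zero_of_subsingleton (R := S) (M := PUnit.{u + 1})⟩

theorem quotient (B : Type u) [AddCommGroup B] [Module S B] [Module.Free S B] [Module.Finite S B] :
    HasResolution I (B ⧸ idealTop I B) (C (Module.finrank S B)) := by
  obtain ⟨Y, ε, h, h0, h1⟩ := ModRes.exists_resolves_quotient B I
  refine ⟨Y, ε, h, fun i => ?_⟩
  cases i with
  | zero => rw [coeff_C_zero, h0]
  | succ i => rw [coeff_C_succ, h1]

theorem prod (hU : HasResolution I U P) (hV : HasResolution I V Q) :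
    HasResolution I (U × V) (P + Q) := by
  obtain ⟨W, εW, hW, hP⟩ := hU
  obtain ⟨Y, εY, hY, hQ⟩ := hV
  obtain ⟨Z, ε, h, hr⟩ := ModRes.exists_resolves_prod hW hY
  exact ⟨Z, ε, h, fun i => by rw [hr, hP, hQ, coeff_add]⟩

theorem of_exact (hU : HasResolution I U P) (hV : HasResolution I V Q) {φ : U →ₗ[S] V}
    (hφ : Function.Injective φ) (hφm : φ ∈ 𝔪 • (⊤ : Submodule S (U →ₗ[S] V))) {π : V →ₗ[S] N}
    (hπ : Function.Surjective π) (hφπ : Function.Exact φ π) : HasResolution I N (Q + X * P) := by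
  obtain ⟨W, εW, hW, hP⟩ := hU
  obtain ⟨Y, εY, hY, hQ⟩ := hV
  obtain ⟨Z, ε, h, h0, hr⟩ := ModRes.exists_resolves_of_exact hW hY hφ hφm hπ hφπ
  refine ⟨Z, ε, h, fun i => ?_⟩
  cases i with
  | zero => rw [h0, hQ, coeff_add, coeff_X_mul_zero, add_zero]
  | succ i => rw [hr, hP, hQ, coeff_add, coeff_X_mul]

/-- The quotient by a regular sequence, starting from a smaller regular sequence. -/
theorem quotient_seqIdeal [IsNoetherianRing S] {f : ℕ → S} {c : ℕ}
    (hreg : RingTheory.Sequence.IsRegular S (seqList f c)) {j q : ℕ} (hjq : j ≤ q) (hq : q ≤ c)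
    (B : Type u) [AddCommGroup B] [Module S B] [Module.Free S B] [Module.Finite S B] :
    HasResolution (seqIdeal f j) (B ⧸ idealTop (seqIdeal f q) B)
      (C (Module.finrank S B) * (1 + X) ^ (q - j)) := by
  induction q, hjq using Nat.le_induction with
  | base => simpa using quotient (I := seqIdeal f j) B
  | succ q hjq ih =>
    have ih := ih (by omega)
    have hle : idealTop (seqIdeal f q) B ≤ idealTop (seqIdeal f (q + 1)) B :=
      Submodule.smul_mono_left (seqIdeal_mono f (Nat.le_succ q))
    -- Multiplication by f_{q+1} on B/I_qB is injective with entries in 𝔪 and cokernel B/I_{q+1}B;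
    -- the cone contributes a factor 1 + x.
    have h := of_exact ih ih (φ := f (q + 1) • LinearMap.id)
      (π := Submodule.factor hle) ?_ ?_ ?_ ?_
    · rw [Nat.succ_sub hjq, pow_succ, ← mul_assoc]
      convert h using 1
      ring
    · refine (injective_iff_map_eq_zero _).2 fun x hx => ?_
      obtain ⟨x, rfl⟩ := Submodule.mkQ_surjective _ x
      refine (Submodule.Quotient.mk_eq_zero _).2 (mem_idealTop_of_smul_mem
        (mem_seqIdeal_of_mul_mem hreg (Nat.lt_succ_self q) hq) ?_)
      exact (Submodule.Quotient.mk_eq_zero _).1 hx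
    · exact smul_mem_idealTop (mem_maximalIdeal_of_isRegular hreg (by omega) hq) _
    · exact Submodule.factor_surjective hle
    · intro x
      obtain ⟨x, rfl⟩ := Submodule.mkQ_surjective _ x
      have h1 : Submodule.factor hle ((idealTop (seqIdeal f q) B).mkQ x) = 0 ↔
          x ∈ idealTop (seqIdeal f (q + 1)) B := Submodule.Quotient.mk_eq_zero _
      rw [h1, seqIdeal_succ, mem_idealTop_sup_span]
      constructor
      · rintro ⟨z, hz⟩
        exact ⟨(idealTop (seqIdeal f q) B).mkQ z,
          (sub_eq_zero.1 ((Submodule.Quotient.mk_eq_zero _).2 hz)).symm⟩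
      · rintro ⟨z, hz⟩
        obtain ⟨z, rfl⟩ := Submodule.mkQ_surjective _ z
        exact ⟨z, (Submodule.Quotient.mk_eq_zero _).1 (sub_eq_zero.2 hz.symm)⟩

end HasResolution

/-! ### Maps out of quotients -/

section Factor

variable {S : Type u} [CommRing S] {I J : Ideal S}

theorem exists_factor_of_surjective {P N N' : Type u} [AddCommGroup P] [Module S P] [AddCommGroup N]
    [Module S N] [AddCommGroup N'] [Module S N'] {κ : P →ₗ[S] N'} (hκ : Function.Surjective κ)
    (g : P →ₗ[S] N) (h : ∀ x, κ x = 0 → g x = 0) : ∃ g' : N' →ₗ[S] N, ∀ x, g' (κ x) = g x := by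
  refine ⟨(LinearMap.ker κ).liftQ g h ∘ₗ (κ.quotKerEquivOfSurjective hκ).symm.toLinearMap,
    fun x => ?_⟩
  have : (κ.quotKerEquivOfSurjective hκ).symm (κ x) = Submodule.Quotient.mk x := by
    rw [LinearEquiv.symm_apply_eq]
    rfl
  rw [LinearMap.comp_apply, LinearEquiv.coe_coe, this]
  rfl

/-- The map is the sum of L_i(φ(b_i)), where L_i(v) sends the i-th basis vector to v and the others
to 0. It descends to B/IB because I kills V, and L_i is linear in v, so J passes from the values to
the map. -/
theorem mem_smul_top_hom {B V : Type u} [AddCommGroup B] [Module S B] [Module.Free S B]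
    [Module.Finite S B] [AddCommGroup V] [Module S V] (hV : ∀ r ∈ I, ∀ v : V, r • v = 0)
    (φ : (B ⧸ idealTop I B) →ₗ[S] V) (hφ : ∀ x, φ x ∈ idealTop J V) :
    φ ∈ J • (⊤ : Submodule S ((B ⧸ idealTop I B) →ₗ[S] V)) := by
  let b := Module.Free.chooseBasis S B
  have hv (i) (v : V) : idealTop I B ≤ LinearMap.ker (LinearMap.toSpanSingleton S V v ∘ₗ b.coord i) := by
    intro x hx
    exact hV _ ((mem_idealTop_iff_repr b).1 hx i) v
  let L (i) : V →ₗ[S] ((B ⧸ idealTop I B) →ₗ[S] V) :=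
    { toFun := fun v => (idealTop I B).liftQ _ (hv i v)
      map_add' := fun v w => by
        refine Submodule.linearMap_qext _ (LinearMap.ext fun x => ?_)
        simp
      map_smul' := fun r v => by
        refine Submodule.linearMap_qext _ (LinearMap.ext fun x => ?_)
        exact smul_comm (b.coord i x) r v }
  have h : φ = ∑ i, L i (φ (Submodule.Quotient.mk (b i))) := by
    refine Submodule.linearMap_qext _ (b.ext fun k => ?_)
    have hL (i v x) : L i v (Submodule.Quotient.mk x) = b.repr x i • v := rfl
    change φ (Submodule.Quotient.mk (b k)) = (∑ i, L i (φ (Submodule.Quotient.mk (b i))))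
      (Submodule.Quotient.mk (b k))
    rw [LinearMap.sum_apply, Finset.sum_eq_single k]
    · rw [hL, b.repr_self, Finsupp.single_eq_same, one_smul]
    · intro i _ hi
      rw [hL, b.repr_self, Finsupp.single_eq_of_ne hi, zero_smul]
    · simp
  rw [h]
  exact Submodule.sum_mem _ fun i _ => map_mem_idealTop (L i) (hφ _)

end Factor

namespace HasResolution

open Polynomial

variable {S : Type u} [CommRing S] [IsLocalRing S] {I J : Ideal S}

local notation "𝔪" => IsLocalRing.maximalIdeal S

variable {P₀ P₁ B₀ B₁ N N' : Type u} [AddCommGroup P₀] [Module S P₀] [AddCommGroup P₁] [Module S P₁]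
  [AddCommGroup B₀] [Module S B₀] [AddCommGroup B₁] [Module S B₁] [Module.Free S B₁]
  [Module.Finite S B₁] [AddCommGroup N] [Module S N] [AddCommGroup N'] [Module S N'] {P Q₀ Q₁ : ℕ[X]}

/-- The resolution of the cokernel modulo `I` of the map `P₁ × B₁ → P₀ × B₀` of block form
`(d, ψ; 0, b)`. -/
theorem of_block (d : P₁ →ₗ[S] P₀) (ψ : B₁ →ₗ[S] P₀) (b : B₁ →ₗ[S] B₀)
    {κ' : P₀ →ₗ[S] N'} (hκ' : Function.Surjective κ')
    (hker' : ∀ x, κ' x = 0 ↔ ∃ z, x - d z ∈ idealTop I P₀)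
    {κ : P₀ × B₀ →ₗ[S] N} (hκ : Function.Surjective κ)
    (hker : ∀ x, κ x = 0 ↔ ∃ z y, x - (d z + ψ y, b y) ∈ idealTop I (P₀ × B₀))
    (hinj : ∀ z y, (d z + ψ y, b y) ∈ idealTop I (P₀ × B₀) → y ∈ idealTop I B₁)
    (hψ : ∀ y, ψ y ∈ idealTop 𝔪 P₀) (hb : ∀ y, b y ∈ idealTop 𝔪 B₀)
    (hN' : HasResolution J N' P) (hB₀ : HasResolution J (B₀ ⧸ idealTop I B₀) Q₀)
    (hB₁ : HasResolution J (B₁ ⧸ idealTop I B₁) Q₁) : HasResolution J N (P + Q₀ + X * Q₁) := by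
  have hκ'I (x) (hx : x ∈ idealTop I P₀) : κ' x = 0 :=
    (hker' x).2 ⟨0, by rwa [map_zero, sub_zero]⟩
  have hκI (x) (hx : x ∈ idealTop I (P₀ × B₀)) : κ x = 0 :=
    (hker x).2 ⟨0, 0, by
      simpa only [map_zero, add_zero, Prod.mk_zero_zero, sub_zero] using hx⟩
  obtain ⟨π₁, hπ₁⟩ := exists_factor_of_surjective hκ' (κ ∘ₗ LinearMap.inl S P₀ B₀) fun x hx => by
    obtain ⟨z, hz⟩ := (hker' x).1 hx
    exact (hker _).2 ⟨z, 0, mem_idealTop_prod.2 (by simpa using hz)⟩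
  obtain ⟨π₂, hπ₂⟩ := exists_factor_of_surjective (Submodule.mkQ_surjective (idealTop I B₀))
    (κ ∘ₗ LinearMap.inr S P₀ B₀) fun x hx =>
      hκI _ (map_mem_idealTop _ ((Submodule.Quotient.mk_eq_zero _).1 hx))
  let π : N' × (B₀ ⧸ idealTop I B₀) →ₗ[S] N := π₁.coprod π₂
  have hπ (a b) : π (κ' a, (idealTop I B₀).mkQ b) = κ (a, b) := by
    change π₁ (κ' a) + π₂ ((idealTop I B₀).mkQ b) = _
    rw [hπ₁, hπ₂, LinearMap.comp_apply, LinearMap.comp_apply, ← map_add]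
    simp
  let φ : (B₁ ⧸ idealTop I B₁) →ₗ[S] N' × (B₀ ⧸ idealTop I B₀) :=
    (idealTop I B₁).liftQ ((κ' ∘ₗ ψ).prod ((idealTop I B₀).mkQ ∘ₗ b)) fun y hy =>
      Prod.ext (hκ'I _ (map_mem_idealTop ψ hy))
        ((Submodule.Quotient.mk_eq_zero _).2 (map_mem_idealTop b hy))
  have hφ (y) : φ ((idealTop I B₁).mkQ y) = (κ' (ψ y), (idealTop I B₀).mkQ (b y)) := rfl
  refine of_exact hB₁ (hN'.prod hB₀) (φ := φ) (π := π) ?_ (mem_smul_top_hom ?_ φ ?_) ?_ ?_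
  · refine (injective_iff_map_eq_zero _).2 fun y hy => ?_
    obtain ⟨y, rfl⟩ := Submodule.mkQ_surjective _ y
    rw [hφ, Prod.mk_eq_zero, hker', Submodule.mkQ_apply, Submodule.Quotient.mk_eq_zero] at hy
    obtain ⟨⟨z, hz⟩, hy⟩ := hy
    refine (Submodule.Quotient.mk_eq_zero _).2 (hinj (-z) y (mem_idealTop_prod.2 ⟨?_, hy⟩))
    rw [map_neg, neg_add_eq_sub]
    exact hz
  · rintro r hr ⟨x, y⟩
    obtain ⟨x, rfl⟩ := hκ' x
    obtain ⟨y, rfl⟩ := Submodule.mkQ_surjective _ y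
    refine Prod.ext ?_ ?_
    · change r • κ' x = 0
      rw [← map_smul]
      exact hκ'I _ (smul_mem_idealTop hr x)
    · exact (Submodule.Quotient.mk_eq_zero (idealTop I B₀)).2 (smul_mem_idealTop hr y)
  · intro y
    obtain ⟨y, rfl⟩ := Submodule.mkQ_surjective _ y
    exact mem_idealTop_prod.2 ⟨map_mem_idealTop κ' (hψ y),
      map_mem_idealTop (idealTop I B₀).mkQ (hb y)⟩
  · intro n
    obtain ⟨⟨a, b⟩, rfl⟩ := hκ n
    exact ⟨_, hπ a b⟩
  · rintro ⟨a, b'⟩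
    obtain ⟨a, rfl⟩ := hκ' a
    obtain ⟨b', rfl⟩ := Submodule.mkQ_surjective _ b'
    rw [hπ, hker]
    constructor
    · rintro ⟨z, y, h⟩
      obtain ⟨h1, h2⟩ := mem_idealTop_prod.1 h
      refine ⟨(idealTop I B₁).mkQ y, ?_⟩
      rw [hφ]
      refine Prod.ext (sub_eq_zero.1 ?_) (sub_eq_zero.1 ?_).symm
      · change κ' (ψ y) - κ' a = 0
        rw [← map_sub, hker']
        refine ⟨-z, ?_⟩
        have h3 := neg_mem h1
        convert h3 using 1
        simp only [Prod.fst_sub, map_neg]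
        abel
      · exact (Submodule.Quotient.mk_eq_zero (idealTop I B₀)).2 h2
    · rintro ⟨y, hy⟩
      obtain ⟨y, rfl⟩ := Submodule.mkQ_surjective _ y
      rw [hφ, Prod.mk.injEq] at hy
      have h1 : κ' (a - ψ y) = 0 := by rw [map_sub, hy.1, sub_self]
      obtain ⟨z, hz⟩ := (hker' _).1 h1
      refine ⟨z, y, mem_idealTop_prod.2 ⟨?_, ?_⟩⟩
      · convert hz using 1
        simp only [Prod.fst_sub]
        abel
      · exact (Submodule.Quotient.mk_eq_zero (idealTop I B₀)).1 (sub_eq_zero.2 hy.2.symm)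

end HasResolution

/-! ### The finite resolution of M over R(j) for j < γ -/

namespace HMF

open Polynomial

variable {S : Type u} [CommRing S] [IsNoetherianRing S] [IsLocalRing S] {f : ℕ → S} {c : ℕ}
  {A₀ A₁ : Type u} [AddCommGroup A₀] [Module S A₀] [AddCommGroup A₁] [Module S A₁]
  {X : HMF f c A₀ A₁}

local notation "𝔪" => IsLocalRing.maximalIdeal S

/-- Splitting A_s(p+1) as A_s(p) ⊕ B_s(p+1) makes d_{p+1} block triangular, and M(p+1) becomes the
cokernel of a map R(p) ⊗ B_1(p+1) → M(p) ⊕ (R(p) ⊗ B_0(p+1)). Condition (b) makes it injective, and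
minimality puts its entries in 𝔪. -/
theorem hasResolution_M_succ (hreg : RingTheory.Sequence.IsRegular S (seqList f c))
    (hmin : X.IsMinimal) {j p : ℕ} (hj : j ≤ p) (hp : p + 1 ≤ c) {P : ℕ[X]}
    (hM : HasResolution (seqIdeal f j) (X.M p) P) :
    HasResolution (seqIdeal f j) (X.M (p + 1))
      (P + C (Module.finrank S (X.B₀ (p + 1))) * (1 + Polynomial.X) ^ (p - j) +
        Polynomial.X * (C (Module.finrank S (X.B₁ (p + 1))) * (1 + Polynomial.X) ^ (p - j))) := by
  obtain ⟨e₀, he₀, he₀'⟩ := X.exists_equiv_prod₀ p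
  obtain ⟨e₁, he₁, he₁'⟩ := X.exists_equiv_prod₁ p
  obtain ⟨κ', hκ', hker'⟩ := X.exists_presentation p
  obtain ⟨κ, hκ, hker⟩ := X.exists_presentation (p + 1)
  have := X.free_B₀ (p := p + 1) (by omega) hp
  have := X.free_B₁ (p := p + 1) (by omega) hp
  have := X.finite_F₀ hp
  have := X.finite_F₁ hp
  let D : X.F₁ p × X.B₁ (p + 1) →ₗ[S] X.F₀ p × X.B₀ (p + 1) :=
    e₀.toLinearMap ∘ₗ X.dp (p + 1) ∘ₗ e₁.symm.toLinearMap
  have hD (w) : D (e₁ w) = e₀ (X.dp (p + 1) w) := by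
    simp [D]
  have hD1 (z) : D (z, 0) = (X.dp p z, 0) := by
    rw [← he₁', hD, ← he₀']
    rfl
  let ψ : X.B₁ (p + 1) →ₗ[S] X.F₀ p :=
    LinearMap.fst S _ _ ∘ₗ D ∘ₗ LinearMap.inr S _ _
  let b : X.B₁ (p + 1) →ₗ[S] X.B₀ (p + 1) :=
    LinearMap.snd S _ _ ∘ₗ D ∘ₗ LinearMap.inr S _ _
  have hD2 (z y) : D (z, y) = (X.dp p z + ψ y, b y) := by
    have h : ((z, y) : X.F₁ p × X.B₁ (p + 1)) = (z, 0) + (0, y) := by simp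
    rw [h, map_add, hD1]
    exact Prod.ext rfl (zero_add _)
  have hDm (y) : D y ∈ idealTop 𝔪 (X.F₀ p × X.B₀ (p + 1)) :=
    map_mem_idealTop e₀.toLinearMap (dp_mem_maximalIdeal hmin hp _)
  refine HasResolution.of_block (I := seqIdeal f p) (X.dp p) ψ b hκ' hker'
    (κ := κ ∘ₗ e₀.symm.toLinearMap) (hκ.comp e₀.symm.surjective) (fun x => ?_) (fun z y h => ?_)
    (fun y => (mem_idealTop_prod.1 (hDm (0, y))).1) (fun y => (mem_idealTop_prod.1 (hDm (0, y))).2)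
    hM (HasResolution.quotient_seqIdeal hreg hj (by omega) _)
    (HasResolution.quotient_seqIdeal hreg hj (by omega) _)
  · rw [LinearMap.comp_apply, LinearEquiv.coe_coe, hker]
    have hsub (w) : x - D (e₁ w) = e₀ (e₀.symm x - X.dp (p + 1) w) := by
      rw [map_sub, LinearEquiv.apply_symm_apply, hD]
    constructor
    · rintro ⟨w, hw⟩
      rw [seqIdeal_succ, mem_idealTop_sup_span] at hw
      obtain ⟨u, hu⟩ := hw
      -- The multiple f_{p+1}u is d h u modulo I_p, so the relations of M(p+1) already hold modulo
      -- I_p after changing w to w + h u.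
      have h1 := sub_mem hu (X.dh (p + 1) (by omega) hp u)
      refine ⟨(e₁ (w + X.h (p + 1) u)).1, (e₁ (w + X.h (p + 1) u)).2, ?_⟩
      rw [← hD2, hsub]
      refine map_mem_idealTop e₀.toLinearMap ?_
      convert h1 using 1
      change _ = _ - (X.dp (p + 1) (X.h (p + 1) u) - _)
      rw [map_add]
      abel
    · rintro ⟨z, y, h⟩
      refine ⟨e₁.symm (z, y), idealTop_mono (seqIdeal_mono f (Nat.le_succ p)) ?_⟩
      rw [← hD2, ← e₁.apply_symm_apply (z, y), hsub] at h
      simpa using map_mem_idealTop e₀.symm.toLinearMap h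
  · rw [← hD2, ← e₁.apply_symm_apply (z, y), hD] at h
    have h1 := map_mem_idealTop e₀.symm.toLinearMap h
    rw [LinearEquiv.coe_coe, LinearEquiv.symm_apply_apply] at h1
    have h2 := proj₁_mem_of_dp_mem hreg (p := p + 1) (by omega) hp _ h1
    have h3 := he₁ (e₁.symm (z, y))
    rw [LinearEquiv.apply_symm_apply] at h3
    change y = _ at h3
    rw [h3]
    exact h2

/-- The ranks of the resolution of `M` over `R(j)`, for `j < γ`. -/
theorem hasResolution_M (hreg : RingTheory.Sequence.IsRegular S (seqList f c))
    (hmin : X.IsMinimal) {γ : ℕ} (hγ : X.IsTopIndex γ) {j p : ℕ} (hj : j < γ) (hγp : γ - 1 ≤ p)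
    (hp : p ≤ c) :
    HasResolution (seqIdeal f j) (X.M p) (∑ q ∈ Finset.Ico (γ - 1) p, (1 + Polynomial.X) ^ (q - j) *
      (C (Module.finrank S (X.B₀ (q + 1))) +
        C (Module.finrank S (X.B₁ (q + 1))) * Polynomial.X)) := by
  induction p, hγp using Nat.le_induction with
  | base =>
    obtain ⟨κ, hκ, -⟩ := X.exists_presentation (γ - 1)
    have : Subsingleton (X.F₀ (γ - 1)) := by
      rw [hγ.bot₀]
      infer_instance
    have := hκ.subsingleton
    rw [Finset.Ico_self, Finset.sum_empty]
    exact HasResolution.of_subsingleton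
  | succ p hγp ih =>
    rw [Finset.sum_Ico_succ_top hγp]
    convert hasResolution_M_succ hreg hmin (by omega) hp (ih (by omega)) using 1
    ring

/-- Finiteness of the projective dimension of `M` and the comparison of Poincaré series. -/
theorem projectiveDimension_lt_top_and_poincareSeries
    (hreg : RingTheory.Sequence.IsRegular S (seqList f c)) (hmin : X.IsMinimal) {γ : ℕ}
    (hγ : X.IsTopIndex γ) {p : ℕ} (hp : p < γ) (hpc : p ≤ c) [IsLocalRing (SeqQuot f p)] :
    projectiveDimension ((ModuleCat.restrictScalars (seqQuotMap f hpc)).obj X.hmfModule) < ⊤ ∧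
    poincareSeries S
        ((ModuleCat.restrictScalars (Ideal.Quotient.mk (seqIdeal f c))).obj X.hmfModule) =
      (1 + PowerSeries.X) ^ p * poincareSeries (SeqQuot f p)
        ((ModuleCat.restrictScalars (seqQuotMap f hpc)).obj X.hmfModule) := by
  have hγc : γ - 1 ≤ c := by have := hγ.1.1.2; omega
  obtain ⟨Y, ε, hY, hr⟩ := hasResolution_M hreg hmin hγ hp hγc le_rfl
  obtain ⟨Z, ε', hZ, hr'⟩ := hasResolution_M hreg hmin hγ (j := 0) (by omega) hγc le_rfl
  have hQ := hY.homological (Ideal.Quotient.mk (seqIdeal f p)) Ideal.Quotient.mk_surjective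
    Ideal.mk_ker ((ModuleCat.restrictScalars (seqQuotMap f hpc)).obj X.hmfModule)
    (AddEquiv.refl (X.M c)) (fun s x => rfl)
  -- Since I_0 = 0 is the kernel of the identity, the resolution modulo I_0 is one over S itself
  -- rather than over S/(0).
  have hS := hZ.homological (RingHom.id S) Function.surjective_id
    (by rw [seqIdeal_zero]; exact RingHom.ker_coe_equiv (RingEquiv.refl S))
    ((ModuleCat.restrictScalars (Ideal.Quotient.mk (seqIdeal f c))).obj X.hmfModule)
    (AddEquiv.refl (X.M c)) (fun s x => rfl)
  refine ⟨hQ.2.2 ?_, ?_⟩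
  -- The omitted index is one more than the degree of the polynomial of ranks.
  · refine ⟨_, (Module.finrank_eq_zero_iff_of_free S _).1 ((hr _).trans
      (coeff_eq_zero_of_natDegree_lt (Nat.lt_succ_self _)))⟩
  · have h (P : ℕ[X]) : PowerSeries.mk P.coeff = (P : PowerSeries ℕ) := rfl
    have h1 : poincareSeries S
        ((ModuleCat.restrictScalars (Ideal.Quotient.mk (seqIdeal f c))).obj X.hmfModule) = _ :=
      congrArg PowerSeries.mk (funext fun i => (hS.1 i).trans (hr' i))
    have h2 : poincareSeries (SeqQuot f p)
        ((ModuleCat.restrictScalars (seqQuotMap f hpc)).obj X.hmfModule) = _ :=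
      congrArg PowerSeries.mk (funext fun i => (hQ.1 i).trans (hr i))
    rw [h1, h2, h, h]
    have h3 : (1 + PowerSeries.X : PowerSeries ℕ) ^ p =
        (((1 + Polynomial.X) ^ p : ℕ[X]) : PowerSeries ℕ) := by simp
    rw [h3, ← Polynomial.coe_mul, Finset.mul_sum]
    congr 1
    refine Finset.sum_congr rfl fun q hq => ?_
    have := Finset.mem_Ico.1 hq
    rw [← mul_assoc, ← pow_add]
    congr 2
    omega

end HMF

/-! ### Ranks -/

section Injective

variable {Q : Type*} [CommRing Q] [Nontrivial Q] {M N : Type*} [AddCommGroup M] [Module Q M]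
  [AddCommGroup N] [Module Q N] [Module.Free Q M] [Module.Finite Q M] [Module.Free Q N]
  [Module.Finite Q N] {b : M →ₗ[Q] N} {g : N →ₗ[Q] M} {r : Q}

omit [Nontrivial Q] [Module.Finite Q M] [Module.Finite Q N] [Module.Free Q M] in
theorem injective_of_comp_eq_smul (hr : r ∈ nonZeroDivisors Q) (h : b ∘ₗ g = r • LinearMap.id) :
    Function.Injective g := by
  refine (injective_iff_map_eq_zero _).2 fun x hx => ?_
  have h1 : r • x = 0 := by
    have := LinearMap.congr_fun h x
    rw [LinearMap.comp_apply, hx, map_zero] at this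
    exact this.symm
  let e := Module.Free.chooseBasis Q N
  refine e.ext_elem fun i => ?_
  have h2 : r * e.repr x i = 0 := by
    rw [← smul_eq_mul, ← Finsupp.smul_apply, ← map_smul, h1, map_zero, Finsupp.zero_apply]
  rw [map_zero, Finsupp.zero_apply]
  exact (mul_left_mem_nonZeroDivisors_eq_zero_iff hr).1 h2

omit [Module.Free Q M] [Module.Finite Q N] in
theorem finrank_le_of_comp_eq_smul (hr : r ∈ nonZeroDivisors Q) (h : b ∘ₗ g = r • LinearMap.id) :
    Module.finrank Q N ≤ Module.finrank Q M :=
  LinearMap.finrank_le_finrank_of_injective (injective_of_comp_eq_smul hr h)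

/-- With square matrices, det b · det g is a power of r, so det b is a nonzerodivisor. -/
theorem injective_of_comp_eq_smul_of_finrank_eq (hr : r ∈ nonZeroDivisors Q)
    (h : b ∘ₗ g = r • LinearMap.id) (hMN : Module.finrank Q M = Module.finrank Q N) :
    Function.Injective b := by
  let e : Module.Basis (Fin (Module.finrank Q N)) Q N := Module.finBasis Q N
  let e' : Module.Basis (Fin (Module.finrank Q N)) Q M := (Module.finBasis Q M).reindex (finCongr hMN)
  have h1 : LinearMap.toMatrix e' e b * LinearMap.toMatrix e e' g = r • 1 := by
    rw [← LinearMap.toMatrix_comp, h, map_smul, LinearMap.toMatrix_id]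
  have h2 := congrArg Matrix.det h1
  rw [Matrix.det_mul, Matrix.det_smul, Matrix.det_one, mul_one] at h2
  have h3 : (LinearMap.toMatrix e' e b).det ∈ nonZeroDivisors Q :=
    (mul_mem_nonZeroDivisors.1 (h2 ▸ pow_mem hr _)).1
  refine (injective_iff_map_eq_zero _).2 fun x hx => ?_
  have h4 := LinearMap.toMatrix_mulVec_repr e' e b x
  rw [hx, map_zero, Finsupp.coe_zero] at h4
  have h5 := Matrix.mulVec_injective_of_det_mem_nonZeroDivisors h3
    (h4.trans (Matrix.mulVec_zero _).symm)
  exact e'.repr.map_eq_zero_iff.1 (DFunLike.coe_injective h5)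

end Injective

section Nakayama

variable {S : Type u} [CommRing S] [IsLocalRing S] {G : Type u} [AddCommGroup G] [Module S G]

theorem subsingleton_of_forall_mem_maximalIdeal [Module.Finite S G]
    (h : ∀ x : G, x ∈ idealTop (IsLocalRing.maximalIdeal S) G) : Subsingleton G := by
  have := Submodule.eq_bot_of_le_smul_of_le_jacobson_bot (IsLocalRing.maximalIdeal S)
    (⊤ : Submodule S G) Module.Finite.fg_top (fun x _ => h x)
    (IsLocalRing.maximalIdeal_le_jacobson ⊥)
  exact (Submodule.subsingleton_iff S).1 (subsingleton_of_bot_eq_top this.symm)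

end Nakayama

namespace HMF

variable {S : Type u} [CommRing S] [IsNoetherianRing S] [IsLocalRing S] {f : ℕ → S} {c : ℕ}
  {A₀ A₁ : Type u} [AddCommGroup A₀] [Module S A₀] [AddCommGroup A₁] [Module S A₁]
  {X : HMF f c A₀ A₁} (hreg : RingTheory.Sequence.IsRegular S (seqList f c))

local notation "𝔪" => IsLocalRing.maximalIdeal S

omit [IsNoetherianRing S] in
theorem finrank_B_of_lt {γ : ℕ} (hγ : X.IsTopIndex γ) {p : ℕ} (hp : p < γ) :
    Module.finrank S (X.B₁ p) = 0 ∧ Module.finrank S (X.B₀ p) = 0 := by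
  have h0 : X.F₀ p = ⊥ := le_bot_iff.1 ((X.mono₀ (by omega)).trans hγ.bot₀.le)
  have h1 : X.F₁ p = ⊥ := le_bot_iff.1 ((X.mono₁ (by omega)).trans hγ.bot₁.le)
  have : Subsingleton (X.F₀ p) := by rw [h0]; infer_instance
  have : Subsingleton (X.F₁ p) := by rw [h1]; infer_instance
  have : Subsingleton (X.B₀ p) := (Submodule.mkQ_surjective _).subsingleton
  have : Subsingleton (X.B₁ p) := (Submodule.mkQ_surjective _).subsingleton
  exact ⟨Module.finrank_zero_of_subsingleton, Module.finrank_zero_of_subsingleton⟩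

include hreg

theorem mk_mem_nonZeroDivisors {p q : ℕ} (hqp : q < p) (hp : p ≤ c) :
    Ideal.Quotient.mk (seqIdeal f q) (f p) ∈ nonZeroDivisors (SeqQuot f q) := by
  refine mem_nonZeroDivisors_iff_right.2 fun s hs => ?_
  obtain ⟨s, rfl⟩ := Ideal.Quotient.mk_surjective s
  rw [← map_mul, Ideal.Quotient.eq_zero_iff_mem, mul_comm] at hs
  exact Ideal.Quotient.eq_zero_iff_mem.2 (mem_seqIdeal_of_mul_mem hreg hqp hp s hs)

/-- The size of the top non-zero part. -/
theorem finrank_B_top {γ : ℕ} (hγ : X.IsTopIndex γ) :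
    (Module.finrank S (X.B₁ γ) = Module.finrank S (X.B₀ γ) ∧ 0 < Module.finrank S (X.B₀ γ)) ∧
      (X.topPart hγ).size = Module.finrank S (X.B₀ γ) := by
  have h1 : 1 ≤ γ := hγ.1.1.1
  have h2 : γ ≤ c := hγ.1.1.2
  have := X.free_B₀ h1 h2
  have := X.free_B₁ h1 h2
  have := X.finite_F₀ h2
  have := X.finite_F₁ h2
  have := (seqQuot_isLocalRing hreg (p := γ - 1) (by omega)).toNontrivial
  have hr := mk_mem_nonZeroDivisors hreg (p := γ) (q := γ - 1) (by omega) h2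
  -- Both composites are a nonzerodivisor, so each of the two maps is injective and the ranks bound
  -- each other.
  have h3 := finrank_le_of_comp_eq_smul hr (X.topPart hγ).dh
  have h4 := finrank_le_of_comp_eq_smul hr (X.topPart hγ).hd
  rw [Module.finrank_baseChange, Module.finrank_baseChange] at h3 h4
  have heq : Module.finrank S (X.B₁ γ) = Module.finrank S (X.B₀ γ) := le_antisymm h4 h3
  refine ⟨⟨heq, Nat.pos_of_ne_zero fun h0 => ?_⟩, Module.finrank_baseChange⟩
  have h5 : Subsingleton (X.B₀ γ) := (Module.finrank_eq_zero_iff_of_free S _).1 h0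
  have h6 : Subsingleton (X.B₁ γ) := (Module.finrank_eq_zero_iff_of_free S _).1 (heq.trans h0)
  rcases hγ.1.2 with h | h
  · refine h (le_bot_iff.1 fun x hx => ?_)
    rw [← hγ.bot₀]
    exact (Submodule.Quotient.mk_eq_zero ((X.F₀ (γ - 1)).submoduleOf (X.F₀ γ))).1
      (Subsingleton.elim (Submodule.Quotient.mk ⟨x, hx⟩) 0)
  · refine h (le_bot_iff.1 fun x hx => ?_)
    rw [← hγ.bot₁]
    exact (Submodule.Quotient.mk_eq_zero ((X.F₁ (γ - 1)).submoduleOf (X.F₁ γ))).1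
      (Subsingleton.elim (Submodule.Quotient.mk ⟨x, hx⟩) 0)

/-- `f_p` is a non-zerodivisor on `M(q)` for `q < p`. -/
theorem exists_sub_mem_of_smul_sub_mem {p q : ℕ} (hqp : q < p) (hp : p ≤ c) (x : X.F₀ q)
    (z : X.F₁ q) (h : f p • x - X.dp q z ∈ idealTop (seqIdeal f q) (X.F₀ q)) :
    ∃ w, x - X.dp q w ∈ idealTop (seqIdeal f q) (X.F₀ q) := by
  induction q with
  | zero =>
    have : Subsingleton (X.F₀ 0) := by rw [X.zero₀]; infer_instance
    exact ⟨0, by rw [Subsingleton.elim (x - X.dp 0 0) 0]; exact zero_mem _⟩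
  | succ q ih =>
    have hq : q + 1 ≤ c := by omega
    have := X.free_B₀ (p := q + 1) (by omega) hq
    have := X.free_B₁ (p := q + 1) (by omega) hq
    obtain ⟨ρ, hρ⟩ := X.exists_retraction₀ (p := q) (by omega)
    rw [seqIdeal_succ, mem_idealTop_sup_span] at h
    obtain ⟨u, hu⟩ := h
    -- The multiple f_{q+1}u is absorbed into d(h u), so the relation holds modulo I_q.
    obtain ⟨z, hz⟩ : ∃ z, f p • x - X.dp (q + 1) z ∈ idealTop (seqIdeal f q) (X.F₀ (q + 1)) := by
      refine ⟨z + X.h (q + 1) u, ?_⟩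
      have h1 := sub_mem hu (X.dh (q + 1) (by omega) hq u)
      convert h1 using 1
      change _ = _ - (X.dp (q + 1) (X.h (q + 1) u) - _)
      rw [map_add]
      abel
    have h1 : X.dp (q + 1) z ∈ idealTop (seqIdeal f q ⊔ Ideal.span {f p}) (X.F₀ (q + 1)) := by
      refine mem_idealTop_sup_span.2 ⟨x, ?_⟩
      rw [← neg_mem_iff, neg_sub]
      exact hz
    -- Here f_{q+1}π(z) ≡ π h d(z) vanishes modulo I_q + (f_p), where f_{q+1} is still regular. Thus
    -- z is an element of A_1(q) plus f_p w modulo I_q, and x may be replaced by x - dw.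
    have h2 : X.proj₁ (q + 1) z ∈ idealTop (seqIdeal f q ⊔ Ideal.span {f p}) (X.B₁ (q + 1)) := by
      refine mem_idealTop_of_smul_mem (mem_seqIdeal_sup_of_mul_mem hreg hqp hp) ?_
      exact (Submodule.sub_mem_iff_right _ (map_mem_idealTop (X.proj₁ (q + 1) ∘ₗ X.h (q + 1)) h1)).1
        (idealTop_mono le_sup_left (X.hd (q + 1) (by omega) hq z))
    obtain ⟨y, hy⟩ := exists_sub_mem_of_mkQ_mem (X.mono₁ (Nat.le_succ q)) z h2
    obtain ⟨w, hw⟩ := mem_idealTop_sup_span.1 hy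
    let i₀ := Submodule.inclusion (X.mono₀ (Nat.le_succ q))
    let i₁ := Submodule.inclusion (X.mono₁ (Nat.le_succ q))
    have hi (y) : X.dp (q + 1) (i₁ y) = i₀ (X.dp q y) := rfl
    have h3 : f p • (x - X.dp (q + 1) w) - i₀ (X.dp q y) ∈
        idealTop (seqIdeal f q) (X.F₀ (q + 1)) := by
      have h4 := add_mem hz (map_mem_idealTop (X.dp (q + 1)) hw)
      convert h4 using 1
      rw [← hi, map_sub, map_sub, map_smul, smul_sub]
      abel
    let π : X.F₀ (q + 1) →ₗ[S] X.B₀ (q + 1) := ((X.F₀ q).submoduleOf (X.F₀ (q + 1))).mkQ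
    have hπ (a) : π (i₀ a) = 0 :=
      (Submodule.Quotient.mk_eq_zero ((X.F₀ q).submoduleOf (X.F₀ (q + 1)))).2 a.2
    have h4 : π (x - X.dp (q + 1) w) ∈ idealTop (seqIdeal f q) (X.B₀ (q + 1)) := by
      refine mem_idealTop_of_smul_mem (mem_seqIdeal_of_mul_mem hreg (by omega : q < p) hp) ?_
      have h5 := map_mem_idealTop π h3
      rwa [map_sub, hπ, sub_zero, map_smul] at h5
    -- The element x - dw agrees modulo I_q with an a in A_0(q) for which f_p a is a boundary, and
    -- induction applies to a.
    obtain ⟨a, ha⟩ := exists_sub_mem_of_mkQ_mem (X.mono₀ (Nat.le_succ q)) _ h4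
    have h5 : f p • a - X.dp q y ∈ idealTop (seqIdeal f q) (X.F₀ q) := by
      refine mem_idealTop_of_retract i₀ (ρ ∘ₗ (X.F₀ (q + 1)).subtype) hρ ?_
      have h6 := sub_mem h3 (Submodule.smul_mem _ (f p) ha)
      convert h6 using 1
      rw [map_sub, map_smul, smul_sub (f p) (x - X.dp (q + 1) w)]
      abel
    obtain ⟨w', hw'⟩ := ih (by omega) a y h5
    refine ⟨w + i₁ w', idealTop_mono (seqIdeal_mono f (Nat.le_succ q)) ?_⟩
    have h6 := add_mem ha (map_mem_idealTop i₀ hw')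
    convert h6 using 1
    rw [map_add, hi, map_sub]
    abel

omit [IsNoetherianRing S] hreg in
-- The map is π h composed with a splitting of A_0(p) → B_0(p); condition (a) passes to the
-- quotient.
theorem exists_bp_section {p : ℕ} (h1 : 1 ≤ p) (hp : p ≤ c) :
    ∃ g : X.B₀ p →ₗ[S] X.B₁ p, ∀ x, X.bp p (g x) - f p • x ∈ idealTop (seqIdeal f (p - 1)) (X.B₀ p) := by
  have := X.free_B₀ h1 hp
  obtain ⟨τ, hτ⟩ := Module.projective_lifting_property
    ((X.F₀ (p - 1)).submoduleOf (X.F₀ p)).mkQ (LinearMap.id : X.B₀ p →ₗ[S] X.B₀ p)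
    (Submodule.mkQ_surjective _)
  refine ⟨X.proj₁ p ∘ₗ X.h p ∘ₗ τ, fun x => ?_⟩
  have h2 := map_mem_idealTop ((X.F₀ (p - 1)).submoduleOf (X.F₀ p)).mkQ (X.dh p h1 hp (τ x))
  rw [map_sub, map_smul] at h2
  have h3 : ((X.F₀ (p - 1)).submoduleOf (X.F₀ p)).mkQ (τ x) = x := LinearMap.congr_fun hτ x
  rw [h3] at h2
  exact h2

/-- The section up to f_p from `exists_bp_section` gives the inequality; with equal ranks, the
determinant argument gives injectivity of b_p modulo I_{p-1}. -/
theorem finrank_B₀_le {p : ℕ} (h1 : 1 ≤ p) (hp : p ≤ c) :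
    Module.finrank S (X.B₀ p) ≤ Module.finrank S (X.B₁ p) ∧
    (Module.finrank S (X.B₁ p) = Module.finrank S (X.B₀ p) → ∀ y,
      X.bp p y ∈ idealTop (seqIdeal f (p - 1)) (X.B₀ p) →
      y ∈ idealTop (seqIdeal f (p - 1)) (X.B₁ p)) := by
  have := X.free_B₀ h1 hp
  have := X.free_B₁ h1 hp
  have := X.finite_F₀ hp
  have := X.finite_F₁ hp
  have := (seqQuot_isLocalRing hreg (p := p - 1) (by omega)).toNontrivial
  have hr := mk_mem_nonZeroDivisors hreg (p := p) (q := p - 1) (by omega) hp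
  have hI : RingHom.ker (algebraMap S (SeqQuot f (p - 1))) = seqIdeal f (p - 1) := Ideal.mk_ker
  obtain ⟨g, hg⟩ := exists_bp_section (X := X) h1 hp
  have h := baseChange_comp_eq _ _ _ _ hg
  refine ⟨?_, fun heq y hy => ?_⟩
  · have h2 := finrank_le_of_comp_eq_smul hr h
    rwa [Module.finrank_baseChange, Module.finrank_baseChange] at h2
  · have h2 := injective_of_comp_eq_smul_of_finrank_eq hr h (by
      rw [Module.finrank_baseChange, Module.finrank_baseChange, heq])
    rw [← one_tmul_eq_zero_iff (Q := SeqQuot f (p - 1)) hI] at hy ⊢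
    refine h2 ?_
    rw [LinearMap.baseChange_tmul, hy, map_zero]

/-- If the ranks were equal, b_p would be injective modulo I_{p-1}. For x in A_0(p-1), b_p(π h x) ≡
0 puts h x in A_1(p-1) modulo I_{p-1}, so f_p x is a boundary in A(p-1). As f_p is regular on
M(p-1), x itself is one, hence lies in 𝔪 A_0(p-1), and Nakayama's lemma gives A_0(p-1) = 0. -/
theorem finrank_B₀_lt (hmin : X.IsMinimal) {p : ℕ} (h1 : 1 ≤ p) (hp : p ≤ c)
    (hne : X.F₀ (p - 1) ≠ ⊥) : Module.finrank S (X.B₀ p) < Module.finrank S (X.B₁ p) := by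
  refine lt_of_le_of_ne (finrank_B₀_le hreg h1 hp).1 fun heq => hne ?_
  have hb := (finrank_B₀_le hreg h1 hp).2 heq.symm
  have := X.finite_F₀ (p := p - 1) (by omega)
  obtain ⟨ρ, hρ⟩ := X.exists_retraction₀ (p := p - 1) (by omega)
  let i₀ := Submodule.inclusion (X.mono₀ (Nat.sub_le p 1))
  let i₁ := Submodule.inclusion (X.mono₁ (Nat.sub_le p 1))
  have hi (y) : X.dp p (i₁ y) = i₀ (X.dp (p - 1) y) := rfl
  let π : X.F₀ p →ₗ[S] X.B₀ p := ((X.F₀ (p - 1)).submoduleOf (X.F₀ p)).mkQ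
  have hπ (a) : π (i₀ a) = 0 :=
    (Submodule.Quotient.mk_eq_zero ((X.F₀ (p - 1)).submoduleOf (X.F₀ p))).2 a.2
  have key (x : X.F₀ (p - 1)) : x ∈ idealTop 𝔪 (X.F₀ (p - 1)) := by
    have hdh : X.dp p (X.h p (i₀ x)) - f p • i₀ x ∈ idealTop (seqIdeal f (p - 1)) (X.F₀ p) :=
      X.dh p h1 hp (i₀ x)
    have h2 : X.proj₁ p (X.h p (i₀ x)) ∈ idealTop (seqIdeal f (p - 1)) (X.B₁ p) := by
      refine hb _ ?_
      have h3 := map_mem_idealTop π hdh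
      rw [map_sub, map_smul, hπ, smul_zero, sub_zero] at h3
      exact h3
    obtain ⟨z, hz⟩ := exists_sub_mem_of_mkQ_mem (X.mono₁ (Nat.sub_le p 1)) _ h2
    have h4 : f p • x - X.dp (p - 1) z ∈ idealTop (seqIdeal f (p - 1)) (X.F₀ (p - 1)) := by
      refine mem_idealTop_of_retract i₀ (ρ ∘ₗ (X.F₀ p).subtype) hρ ?_
      have h5 := sub_mem (map_mem_idealTop (X.dp p) hz) hdh
      convert h5 using 1
      rw [map_sub, map_smul, map_sub, hi]
      abel
    obtain ⟨w, hw⟩ := exists_sub_mem_of_smul_sub_mem hreg (by omega) hp x z h4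
    exact (Submodule.sub_mem_iff_left _ (dp_mem_maximalIdeal hmin (by omega) w)).1
      (idealTop_mono (seqIdeal_le_maximalIdeal hreg (by omega)) hw)
  have := subsingleton_of_forall_mem_maximalIdeal key
  exact (Submodule.eq_bot_iff _).2 fun x hx =>
    congrArg Subtype.val (Subsingleton.elim (⟨x, hx⟩ : X.F₀ (p - 1)) 0)

omit [IsNoetherianRing S] in
-- If B_0(p) = 0 then d y lies in A_0(p-1), so f_p π(y) ≡ π h d(y) is in the image of the map of the
-- pre-stability condition. Hence so is π(y) modulo I_{p-1}. That image lies in 𝔪 B_1(p) by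
-- minimality, and Nakayama's lemma applies.
theorem finrank_B₁_eq_zero (hmin : X.IsMinimal) (hpre : X.IsPreStable) {p : ℕ} (h1 : 1 ≤ p)
    (hp : p ≤ c) (h0 : Module.finrank S (X.B₀ p) = 0) : Module.finrank S (X.B₁ p) = 0 := by
  have := X.free_B₀ h1 hp
  have := X.free_B₁ h1 hp
  have := X.finite_F₀ hp
  have := X.finite_F₁ hp
  have h2 : Subsingleton (X.B₀ p) := (Module.finrank_eq_zero_iff_of_free S _).1 h0
  have hI : RingHom.ker (algebraMap S (SeqQuot f (p - 1))) = seqIdeal f (p - 1) := Ideal.mk_ker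
  have hQ : Function.Surjective (algebraMap S (SeqQuot f (p - 1))) := Ideal.Quotient.mk_surjective
  have hstab (a) : X.stabMap p a ∈ idealTop 𝔪 (X.B₁ p) :=
    map_mem_idealTop (X.proj₁ p) (h_mem_maximalIdeal hmin h1 hp _)
  have key (y : X.B₁ p) : y ∈ idealTop 𝔪 (X.B₁ p) := by
    obtain ⟨y, rfl⟩ := Submodule.mkQ_surjective _ y
    have h3 : ((X.dp p y : X.F₀ p) : A₀) ∈ X.F₀ (p - 1) :=
      (Submodule.Quotient.mk_eq_zero ((X.F₀ (p - 1)).submoduleOf (X.F₀ p))).1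
        (Subsingleton.elim (Submodule.Quotient.mk (X.dp p y)) 0)
    have h4 : X.stabMap p ⟨_, h3⟩ - f p • X.proj₁ p y ∈ idealTop (seqIdeal f (p - 1)) (X.B₁ p) :=
      X.hd p h1 hp y
    rw [← one_tmul_eq_zero_iff (Q := SeqQuot f (p - 1)) hI, TensorProduct.tmul_sub, sub_eq_zero]
      at h4
    have h5 : (Submodule.Quotient.mk ((1 : SeqQuot f (p - 1)) ⊗ₜ[S] X.proj₁ p y) :
        (SeqQuot f (p - 1) ⊗[S] X.B₁ p) ⧸
          LinearMap.range ((X.stabMap p).baseChange (SeqQuot f (p - 1)))) = 0 := by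
      refine hpre p h1 hp ?_
      change f p • _ = f p • _
      rw [smul_zero, ← Submodule.Quotient.mk_smul, Submodule.Quotient.mk_eq_zero,
        ← TensorProduct.tmul_smul, ← h4]
      exact ⟨1 ⊗ₜ ⟨_, h3⟩, LinearMap.baseChange_tmul _ _ _⟩
    rw [Submodule.Quotient.mk_eq_zero] at h5
    obtain ⟨a, ha⟩ := h5
    obtain ⟨a, rfl⟩ := exists_one_tmul_eq hQ a
    rw [LinearMap.baseChange_tmul, ← sub_eq_zero, ← TensorProduct.tmul_sub,
      one_tmul_eq_zero_iff hI] at ha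
    exact (Submodule.sub_mem_iff_right _ (hstab a)).1
      (idealTop_mono (seqIdeal_le_maximalIdeal hreg (by omega)) ha)
  have := subsingleton_of_forall_mem_maximalIdeal key
  exact Module.finrank_zero_of_subsingleton

/-- The ranks of the parts below the top non-zero part. -/
theorem finrank_B_of_gt (hmin : X.IsMinimal) (hpre : X.IsPreStable) {γ : ℕ} (hγ : X.IsTopIndex γ)
    {p : ℕ} (hγp : γ < p) (hp : p ≤ c) :
    Module.finrank S (X.B₀ p) < Module.finrank S (X.B₁ p) ∧ 0 < Module.finrank S (X.B₀ p) := by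
  have hne : X.F₀ (p - 1) ≠ ⊥ := by
    intro h
    have h0 : X.F₀ γ = ⊥ := le_bot_iff.1 ((X.mono₀ (by omega)).trans h.le)
    have : Subsingleton (X.F₀ γ) := by rw [h0]; infer_instance
    have : Subsingleton (X.B₀ γ) := (Submodule.mkQ_surjective _).subsingleton
    have h2 := (finrank_B_top hreg hγ).1.2
    rw [Module.finrank_zero_of_subsingleton] at h2
    omega
  have hlt := finrank_B₀_lt hreg hmin (by omega) hp hne
  refine ⟨hlt, Nat.pos_of_ne_zero fun h0 => ?_⟩
  rw [finrank_B₁_eq_zero hreg hmin hpre (by omega) hp h0] at hlt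
  omega

end HMF

/-! ### Growth of Betti numbers -/

section Asymptotics

open Filter Asymptotics

theorem zpow_isBigO_zpow {a b : ℤ} (h : a ≤ b) :
    (fun i : ℕ => (i : ℝ) ^ a) =O[atTop] fun i : ℕ => (i : ℝ) ^ b := by
  refine IsBigO.of_bound 1 ?_
  filter_upwards [eventually_ge_atTop 1] with i hi
  have hi : (1 : ℝ) ≤ i := by exact_mod_cast hi
  rw [one_mul, Real.norm_of_nonneg (by positivity), Real.norm_of_nonneg (by positivity)]
  exact zpow_le_zpow_right₀ hi h

theorem zpow_mul_cast_isBigO (a : ℤ) :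
    (fun i : ℕ => (i : ℝ) ^ a * i) =O[atTop] fun i : ℕ => (i : ℝ) ^ (a + 1) := by
  refine EventuallyEq.isBigO ?_
  filter_upwards [eventually_ge_atTop 1] with i hi
  have hi : (i : ℝ) ≠ 0 := by positivity
  exact (zpow_add_one₀ hi a).symm

theorem isBigO_of_sub_isBigO {H : ℕ → ℝ} {β : ℝ} {k : ℕ}
    (h : (fun i : ℕ => H i - β * (i : ℝ) ^ k) =O[atTop] fun i : ℕ => (i : ℝ) ^ ((k : ℤ) - 1)) :
    H =O[atTop] fun i : ℕ => (i : ℝ) ^ (k : ℤ) := by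
  have h1 := (h.trans (zpow_isBigO_zpow (by omega : (k : ℤ) - 1 ≤ k))).add
    ((isBigO_refl (fun i : ℕ => (i : ℝ) ^ (k : ℤ)) atTop).const_mul_left β)
  refine h1.congr_left fun i => ?_
  rw [zpow_natCast, sub_add_cancel]

/-- Induction by (k+1) C(i+k+1, k+1) = (i+k+1) C(i+k, k). For k = 0 the exponent on the right is -1,
and the difference is exactly zero. -/
theorem choose_sub_isBigO (k : ℕ) :
    (fun i : ℕ => (((i + k).choose k : ℕ) : ℝ) - ((k.factorial : ℝ)⁻¹) * (i : ℝ) ^ k) =O[atTop]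
      fun i : ℕ => (i : ℝ) ^ ((k : ℤ) - 1) := by
  induction k with
  | zero =>
    refine (isBigO_zero _ _).congr_left fun i => ?_
    simp
  | succ k ih =>
    have h1 := (ih.mul (isBigO_refl (fun i : ℕ => (i : ℝ)) atTop)).trans (zpow_mul_cast_isBigO _)
    rw [sub_add_cancel] at h1
    have h2 := (h1.const_mul_left ((k : ℝ) + 1)⁻¹).add (isBigO_of_sub_isBigO ih)
    have h3 : ((k + 1 : ℕ) : ℤ) - 1 = k := by push_cast; ring
    rw [h3]
    refine h2.congr_left fun i => ?_
    have h4 : ((i + (k + 1)).choose (k + 1) : ℝ) * (k + 1) = (i + k + 1) * (i + k).choose k := by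
      have := Nat.add_one_mul_choose_eq (i + k) k
      rw [add_assoc i k 1] at this
      exact_mod_cast this.symm
    have hk : (k : ℝ) + 1 ≠ 0 := by positivity
    have hk' : (k.factorial : ℝ) ≠ 0 := by positivity
    have h5 : ((i + (k + 1)).choose (k + 1) : ℝ) = (i + k + 1) * (i + k).choose k / (k + 1) := by
      rw [← h4, mul_div_cancel_right₀ _ hk]
    rw [h5, Nat.factorial_succ]
    push_cast
    field_simp
    ring

/-- The q-th summand is a polynomial in i of degree at most p-1-q, so the term q = s dominates and
the later ones go into the error. -/
theorem hasMultiplicity_sum_choose (b : ℕ → ℕ) {s p : ℕ} (hsp : s < p) (hb : ∀ q < s, b q = 0) :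
    HasMultiplicity
      (fun i => ∑ q ∈ Finset.range p, b q * (i + (p - 1 - q)).choose (p - 1 - q)) (p - s) (b s) := by
  refine ⟨by omega, ?_⟩
  have h1 : ((p - s : ℕ) : ℤ) - 2 = ((p - 1 - s : ℕ) : ℤ) - 1 := by omega
  have h2 : p - s - 1 = p - 1 - s := by omega
  rw [h1, h2]
  have h3 : (fun i : ℕ => ∑ q ∈ Finset.range p,
      ((b q : ℝ) * (i + (p - 1 - q)).choose (p - 1 - q) -
        if q = s then (b s : ℝ) * (((p - 1 - s).factorial : ℝ)⁻¹ * (i : ℝ) ^ (p - 1 - s)) else 0))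
      =O[atTop] fun i : ℕ => (i : ℝ) ^ (((p - 1 - s : ℕ) : ℤ) - 1) := by
    refine IsBigO.fun_sum fun q hq => ?_
    have hq := Finset.mem_range.1 hq
    rcases lt_trichotomy q s with h | h | h
    · refine (isBigO_zero _ _).congr_left fun i => ?_
      rw [if_neg h.ne, hb q h, Nat.cast_zero, zero_mul, sub_zero]
    · subst h
      refine ((choose_sub_isBigO (p - 1 - q)).const_mul_left (b q : ℝ)).congr_left fun i => ?_
      rw [if_pos rfl, mul_sub]
    · refine (((isBigO_of_sub_isBigO (choose_sub_isBigO (p - 1 - q))).trans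
        (zpow_isBigO_zpow (by omega))).const_mul_left (b q : ℝ)).congr_left fun i => ?_
      rw [if_neg h.ne', sub_zero]
  refine h3.congr_left fun i => ?_
  rw [Finset.sum_sub_distrib, Finset.sum_ite_eq' (Finset.range p) s,
    if_pos (Finset.mem_range.2 hsp)]
  push_cast
  rw [div_eq_mul_inv, mul_assoc]

theorem HasMultiplicity.isBigO {H : ℕ → ℕ} {μ β : ℕ} (h : HasMultiplicity H μ β) :
    (fun i => (H i : ℝ)) =O[atTop] fun i : ℕ => (i : ℝ) ^ ((μ : ℤ) - 1) := by
  obtain ⟨h1, h2⟩ := h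
  have h3 : (μ : ℤ) - 2 = ((μ - 1 : ℕ) : ℤ) - 1 := by omega
  have h4 : (μ : ℤ) - 1 = (μ - 1 : ℕ) := by omega
  rw [h3] at h2
  rw [h4]
  exact isBigO_of_sub_isBigO h2

/-- Otherwise i^{μ-1} would be O(i^{μ-2}), and i would be bounded. -/
theorem HasMultiplicity.not_isBigO {H : ℕ → ℕ} {μ β : ℕ} (h : HasMultiplicity H μ β) (hβ : 0 < β) :
    ¬ (fun i => (H i : ℝ)) =O[atTop] fun i : ℕ => (i : ℝ) ^ ((μ : ℤ) - 2) := by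
  intro h1
  obtain ⟨hμ, h2⟩ := h
  have hc : (0 : ℝ) < (β : ℝ) / ((μ - 1).factorial : ℝ) := by positivity
  obtain ⟨C, hC⟩ := (h1.sub h2).bound
  have h3 : ∀ᶠ i : ℕ in atTop, (i : ℝ) ≤ C / ((β : ℝ) / ((μ - 1).factorial : ℝ)) := by
    filter_upwards [hC, eventually_ge_atTop 1] with i hi hi1
    have hi0 : (0 : ℝ) < i := by exact_mod_cast hi1
    rw [sub_sub_cancel, Real.norm_of_nonneg (by positivity), Real.norm_of_nonneg (by positivity)]
      at hi
    have h4 : (i : ℝ) ^ (μ - 1) = (i : ℝ) ^ ((μ : ℤ) - 2) * i := by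
      rw [← zpow_add_one₀ hi0.ne', ← zpow_natCast]
      congr 1
      omega
    rw [h4] at hi
    have h5 : (0 : ℝ) < (i : ℝ) ^ ((μ : ℤ) - 2) := by positivity
    rw [le_div_iff₀ hc]
    refine le_of_mul_le_mul_right ?_ h5
    calc _ = (β : ℝ) / ((μ - 1).factorial : ℝ) * ((i : ℝ) ^ ((μ : ℤ) - 2) * i) := by ring
      _ ≤ _ := hi
  obtain ⟨i, hi, hi'⟩ := (h3.and (tendsto_natCast_atTop_atTop.eventually_gt_atTop
    (C / ((β : ℝ) / ((μ - 1).factorial : ℝ))))).exists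
  linarith

/-- Even and odd degrees together bound the growth from above; the even degrees alone, with positive
leading coefficient, exclude a smaller exponent. -/
theorem complexity_eq_of_hasMultiplicity {R : Type u} [CommRing R] [IsLocalRing R]
    {N : ModuleCat.{u} R} {μ β β' : ℕ}
    (h : HasMultiplicity (fun i => bettiNumber R N (2 * i)) μ β)
    (h' : HasMultiplicity (fun i => bettiNumber R N (2 * i + 1)) μ β') (hβ : 0 < β) :
    complexity R N = μ := by
  have hμ := h.1
  have hcast : (μ : ℤ) - 1 = (μ - 1 : ℕ) := by omega
  refine le_antisymm (sInf_le ⟨μ, rfl, ?_⟩) (le_sInf ?_)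
  · obtain ⟨C, hC⟩ := h.isBigO.bound
    obtain ⟨C', hC'⟩ := h'.isBigO.bound
    obtain ⟨n, hn⟩ := eventually_atTop.1 (hC.and hC')
    -- A nonnegative constant is needed to pass from the power of ⌊k/2⌋ to the power of k.
    refine ⟨max 0 (max C C'), ?_⟩
    filter_upwards [eventually_ge_atTop (2 * n)] with k hk
    obtain ⟨h1, h2⟩ := hn (k / 2) (by omega)
    simp only [hcast, zpow_natCast, norm_pow, Real.norm_natCast] at h1 h2 ⊢
    have h3 : ((k / 2 : ℕ) : ℝ) ^ (μ - 1) ≤ (k : ℝ) ^ (μ - 1) :=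
      pow_le_pow_left₀ (Nat.cast_nonneg _) (by exact_mod_cast Nat.div_le_self k 2) _
    have h4 : (0 : ℝ) ≤ ((k / 2 : ℕ) : ℝ) ^ (μ - 1) := by positivity
    have h5 : (bettiNumber R N k : ℝ) ≤ max C C' * ((k / 2 : ℕ) : ℝ) ^ (μ - 1) := by
      rcases Nat.even_or_odd' k with ⟨m, hm | hm⟩
      · rw [show 2 * (k / 2) = k by omega] at h1
        exact h1.trans (mul_le_mul_of_nonneg_right (le_max_left _ _) h4)
      · rw [show 2 * (k / 2) + 1 = k by omega] at h2
        exact h2.trans (mul_le_mul_of_nonneg_right (le_max_right _ _) h4)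
    exact h5.trans (mul_le_mul (le_max_right _ _) h3 h4 (le_max_left _ _))
  · rintro _ ⟨q, rfl, w, hw⟩
    by_contra hlt
    have hq : q < μ := by exact_mod_cast not_le.1 hlt
    refine h.not_isBigO hβ ?_
    have h1 : (fun i : ℕ => (bettiNumber R N (2 * i) : ℝ)) =O[atTop]
        fun i : ℕ => (i : ℝ) ^ ((q : ℤ) - 1) := by
      refine IsBigO.of_bound (w * 2 ^ ((q : ℤ) - 1)) ?_
      have htend : Tendsto (fun i : ℕ => 2 * i) atTop atTop :=
        tendsto_id.const_mul_atTop' (by norm_num)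
      filter_upwards [htend.eventually hw] with i hi
      rw [Real.norm_natCast, Real.norm_of_nonneg (by positivity), mul_assoc, ← mul_zpow]
      exact_mod_cast hi
    exact h1.trans (zpow_isBigO_zpow (by omega))

end Asymptotics

/-- In terms of generating functions in i, (1 - t) E_{p+1} = E_p + b_p, so E_p is the sum of b_q (1
- t)^{-(p-q)}. The proof is Pascal's rule. -/
theorem eq_sum_choose_of_recursion {E : ℕ → ℕ → ℕ} {b : ℕ → ℕ} {c : ℕ} (h0 : ∀ i, E 0 i = 0)
    (h1 : ∀ p < c, E (p + 1) 0 = E p 0 + b p)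
    (h2 : ∀ p i, E (p + 1) (i + 1) = E p (i + 1) + E (p + 1) i) {p : ℕ} (hp : p ≤ c) (i : ℕ) :
    E p i = ∑ q ∈ Finset.range p, b q * (i + (p - 1 - q)).choose (p - 1 - q) := by
  induction p generalizing i with
  | zero => simp [h0]
  | succ p ih =>
    induction i with
    | zero => simp [h1 p hp, ih (by omega), Finset.sum_range_succ]
    | succ i ih' =>
      rw [h2, ih (by omega), ih', Finset.sum_range_succ, Finset.sum_range_succ, ← add_assoc,
        ← Finset.sum_add_distrib]
      simp only [Nat.add_sub_cancel, Nat.sub_self, add_zero, Nat.choose_zero_right]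
      congr 1
      refine Finset.sum_congr rfl fun q hq => ?_
      have hq := Finset.mem_range.1 hq
      obtain ⟨k, hk⟩ : ∃ k, p - q = k + 1 := ⟨p - q - 1, by omega⟩
      rw [show p - 1 - q = k by omega, hk, ← mul_add]
      congr 1
      rw [show i + 1 + (k + 1) = (i + 1 + k) + 1 by ring, Nat.choose_succ_succ,
        show i + (k + 1) = i + 1 + k by ring]

/-! ### Betti numbers of M as sums of binomial coefficients -/

namespace HMF

variable {S : Type u} [CommRing S] [IsLocalRing S] {f : ℕ → S} {c : ℕ}
  {A₀ A₁ : Type u} [AddCommGroup A₀] [Module S A₀] [AddCommGroup A₁] [Module S A₁]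
  {X : HMF f c A₀ A₁}

theorem resRank_zero_right (p : ℕ) : X.resRank p 0 = Module.finrank S (X.F₀ p) := by
  cases p with
  | zero =>
    have : Subsingleton (X.F₀ 0) := by rw [X.zero₀]; infer_instance
    rw [resRank, Module.finrank_zero_of_subsingleton]
  | succ p => rw [resRank]

theorem resRank_one_right (p : ℕ) : X.resRank p 1 = Module.finrank S (X.F₁ p) := by
  cases p with
  | zero =>
    have : Subsingleton (X.F₁ 0) := by rw [X.zero₁]; infer_instance
    rw [resRank, Module.finrank_zero_of_subsingleton]
  | succ p => rw [resRank]

theorem resRank_even {p : ℕ} (hp : p ≤ c) (i : ℕ) :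
    X.resRank p (2 * i) = ∑ q ∈ Finset.range p,
      Module.finrank S (X.B₀ (q + 1)) * (i + (p - 1 - q)).choose (p - 1 - q) := by
  refine eq_sum_choose_of_recursion (E := fun p i => X.resRank p (2 * i))
    (fun i => by rw [resRank]) (fun p hp => ?_) (fun p i => ?_) hp i
  · rw [mul_zero, resRank_zero_right, resRank_zero_right, X.finrank_F₀_succ hp]
  · rw [mul_add, mul_one, resRank]

theorem resRank_odd {p : ℕ} (hp : p ≤ c) (i : ℕ) :
    X.resRank p (2 * i + 1) = ∑ q ∈ Finset.range p,
      Module.finrank S (X.B₁ (q + 1)) * (i + (p - 1 - q)).choose (p - 1 - q) := by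
  refine eq_sum_choose_of_recursion (E := fun p i => X.resRank p (2 * i + 1))
    (fun i => by rw [resRank]) (fun p hp => ?_) (fun p i => ?_) hp i
  · rw [mul_zero, zero_add, resRank_one_right, resRank_one_right, X.finrank_F₁_succ hp]
  · rw [mul_add, mul_one, add_right_comm, resRank]

/-- The complexity and the Betti degree of `M`. -/
theorem complexity_and_hasBettiDegree [IsNoetherianRing S] [IsLocalRing (SeqQuot f c)]
    (hreg : RingTheory.Sequence.IsRegular S (seqList f c)) (hmin : X.IsMinimal) {γ : ℕ}
    (hγ : X.IsTopIndex γ) :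
    complexity (SeqQuot f c) X.hmfModule = ((c - γ + 1 : ℕ) : ℕ∞) ∧
      HasBettiDegree (SeqQuot f c) X.hmfModule (X.topPart hγ).size := by
  have h1 : 1 ≤ γ := hγ.1.1.1
  have h2 : γ ≤ c := hγ.1.1.2
  obtain ⟨⟨heq, hpos⟩, hsize⟩ := finrank_B_top hreg hγ
  obtain ⟨Y, ε, hY, hr⟩ := exists_resolves_M hreg hmin (p := c) le_rfl
  obtain ⟨hb, he, -⟩ := hY.homological (Ideal.Quotient.mk (seqIdeal f c))
    Ideal.Quotient.mk_surjective Ideal.mk_ker X.hmfModule (AddEquiv.refl (X.M c))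
    (fun s x => rfl)
  have hzero (q : ℕ) (hq : q < γ - 1) := finrank_B_of_lt hγ (p := q + 1) (by omega)
  have hs : γ - 1 + 1 = γ := by omega
  have hμ : c - (γ - 1) = c - γ + 1 := by omega
  have heven := hasMultiplicity_sum_choose (fun q => Module.finrank S (X.B₀ (q + 1)))
    (s := γ - 1) (p := c) (by omega) fun q hq => (hzero q hq).2
  have hodd := hasMultiplicity_sum_choose (fun q => Module.finrank S (X.B₁ (q + 1)))
    (s := γ - 1) (p := c) (by omega) fun q hq => (hzero q hq).1
  have hB₀ : Module.finrank S (X.B₀ (γ - 1 + 1)) = (X.topPart hγ).size := by rw [hs, hsize]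
  have hB₁ : Module.finrank S (X.B₁ (γ - 1 + 1)) = (X.topPart hγ).size := by rw [hs, hsize, heq]
  simp only [← resRank_even le_rfl, ← resRank_odd le_rfl, hμ, hB₀, hB₁, ← hr] at heven hodd
  rw [← hsize] at hpos
  have hc : complexity (SeqQuot f c) X.hmfModule = ((c - γ + 1 : ℕ) : ℕ∞) := by
    refine complexity_eq_of_hasMultiplicity (β' := (X.topPart hγ).size) ?_ ?_ hpos
    · simpa only [hb] using heven
    · simpa only [hb] using hodd
  refine ⟨hc, c - γ + 1, hc, ?_, ?_⟩
  · simpa only [he] using heven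
  · simpa only [he] using hodd

end HMF

end

/-! ### The main theorem -/

theorem mainTheorem8 {S : Type u} [CommRing S] [IsNoetherianRing S] [IsLocalRing S]
    (c : ℕ) (f : ℕ → S) (hreg : RingTheory.Sequence.IsRegular S (seqList f c))
    {A₀ A₁ : Type u} [AddCommGroup A₀] [Module S A₀] [AddCommGroup A₁] [Module S A₁]
    (X : HMF f c A₀ A₁) (hmin : X.IsMinimal) (hpre : X.IsPreStable)
    (γ : ℕ) (hγ : X.IsTopIndex γ) :
    haveI : IsLocalRing (SeqQuot f c) := seqQuot_isLocalRing hreg le_rfl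
    complexity (SeqQuot f c) X.hmfModule = ((c - γ + 1 : ℕ) : ℕ∞) ∧
    (∀ p, 1 ≤ p → p < γ →
      Module.finrank S (X.B₁ p) = 0 ∧ Module.finrank S (X.B₀ p) = 0) ∧
    (Module.finrank S (X.B₁ γ) = Module.finrank S (X.B₀ γ) ∧
      0 < Module.finrank S (X.B₀ γ)) ∧
    (∀ p, γ < p → p ≤ c →
      Module.finrank S (X.B₀ p) < Module.finrank S (X.B₁ p) ∧
      0 < Module.finrank S (X.B₀ p)) ∧
    HasBettiDegree (SeqQuot f c) X.hmfModule (X.topPart hγ).size ∧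
    ∀ p (hp : p < γ),
      haveI hpc : p ≤ c := hp.le.trans hγ.1.1.2
      haveI : IsLocalRing (SeqQuot f p) := seqQuot_isLocalRing hreg hpc
      projectiveDimension
        ((ModuleCat.restrictScalars (seqQuotMap f hpc)).obj X.hmfModule) < ⊤ ∧
      poincareSeries S
          ((ModuleCat.restrictScalars (Ideal.Quotient.mk (seqIdeal f c))).obj X.hmfModule) =
        (1 + PowerSeries.X) ^ p *
          poincareSeries (SeqQuot f p)
            ((ModuleCat.restrictScalars (seqQuotMap f hpc)).obj X.hmfModule) := by
  have : IsLocalRing (SeqQuot f c) := seqQuot_isLocalRing hreg le_rfl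
  obtain ⟨hcx, hdeg⟩ := HMF.complexity_and_hasBettiDegree hreg hmin hγ
  refine ⟨hcx, fun p _ hp => HMF.finrank_B_of_lt hγ hp, (HMF.finrank_B_top hreg hγ).1,
    fun p hγp hp => HMF.finrank_B_of_gt hreg hmin hpre hγ hγp hp, hdeg, fun p hp => ?_⟩
  have hpc : p ≤ c := hp.le.trans hγ.1.1.2
  have : IsLocalRing (SeqQuot f p) := seqQuot_isLocalRing hreg hpc
  exact HMF.projectiveDimension_lt_top_and_poincareSeries hreg hmin hγ hp hpc
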